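/- Let $d\ge 2$. For a set $E\subset\mathbb{R}^d$ let $$\mathrm{Fav}(E):=\int_{\mathbb{S}^{d-1}}\mathcal{H}^1(\pi_\theta(E))\,d\sigma^{d-1}(\theta),\qquad \pi_\theta(x)=x\cdot\theta,$$ where $\sigma^{d-1}$ is the standard surface measure on the unit sphere $\mathbb{S}^{d-1}$ and $\mathcal{H}^1$ is the one-dimensional Hausdorff measure on $\mathbb{R}$, and for $\delta>0$ let $\mathcal{N}_\delta(E):=\{x\in\mathbb{R}^d: |x-a|<\delta\text{ for some }a\in E\}$, with $|\cdot|$ the Euclidean norm. Put $A:=\{0,2^d-1\}$ and, for integers $N\ge 1$, $$A^N:=2^{-d}A+2^{-2d}A+\cdots+2^{-Nd}A,\qquad \mathcal{K}_d^N:=(\underbrace{A^N\times\cdots\times A^N}_{d\text{ times}})+[0,2^{-dN}]^d.$$ Let $\mathcal{K}_d^\infty:=\bigcap_{N=1}^\infty\mathcal{K}_d^N\subset\mathbb{R}^d$ be the $2^d$-corner Cantor set. **Theorem.** For every $d\ge 2$ there exist $\epsilon\in(0,1)$, a constant $C>0$ and an integer $N_0$ (which may depend on $d$, but not on $N$) such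 that for all integers $N\ge N_0$ $$C^{-1}N^{-1}\;\le\;\mathrm{Fav}\big(\mathcal{N}_{2^{-dN}}(\mathcal{K}_d^\infty)\big)\;\le\;C\,N^{-\epsilon}.$$ -/

import Mathlib

open MeasureTheory
open scoped Pointwise ENNReal

noncomputable section

/-- The Favard length of `E ⊆ ℝ^d`: the integral, over the unit sphere with its (unnormalized)
surface measure, of the one-dimensional Hausdorff measure of the projection
`π_θ(E) = {x ⬝ θ : x ∈ E} ⊆ ℝ`. -/
def favardLength {d : ℕ} (E : Set (EuclideanSpace ℝ (Fin d))) : ℝ≥0∞ :=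
  ∫⁻ θ : Metric.sphere (0 : EuclideanSpace ℝ (Fin d)) 1,
    Measure.hausdorffMeasure (1 : ℝ)
      ((fun x : EuclideanSpace ℝ (Fin d) => inner ℝ x (θ : EuclideanSpace ℝ (Fin d))) '' E)
    ∂((volume : Measure (EuclideanSpace ℝ (Fin d))).toSphere)

/-- The digit set `A = {0, 2^d - 1}`. -/
def cornerDigits (d : ℕ) : Set ℤ := {0, 2 ^ d - 1}

/-- The multiscale digit set `A^N = 2^{-d} A + 2^{-2d} A + ⋯ + 2^{-Nd} A`. -/
def multiscaleDigits (d N : ℕ) : Set ℝ :=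
  {x | ∃ a : ℕ → ℤ, (∀ n, a n ∈ cornerDigits d) ∧
    x = ∑ n ∈ Finset.Icc 1 N, (a n : ℝ) * ((2 : ℝ) ^ (d * n))⁻¹}

/-- The `N`-th Cantor iterate `(A^N × ⋯ × A^N) + [0, 2^{-dN}]^d ⊆ ℝ^d`. -/
def cornerCantorIterate (d N : ℕ) : Set (EuclideanSpace ℝ (Fin d)) :=
  {x : EuclideanSpace ℝ (Fin d) | ∀ i, x i ∈ multiscaleDigits d N} +
    {x : EuclideanSpace ℝ (Fin d) | ∀ i, x i ∈ Set.Icc (0 : ℝ) ((2 : ℝ) ^ (d * N))⁻¹}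

/-- The `2^d`-corner Cantor set, the intersection of all its iterates with `N ≥ 1`. -/
def cornerCantorSet (d : ℕ) : Set (EuclideanSpace ℝ (Fin d)) :=
  ⋂ (N : ℕ) (_ : 1 ≤ N), cornerCantorIterate d N

end

/-!
Write `L = 2 ^ d`. The `N`-th Cantor iterate consists of `L ^ N` cubes addressed by the words of
length `N` over the alphabet `{0, 1} ^ d` of corners, and the projection in direction `θ` of the
cube addressed by `w` is an interval of length comparable to `L ^ (-N)` near the point
`pos (cornerValue θ) w`. Both bounds are statements about the counting function `stack` of these
intervals and its squared `L²` norm `energy`.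

Upper bound. For a fixed direction, suppose that `energy` at some generation `n ≤ N` exceeds a
multiple of `K`. Decomposing every word at its first prefix over which more than `K` intervals are
stacked gives a recursive inequality for the energy, so the words with a stacked prefix must have
mass at least of order `1 / K` (`energy_le`). By the Vitali covering lemma the stacked intervals of
mass `q` occupy length at most of order `q / K`, and by self-similarity the complementary words can
be decomposed again and again; after order `K ^ 2` rounds the whole projection has length of order
`1 / K` (`volume_coverSet_le`).

The remaining directions, in which the energy stays below a multiple of `K` at all generations up to
`N`, form a small set (`measure_lowEnergyDirections_le`). In such a direction Plancherel's theorem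
bounds the integral over `[0, 1]` of the Riesz product `∏ₖ ∏ⱼ cos² (L ^ k θⱼ y)` by a multiple of
`K L ^ (-n)` for each `n ≤ N` (`integral_rieszProd_le`). Since a product of squared cosines has
nonnegative Fourier coefficients, the high frequency factor `m ≤ k < n` has integral at least
`L ^ (m - n) / 2`, of which at most a half lies near the origin, where the energy bound applies to
the rescaled product. The low frequency factor `k < m` is essentially bounded below by powers of
`sin (L ^ m θⱼ y)`; so unless much of the mass of the high frequency factor sits near zeros of these
sines, the full product is large on `[L ^ (-m), 1]`. By self-similarity the contributions of the
`I` lengths `m, 2 m, …, I m` live on disjoint annuli, so for large `I` they cannot all be large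
(`sum_integral_rieszProd_le`). On the other hand, in polar coordinates the average over all
directions of the mass near the zeros is an integral over the unit ball of `ℝ ^ d`, where the
coordinates separate; the mass of one factor within `L ^ (-l)` of the zeros is smaller by
`(2 / L) ^ l`, which for `l = 2 d m` beats all losses (`lintegral_sphere_badProd_le`). Chebyshev's
inequality finishes the estimate. Taking `K` to be a multiple of `L ^ m` and `I` a power of `L ^ m`,
with `N` between two consecutive powers of a power of `L`, yields the exponent `ε`.

Lower bound. By the second moment method (`sub_energy_le_volume`) it suffices that the average over
all directions of the energy is `O(N)`. Two corners whose addresses share `k` letters are at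
distance at least of order `L ^ (-k)`, so they project to within `L ^ (-N)` of each other only in
a set of directions of measure `O(L ^ (k - N))` (`toSphere_real_collision_le`), and each of the
`N + 1` values of `k` contributes `O(1)` to the average of the energy.
-/

/-! ### Words over a finite alphabet -/

/-- The position `∑ₖ v(wₖ) L⁻ᵏ` (with `k` starting at `1`, and `L` the size of the alphabet) of the
word `w` on the line. -/
noncomputable def pos {α : Type*} [Fintype α] (v : α → ℝ) : List α → ℝ
  | [] => 0
  | a :: w => (v a + pos v w) / Fintype.card α

lemma pos_append {α : Type*} [Fintype α] [Nonempty α] {v : α → ℝ} (u w : List α) :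
    pos v (u ++ w) = pos v u + ((Fintype.card α : ℝ) ^ u.length)⁻¹ * pos v w := by
  have hc : (0 : ℝ) < Fintype.card α := by exact_mod_cast Fintype.card_pos
  induction u with
  | nil => simp [pos]
  | cons a u ih =>
    simp only [List.cons_append, pos, ih, List.length_cons, pow_succ]
    field_simp
    ring

lemma abs_pos_le {α : Type*} [Fintype α] [Nonempty α] {v : α → ℝ} {D : ℝ}
    (hv : ∀ a, |v a| ≤ D * (Fintype.card α - 1)) (w : List α) :
    |pos v w| ≤ D * (1 - ((Fintype.card α : ℝ) ^ w.length)⁻¹) := by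
  have hc : (0 : ℝ) < Fintype.card α := by exact_mod_cast Fintype.card_pos
  induction w with
  | nil => simp [pos]
  | cons a w ih =>
    simp only [pos, List.length_cons]
    rw [abs_div, abs_of_pos hc, div_le_iff₀ hc]
    calc |v a + pos v w| ≤ |v a| + |pos v w| := abs_add_le _ _
      _ ≤ D * (Fintype.card α - 1) + D * (1 - ((Fintype.card α : ℝ) ^ w.length)⁻¹) :=
          add_le_add (hv a) ih
      _ = _ := by rw [pow_succ]; field_simp; ring

/-- The interval of a word is contained in the interval of each of its prefixes; the bound on the
digit values `v` is exactly what makes this true. -/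
lemma mem_closedBall_prefix {α : Type*} [Fintype α] [Nonempty α] {v : α → ℝ} {D : ℝ}
    (hv : ∀ a, |v a| ≤ D * (Fintype.card α - 1))
    (s u : List α) {x : ℝ}
    (hx : x ∈ Metric.closedBall (pos v (s ++ u))
      (D * ((Fintype.card α : ℝ) ^ (s ++ u).length)⁻¹)) :
    x ∈ Metric.closedBall (pos v s) (D * ((Fintype.card α : ℝ) ^ s.length)⁻¹) := by
  have hc : (0 : ℝ) < Fintype.card α := by exact_mod_cast Fintype.card_pos
  rw [Metric.mem_closedBall, Real.dist_eq] at hx ⊢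
  rw [pos_append] at hx
  have hu := mul_le_mul_of_nonneg_left (abs_pos_le hv u)
    (show 0 ≤ ((Fintype.card α : ℝ) ^ s.length)⁻¹ by positivity)
  rw [List.length_append, pow_add, mul_inv] at hx
  have h3 : |((Fintype.card α : ℝ) ^ s.length)⁻¹ * pos v u| =
      ((Fintype.card α : ℝ) ^ s.length)⁻¹ * |pos v u| := by
    rw [abs_mul, abs_of_nonneg]; positivity
  calc |x - pos v s| = |(x - (pos v s + ((Fintype.card α : ℝ) ^ s.length)⁻¹ * pos v u)) +
        ((Fintype.card α : ℝ) ^ s.length)⁻¹ * pos v u| := by congr 1; ring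
    _ ≤ _ := (abs_add_le _ _)
    _ ≤ _ := by rw [h3]; linarith

section Words

variable {α : Type*} [Fintype α] [DecidableEq α]

/-- The finite set of words of length `n` over the alphabet `α`. -/
def words (α : Type*) [Fintype α] [DecidableEq α] : ℕ → Finset (List α)
  | 0 => {[]}
  | n + 1 => (Finset.univ ×ˢ words α n).image fun p => p.1 :: p.2

lemma sum_words_zero {M : Type*} [AddCommMonoid M] (F : List α → M) :
    ∑ w ∈ words α 0, F w = F [] := by
  simp [words]

lemma sum_words_succ {M : Type*} [AddCommMonoid M] (n : ℕ) (F : List α → M) :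
    ∑ w ∈ words α (n + 1), F w = ∑ a : α, ∑ w ∈ words α n, F (a :: w) := by
  rw [words, Finset.sum_image, Finset.sum_product]
  rintro ⟨a, w⟩ - ⟨b, w'⟩ - h
  simpa using h

lemma mem_words {n : ℕ} {w : List α} : w ∈ words α n ↔ w.length = n := by
  induction n generalizing w with
  | zero => simp [words]
  | succ n ih =>
    cases w with
    | nil => simp [words]
    | cons a w => simp [words, ih]

lemma card_words (n : ℕ) : (words α n).card = Fintype.card α ^ n := by
  induction n with
  | zero => simp [words]
  | succ n ih =>
    have := sum_words_succ (α := α) n (fun _ => 1)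
    simp only [Finset.sum_const, smul_eq_mul, mul_one, Finset.card_univ] at this
    rw [this, ih, pow_succ]; ring

lemma sum_words_add {M : Type*} [AddCommMonoid M] (n m : ℕ) (F : List α → M) :
    ∑ w ∈ words α (n + m), F w = ∑ u ∈ words α n, ∑ w ∈ words α m, F (u ++ w) := by
  induction n generalizing F with
  | zero => simp [sum_words_zero]
  | succ n ih =>
    rw [show n + 1 + m = (n + m) + 1 by ring, sum_words_succ, sum_words_succ]
    refine Finset.sum_congr rfl fun a _ => ?_
    rw [ih]
    simp

lemma take_append_of_mem_words {n : ℕ} {u w : List α} (hu : u ∈ words α n) {i : ℕ}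
    (hi : i ≤ n) : (u ++ w).take i = u.take i := by
  rw [mem_words] at hu
  rw [List.take_append_of_le_length (by omega)]

open Classical in
/-- Words of length `n` none of whose prefixes (the word itself included) satisfies `P`. -/
noncomputable def unmarked (P : List α → Prop) (n : ℕ) : Finset (List α) :=
  {w ∈ words α n | ∀ i ≤ n, ¬ P (w.take i)}

open Classical in
/-- Words of length `n` which satisfy `P` while none of their proper prefixes does. -/
noncomputable def firstMarked (P : List α → Prop) (n : ℕ) : Finset (List α) :=
  {w ∈ words α n | P w ∧ ∀ i < n, ¬ P (w.take i)}

lemma mem_unmarked {P : List α → Prop} {n : ℕ} {w : List α} :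
    w ∈ unmarked P n ↔ w ∈ words α n ∧ ∀ i ≤ n, ¬ P (w.take i) := by
  simp [unmarked]

lemma mem_firstMarked {P : List α → Prop} {n : ℕ} {w : List α} :
    w ∈ firstMarked P n ↔ w ∈ words α n ∧ P w ∧ ∀ i < n, ¬ P (w.take i) := by
  simp [firstMarked]

lemma sum_unmarked_succ {M : Type*} [AddCommMonoid M] (P : List α → Prop) (n : ℕ)
    (F : List α → M) :
    ∑ w ∈ unmarked P n, ∑ u ∈ words α 1, F (w ++ u) =
      ∑ w ∈ unmarked P (n + 1), F w + ∑ w ∈ firstMarked P (n + 1), F w := by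
  classical
  have h1 : unmarked P n = {w ∈ words α n | ∀ i ≤ n, ¬ P (w.take i)} := by
    ext; simp [mem_unmarked]
  have h2 : ∑ w ∈ unmarked P n, ∑ u ∈ words α 1, F (w ++ u) =
      ∑ w ∈ words α (n + 1), if ∀ i ≤ n, ¬ P (w.take i) then F w else 0 := by
    rw [sum_words_add, h1, Finset.sum_filter]
    refine Finset.sum_congr rfl fun w hw => ?_
    have : ∀ u : List α, (∀ i ≤ n, ¬ P ((w ++ u).take i)) ↔ ∀ i ≤ n, ¬ P (w.take i) := by
      intro u
      refine forall₂_congr fun i hi => ?_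
      rw [take_append_of_mem_words hw hi]
    simp only [this]
    split_ifs <;> simp
  rw [h2, ← Finset.sum_filter, ← Finset.sum_union]
  · refine Finset.sum_congr ?_ fun _ _ => rfl
    ext w
    simp only [Finset.mem_filter, Finset.mem_union, mem_unmarked, mem_firstMarked]
    constructor
    · rintro ⟨hw, h⟩
      have hl : w.take (n + 1) = w := List.take_of_length_le (by rw [mem_words] at hw; omega)
      by_cases hP : P w
      · exact Or.inr ⟨hw, hP, fun i hi => h i (by omega)⟩
      · refine Or.inl ⟨hw, fun i hi => ?_⟩
        rcases Nat.lt_or_ge n i with h' | h'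
        · rw [show i = n + 1 by omega, hl]; exact hP
        · exact h i h'
    · rintro (⟨hw, h⟩ | ⟨hw, -, h⟩)
      · exact ⟨hw, fun i hi => h i (by omega)⟩
      · exact ⟨hw, fun i hi => h i (by omega)⟩
  · rw [Finset.disjoint_left]
    intro w hw hw'
    rw [mem_unmarked] at hw
    rw [mem_firstMarked] at hw'
    have hl : w.take (n + 1) = w :=
      List.take_of_length_le (by have := mem_words.1 hw.1; omega)
    exact hw.2 (n + 1) le_rfl (by rw [hl]; exact hw'.2.1)

/-- Stopping-time decomposition: a word of length `n` either has no marked prefix, or it factors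
uniquely as its shortest marked prefix followed by an arbitrary word. -/
lemma sum_words_stopping {M : Type*} [AddCommMonoid M] (P : List α → Prop) (n : ℕ)
    (F : List α → M) :
    ∑ w ∈ words α n, F w = ∑ w ∈ unmarked P n, F w +
      ∑ k ∈ Finset.range (n + 1), ∑ s ∈ firstMarked P k, ∑ u ∈ words α (n - k), F (s ++ u) := by
  classical
  induction n generalizing F with
  | zero =>
    by_cases h : P []
    · have h1 : unmarked P 0 = ∅ := by
        ext w; simp only [mem_unmarked]; simp [h]
      have h2 : firstMarked P 0 = {[]} := by
        ext w; simp only [mem_firstMarked, words]; simp only [Finset.mem_singleton]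
        constructor
        · exact fun h => h.1
        · rintro rfl; exact ⟨rfl, h, by simp⟩
      simp [h1, h2, words]
    · have h1 : unmarked P 0 = {[]} := by
        ext w; simp only [mem_unmarked, words]; simp [h]
      have h2 : firstMarked P 0 = ∅ := by
        ext w; simp only [mem_firstMarked, words]; simp only [Finset.mem_singleton]
        simp only [Finset.notMem_empty, iff_false]
        rintro ⟨rfl, h', -⟩; exact h h'
      simp [h1, h2, words]
  | succ n ih =>
    rw [sum_words_add, ih, sum_unmarked_succ, Finset.sum_range_succ _ (n + 1), add_assoc,
      add_comm (∑ w ∈ firstMarked P (n + 1), F w)]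
    congr 2
    · refine Finset.sum_congr rfl fun k hk => Finset.sum_congr rfl fun s _ => ?_
      rw [Finset.mem_range] at hk
      rw [show n + 1 - k = (n - k) + 1 by omega, sum_words_add]
      simp
    · simp [sum_words_zero]

/-- The proportion of infinite words having a prefix of length at most `n` that satisfies `P`. -/
noncomputable def markedMass (P : List α → Prop) (n : ℕ) : ℝ :=
  ∑ k ∈ Finset.range (n + 1), ((firstMarked P k).card : ℝ) * ((Fintype.card α : ℝ) ^ k)⁻¹

lemma card_unmarked_mul_inv [Nonempty α] (P : List α → Prop) (n : ℕ) :
    ((unmarked P n).card : ℝ) * ((Fintype.card α : ℝ) ^ n)⁻¹ = 1 - markedMass P n := by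
  have hc : (0 : ℝ) < Fintype.card α := by exact_mod_cast Fintype.card_pos
  have h := sum_words_stopping P n (fun _ => ((Fintype.card α : ℝ) ^ n)⁻¹)
  simp only [Finset.sum_const, card_words, nsmul_eq_mul, Nat.cast_pow] at h
  rw [mul_inv_cancel₀ (by positivity)] at h
  rw [h, markedMass, eq_sub_iff_add_eq, add_right_inj]
  refine Finset.sum_congr rfl fun k hk => ?_
  rw [Finset.mem_range] at hk
  have : (Fintype.card α : ℝ) ^ n = (Fintype.card α : ℝ) ^ k * (Fintype.card α : ℝ) ^ (n - k) := by
    rw [← pow_add]; congr 1; omega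
  rw [this]
  field_simp

lemma markedMass_nonneg (P : List α → Prop) (n : ℕ) : 0 ≤ markedMass P n :=
  Finset.sum_nonneg fun _ _ => by positivity

lemma markedMass_le_one [Nonempty α] (P : List α → Prop) (n : ℕ) : markedMass P n ≤ 1 := by
  have h := card_unmarked_mul_inv P n
  have : 0 ≤ ((unmarked P n).card : ℝ) * ((Fintype.card α : ℝ) ^ n)⁻¹ := by positivity
  linarith

lemma markedMass_mono (P : List α → Prop) : Monotone (markedMass P) := by
  intro m n h
  refine Finset.sum_le_sum_of_subset_of_nonneg ?_ fun _ _ _ => by positivity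
  exact Finset.range_mono (by omega)

/-! ### Stacks of intervals of a self-similar system on the line -/

variable {v : α → ℝ} {D : ℝ}

/-- The number of words `w` of length `n` whose interval `[pos w - D L⁻ⁿ, pos w + D L⁻ⁿ]`
contains `x`. -/
noncomputable def stack (v : α → ℝ) (D : ℝ) (n : ℕ) (x : ℝ) : ℝ :=
  ∑ w ∈ words α n,
    (Metric.closedBall (pos v w) (D * ((Fintype.card α : ℝ) ^ n)⁻¹)).indicator (fun _ => 1) x

lemma stack_nonneg (n : ℕ) (x : ℝ) : 0 ≤ stack v D n x :=
  Finset.sum_nonneg fun _ _ => Set.indicator_nonneg (by simp) _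

open Classical in
lemma stack_eq_card (n : ℕ) (x : ℝ) : stack v D n x =
    ((words α n).filter fun w =>
      x ∈ Metric.closedBall (pos v w) (D * ((Fintype.card α : ℝ) ^ n)⁻¹)).card := by
  simp [stack, Set.indicator_apply, Finset.sum_boole]

lemma one_le_stack_iff {n : ℕ} {x : ℝ} : 1 ≤ stack v D n x ↔ ∃ w ∈ words α n,
    x ∈ Metric.closedBall (pos v w) (D * ((Fintype.card α : ℝ) ^ n)⁻¹) := by
  classical
  rw [stack_eq_card, Nat.one_le_cast, Nat.one_le_iff_ne_zero, Finset.card_ne_zero]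
  simp [Finset.Nonempty]

lemma stack_eq_zero_or_one_le (n : ℕ) (x : ℝ) : stack v D n x = 0 ∨ 1 ≤ stack v D n x := by
  classical
  rw [stack_eq_card, Nat.one_le_cast, Nat.cast_eq_zero]
  omega

/-- Self-similarity of the intervals. -/
lemma indicator_append [Nonempty α] {k n : ℕ} (hk : k ≤ n) {s : List α} (hs : s ∈ words α k)
    (u : List α) (x : ℝ) :
    (Metric.closedBall (pos v (s ++ u)) (D * ((Fintype.card α : ℝ) ^ n)⁻¹)).indicator
        (fun _ => (1 : ℝ)) x =
      (Metric.closedBall (pos v u) (D * ((Fintype.card α : ℝ) ^ (n - k))⁻¹)).indicator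
        (fun _ => (1 : ℝ)) ((Fintype.card α : ℝ) ^ k * (x - pos v s)) := by
  classical
  have hc : (0 : ℝ) < Fintype.card α := by exact_mod_cast Fintype.card_pos
  have hck : (0 : ℝ) < (Fintype.card α : ℝ) ^ k := by positivity
  have hn : (Fintype.card α : ℝ) ^ n =
      (Fintype.card α : ℝ) ^ k * (Fintype.card α : ℝ) ^ (n - k) := by
    rw [← pow_add]; congr 1; omega
  rw [Set.indicator_apply, Set.indicator_apply]
  congr 1
  rw [eq_iff_iff, Metric.mem_closedBall, Metric.mem_closedBall, Real.dist_eq, Real.dist_eq,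
    pos_append, mem_words.1 hs]
  have e : (Fintype.card α : ℝ) ^ k * (x - pos v s) - pos v u =
      (Fintype.card α : ℝ) ^ k * (x - (pos v s + ((Fintype.card α : ℝ) ^ k)⁻¹ * pos v u)) := by
    field_simp
    ring
  rw [e, abs_mul, abs_of_pos hck, hn, mul_inv, ← mul_le_mul_iff_right₀ hck]
  apply iff_of_eq
  congr 1
  field_simp

lemma stack_words_append [Nonempty α] {k n : ℕ} (hk : k ≤ n) {s : List α} (hs : s ∈ words α k)
    (x : ℝ) :
    ∑ u ∈ words α (n - k),
      (Metric.closedBall (pos v (s ++ u)) (D * ((Fintype.card α : ℝ) ^ n)⁻¹)).indicator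
        (fun _ => (1 : ℝ)) x = stack v D (n - k) ((Fintype.card α : ℝ) ^ k * (x - pos v s)) :=
  Finset.sum_congr rfl fun u _ => indicator_append hk hs u x

lemma one_le_stack_of_le [Nonempty α] (hv : ∀ a, |v a| ≤ D * (Fintype.card α - 1))
    {m n : ℕ} (hmn : m ≤ n) {x : ℝ} (h : 1 ≤ stack v D n x) : 1 ≤ stack v D m x := by
  rw [one_le_stack_iff] at h ⊢
  obtain ⟨w, hw, hx⟩ := h
  rw [mem_words] at hw
  have hl : (w.take m).length = m := by simp; omega
  refine ⟨w.take m, mem_words.2 hl, ?_⟩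
  have := mem_closedBall_prefix hv (w.take m) (w.drop m) (x := x)
    (by rw [List.take_append_drop, hw]; exact hx)
  rwa [hl] at this

lemma stack_succ_le [Nonempty α] (hv : ∀ a, |v a| ≤ D * (Fintype.card α - 1)) (n : ℕ) (x : ℝ) :
    stack v D (n + 1) x ≤ Fintype.card α * stack v D n x := by
  have hw1 : (words α 1).card = Fintype.card α := by simp [card_words]
  rw [stack, sum_words_add, stack, Finset.mul_sum]
  refine Finset.sum_le_sum fun w hw => ?_
  by_cases h : x ∈ Metric.closedBall (pos v w) (D * ((Fintype.card α : ℝ) ^ n)⁻¹)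
  · rw [Set.indicator_of_mem h]
    calc _ ≤ ∑ u ∈ words α 1, (1 : ℝ) := by
          classical
          refine Finset.sum_le_sum fun u _ => ?_
          rw [Set.indicator_apply]
          split_ifs <;> norm_num
      _ = _ := by simp [hw1]
  · rw [Set.indicator_of_notMem h, mul_zero]
    refine (Finset.sum_eq_zero fun u hu => ?_).le
    refine Set.indicator_of_notMem (fun h' => h ?_) _
    have := mem_closedBall_prefix hv w u (x := x) (by
      rw [List.length_append, mem_words.1 hw, mem_words.1 hu]; exact h')
    rwa [mem_words.1 hw] at this

end Words

/-! ### Energy and stacked words -/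

section Stacking

variable {α : Type*} [Fintype α] [DecidableEq α] {v : α → ℝ} {D K : ℝ}

/-- A word `w` of length `n` is stacked at height `K` if some point of its interval lies in the
intervals of more than `K` words of length `n`. All these words are then stacked as well. -/
def IsStacked (v : α → ℝ) (D K : ℝ) (w : List α) : Prop :=
  ∃ z ∈ Metric.closedBall (pos v w) (D * ((Fintype.card α : ℝ) ^ w.length)⁻¹),
    K < stack v D w.length z

lemma not_isStacked_nil (hK : 1 ≤ K) : ¬ IsStacked v D K [] := by
  rintro ⟨z, -, hz⟩
  have : stack v D 0 z ≤ 1 := by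
    classical
    rw [stack, sum_words_zero, Set.indicator_apply]
    split_ifs <;> norm_num
  simp only [List.length_nil] at hz
  linarith

lemma stack_le_of_not_isStacked {n : ℕ} {w : List α} (hw : w ∈ words α n)
    (h : ¬ IsStacked v D K w) {x : ℝ}
    (hx : x ∈ Metric.closedBall (pos v w) (D * ((Fintype.card α : ℝ) ^ n)⁻¹)) :
    stack v D n x ≤ K := by
  rw [mem_words] at hw
  subst hw
  by_contra! hc
  exact h ⟨x, hx, hc⟩

lemma stack_eq_sum_stopping [Nonempty α] (P : List α → Prop) (n : ℕ) (x : ℝ) :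
    stack v D n x = ∑ w ∈ unmarked P n,
      (Metric.closedBall (pos v w) (D * ((Fintype.card α : ℝ) ^ n)⁻¹)).indicator (fun _ => 1) x +
      ∑ k ∈ Finset.range (n + 1), ∑ s ∈ firstMarked P k,
        stack v D (n - k) ((Fintype.card α : ℝ) ^ k * (x - pos v s)) := by
  rw [stack, sum_words_stopping P]
  congr 1
  refine Finset.sum_congr rfl fun k hk => Finset.sum_congr rfl fun s hs => ?_
  exact stack_words_append (by rw [Finset.mem_range] at hk; omega) (mem_firstMarked.1 hs).1 x

/-- The first stacked prefixes which contribute to the stack over `x` are few: those of maximal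
length have an unstacked parent, and all of them are seen at that length. -/
lemma card_contributing_le [Nonempty α] (hv : ∀ a, |v a| ≤ D * (Fintype.card α - 1))
    (hK : 1 ≤ K) (n : ℕ) (x : ℝ) :
    ∑ k ∈ Finset.range (n + 1), ∑ s ∈ firstMarked (IsStacked v D K) k,
      (if 1 ≤ stack v D (n - k) ((Fintype.card α : ℝ) ^ k * (x - pos v s)) then (1 : ℝ) else 0)
      ≤ Fintype.card α * K := by
  classical
  have hc : (0 : ℝ) < Fintype.card α := by exact_mod_cast Fintype.card_pos
  set Q : ℕ → Prop := fun k => k ≤ n ∧ ∃ s ∈ firstMarked (IsStacked v D K) k,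
    1 ≤ stack v D (n - k) ((Fintype.card α : ℝ) ^ k * (x - pos v s)) with hQ
  by_cases hex : ∃ k, Q k
  swap
  · push Not at hex
    rw [Finset.sum_eq_zero]
    · positivity
    · intro k hk
      refine Finset.sum_eq_zero fun s hs => if_neg fun h => hex k ⟨?_, s, hs, h⟩
      rw [Finset.mem_range] at hk; omega
  obtain ⟨k₁, hk₁⟩ := hex
  set k₀ := Nat.findGreatest Q n with hk₀
  have hQ₀ : Q k₀ := Nat.findGreatest_spec hk₁.1 hk₁
  have hmax : ∀ k, Q k → k ≤ k₀ := fun k hk => Nat.le_findGreatest hk.1 hk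
  obtain ⟨hk₀n, s, hs, hs1⟩ := hQ₀
  have hsw := (mem_firstMarked.1 hs).1
  -- the stack at level `k₀` counts every contributing word at least once
  have h1 : ∑ k ∈ Finset.range (n + 1), ∑ s ∈ firstMarked (IsStacked v D K) k,
      (if 1 ≤ stack v D (n - k) ((Fintype.card α : ℝ) ^ k * (x - pos v s)) then (1 : ℝ) else 0)
      ≤ stack v D k₀ x := by
    rw [stack_eq_sum_stopping (IsStacked v D K)]
    refine le_add_of_nonneg_of_le
      (Finset.sum_nonneg fun _ _ => Set.indicator_nonneg (by simp) _) ?_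
    rw [← Finset.sum_subset (Finset.range_mono (show k₀ + 1 ≤ n + 1 by omega))]
    · refine Finset.sum_le_sum fun k hk => Finset.sum_le_sum fun s _ => ?_
      rw [Finset.mem_range] at hk
      split_ifs with h
      · exact one_le_stack_of_le hv (by omega) h
      · exact stack_nonneg _ _
    · intro k hk hk'
      rw [Finset.mem_range] at hk hk'
      refine Finset.sum_eq_zero fun s hs => if_neg fun h => hk' ?_
      have := hmax k ⟨by omega, s, hs, h⟩
      omega
  refine h1.trans ?_
  have hpos : k₀ ≠ 0 := by
    intro h0
    have hnil : s = [] := by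
      rw [mem_words, h0] at hsw; exact List.length_eq_zero_iff.1 hsw
    exact not_isStacked_nil hK (hnil ▸ (mem_firstMarked.1 hs).2.1)
  obtain ⟨j, hj⟩ := Nat.exists_eq_succ_of_ne_zero hpos
  rw [hj]
  refine (stack_succ_le hv j x).trans (mul_le_mul_of_nonneg_left ?_ hc.le)
  have hxs : x ∈ Metric.closedBall (pos v s) (D * ((Fintype.card α : ℝ) ^ k₀)⁻¹) := by
    rw [one_le_stack_iff] at hs1
    obtain ⟨u, hu, hxu⟩ := hs1
    have h2 : x ∈ Metric.closedBall (pos v (s ++ u))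
        (D * ((Fintype.card α : ℝ) ^ (s ++ u).length)⁻¹) := by
      have h3 := indicator_append (v := v) (D := D) hk₀n hsw u x
      rw [Set.indicator_of_mem hxu] at h3
      have := Set.mem_of_indicator_ne_zero (by rw [h3]; norm_num)
      rwa [List.length_append, mem_words.1 hsw, mem_words.1 hu, Nat.add_sub_cancel' hk₀n]
    have := mem_closedBall_prefix hv s u h2
    rwa [mem_words.1 hsw] at this
  have hl : (s.take j).length = j := by
    rw [List.length_take, mem_words.1 hsw]; omega
  refine stack_le_of_not_isStacked (mem_words.2 hl)
    ((mem_firstMarked.1 hs).2.2 j (by omega)) ?_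
  have := mem_closedBall_prefix hv (s.take j) (s.drop j) (x := x)
    (by rw [List.take_append_drop, mem_words.1 hsw]; exact hxs)
  rwa [hl] at this

/-- Over a point of an interval without stacked prefix the stack has height at most `K`; over any
other point the intervals group according to their first stacked prefix, and there are at most
`L K` groups, so that the Cauchy–Schwarz inequality applies. -/
lemma stack_sq_le [Nonempty α] (hv : ∀ a, |v a| ≤ D * (Fintype.card α - 1))
    (hK : 1 ≤ K) (n : ℕ) (x : ℝ) :
    stack v D n x ^ 2 ≤ K * stack v D n x + Fintype.card α * K *
      ∑ k ∈ Finset.range (n + 1), ∑ s ∈ firstMarked (IsStacked v D K) k,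
        stack v D (n - k) ((Fintype.card α : ℝ) ^ k * (x - pos v s)) ^ 2 := by
  classical
  have hS : 0 ≤ ∑ k ∈ Finset.range (n + 1), ∑ s ∈ firstMarked (IsStacked v D K) k,
      stack v D (n - k) ((Fintype.card α : ℝ) ^ k * (x - pos v s)) ^ 2 :=
    Finset.sum_nonneg fun _ _ => Finset.sum_nonneg fun _ _ => by positivity
  by_cases hex : ∃ w ∈ unmarked (IsStacked v D K) n,
      x ∈ Metric.closedBall (pos v w) (D * ((Fintype.card α : ℝ) ^ n)⁻¹)
  · obtain ⟨w, hw, hx⟩ := hex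
    have hw' := mem_unmarked.1 hw
    have h1 : ¬ IsStacked v D K w := by
      have := hw'.2 n le_rfl
      rwa [List.take_of_length_le (by rw [mem_words.1 hw'.1])] at this
    have h2 := stack_le_of_not_isStacked hw'.1 h1 hx
    have h3 : stack v D n x ^ 2 ≤ K * stack v D n x := by
      rw [sq]; exact mul_le_mul_of_nonneg_right h2 (stack_nonneg _ _)
    have : 0 ≤ Fintype.card α * K := by positivity
    nlinarith [mul_nonneg this hS]
  · push Not at hex
    have h0 := stack_eq_sum_stopping (v := v) (D := D) (IsStacked v D K) n x
    rw [Finset.sum_eq_zero fun w hw => Set.indicator_of_notMem (hex w hw) _, zero_add,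
      Finset.sum_sigma'] at h0
    have hcard := card_contributing_le hv hK n x
    rw [Finset.sum_sigma'] at hcard
    rw [Finset.sum_sigma'] at hS ⊢
    have hcs := Finset.sum_mul_sq_le_sq_mul_sq
      ((Finset.range (n + 1)).sigma fun k => firstMarked (IsStacked v D K) k)
      (fun p => if 1 ≤ stack v D (n - p.1) ((Fintype.card α : ℝ) ^ p.1 * (x - pos v p.2))
        then (1 : ℝ) else 0)
      (fun p => stack v D (n - p.1) ((Fintype.card α : ℝ) ^ p.1 * (x - pos v p.2)))
    have e1 : ∀ p : (_ : ℕ) × List α,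
        (if 1 ≤ stack v D (n - p.1) ((Fintype.card α : ℝ) ^ p.1 * (x - pos v p.2))
          then (1 : ℝ) else 0) *
          stack v D (n - p.1) ((Fintype.card α : ℝ) ^ p.1 * (x - pos v p.2)) =
        stack v D (n - p.1) ((Fintype.card α : ℝ) ^ p.1 * (x - pos v p.2)) := by
      intro p
      split_ifs with h
      · simp
      · rcases stack_eq_zero_or_one_le (v := v) (D := D) (n - p.1)
          ((Fintype.card α : ℝ) ^ p.1 * (x - pos v p.2)) with h' | h'
        · rw [h']; simp
        · exact absurd h' h
    simp only [e1, ite_pow, one_pow, ne_eq, OfNat.ofNat_ne_zero, not_false_eq_true,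
      zero_pow] at hcs
    rw [← h0] at hcs
    have h4 : 0 ≤ K * stack v D n x := mul_nonneg (by linarith) (stack_nonneg _ _)
    calc _ ≤ _ := hcs
      _ ≤ _ := mul_le_mul_of_nonneg_right hcard hS
      _ ≤ _ := le_add_of_nonneg_left h4

/-- The `L²` energy of the counting function of the intervals of generation `n`. -/
noncomputable def energy (v : α → ℝ) (D : ℝ) (n : ℕ) : ℝ := ∫ x, stack v D n x ^ 2

lemma measurable_stack (n : ℕ) : Measurable (stack v D n) := by
  refine Finset.measurable_sum _ fun w _ => ?_
  exact measurable_const.indicator Metric.isClosed_closedBall.measurableSet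

lemma integrable_stack (n : ℕ) : Integrable (stack v D n) := by
  refine integrable_finsetSum _ fun w _ => ?_
  refine (integrable_indicator_iff Metric.isClosed_closedBall.measurableSet).2 ?_
  exact integrableOn_const (measure_closedBall_lt_top.ne)

lemma stack_le_card_pow (n : ℕ) (x : ℝ) : stack v D n x ≤ (Fintype.card α : ℝ) ^ n := by
  classical
  rw [stack_eq_card, ← Nat.cast_pow, ← card_words (α := α) n]
  exact_mod_cast Finset.card_filter_le _ _

lemma integrable_stack_sq (n : ℕ) : Integrable fun x => stack v D n x ^ 2 := by
  simp only [sq]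
  refine (integrable_stack n).bdd_mul (c := (Fintype.card α : ℝ) ^ n)
    (measurable_stack n).aestronglyMeasurable (Filter.Eventually.of_forall fun x => ?_)
  rw [Real.norm_of_nonneg (stack_nonneg _ _)]
  exact stack_le_card_pow n x

lemma integral_stack [Nonempty α] (hD : 0 ≤ D) (n : ℕ) : ∫ x, stack v D n x = 2 * D := by
  have hc : (0 : ℝ) < Fintype.card α := by exact_mod_cast Fintype.card_pos
  simp only [stack]
  rw [integral_finsetSum]
  · have : ∀ w : List α, ∫ x, (Metric.closedBall (pos v w)
        (D * ((Fintype.card α : ℝ) ^ n)⁻¹)).indicator (fun _ => (1 : ℝ)) x =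
          2 * (D * ((Fintype.card α : ℝ) ^ n)⁻¹) := by
      intro w
      rw [integral_indicator_const _ Metric.isClosed_closedBall.measurableSet,
        Measure.real, Real.volume_closedBall, ENNReal.toReal_ofReal (by positivity)]
      simp
    simp only [this, Finset.sum_const, card_words, nsmul_eq_mul, Nat.cast_pow]
    field_simp
  · intro w _
    refine (integrable_indicator_iff Metric.isClosed_closedBall.measurableSet).2 ?_
    exact integrableOn_const (measure_closedBall_lt_top.ne)

lemma energy_nonneg (n : ℕ) : 0 ≤ energy v D n := integral_nonneg fun _ => sq_nonneg _

lemma integral_stack_sq_comp [Nonempty α] (n k : ℕ) (y : ℝ) :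
    ∫ x, stack v D n ((Fintype.card α : ℝ) ^ k * (x - y)) ^ 2 =
      ((Fintype.card α : ℝ) ^ k)⁻¹ * energy v D n := by
  have hc : (0 : ℝ) < Fintype.card α := by exact_mod_cast Fintype.card_pos
  rw [integral_sub_right_eq_self (fun x => stack v D n ((Fintype.card α : ℝ) ^ k * x) ^ 2) y,
    Measure.integral_comp_mul_left (fun x => stack v D n x ^ 2), abs_of_pos (by positivity),
    smul_eq_mul, energy]

lemma energy_le_add [Nonempty α] (hD : 0 ≤ D) (hv : ∀ a, |v a| ≤ D * (Fintype.card α - 1))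
    (hK : 1 ≤ K) (n : ℕ) :
    energy v D n ≤ 2 * D * K + Fintype.card α * K *
      ∑ k ∈ Finset.range (n + 1), ((firstMarked (IsStacked v D K) k).card : ℝ) *
        (((Fintype.card α : ℝ) ^ k)⁻¹ * energy v D (n - k)) := by
  have hc : (0 : ℝ) < Fintype.card α := by exact_mod_cast Fintype.card_pos
  have hint : ∀ k s, Integrable fun x =>
      stack v D (n - k) ((Fintype.card α : ℝ) ^ k * (x - pos v s)) ^ 2 := fun k s =>
    ((integrable_stack_sq (v := v) (D := D) (n - k)).comp_mul_left'
      (R := (Fintype.card α : ℝ) ^ k) (by positivity)).comp_sub_right (pos v s)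
  have hS : Integrable fun x => Fintype.card α * K *
      ∑ k ∈ Finset.range (n + 1), ∑ s ∈ firstMarked (IsStacked v D K) k,
        stack v D (n - k) ((Fintype.card α : ℝ) ^ k * (x - pos v s)) ^ 2 :=
    (integrable_finsetSum _ fun k _ => integrable_finsetSum _ fun s _ => hint k s).const_mul _
  calc energy v D n ≤ ∫ x, (K * stack v D n x + Fintype.card α * K *
      ∑ k ∈ Finset.range (n + 1), ∑ s ∈ firstMarked (IsStacked v D K) k,
        stack v D (n - k) ((Fintype.card α : ℝ) ^ k * (x - pos v s)) ^ 2) :=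
        integral_mono (integrable_stack_sq n) (((integrable_stack n).const_mul K).add hS)
          fun x => stack_sq_le hv hK n x
    _ = _ := by
      rw [integral_add ((integrable_stack n).const_mul K) hS, integral_const_mul,
        integral_stack hD, integral_const_mul, integral_finsetSum]
      · congr 1
        · ring
        · congr 1
          refine Finset.sum_congr rfl fun k _ => ?_
          rw [integral_finsetSum _ fun s _ => hint k s]
          simp only [integral_stack_sq_comp, Finset.sum_const, nsmul_eq_mul]
      · exact fun k _ => integrable_finsetSum _ fun s _ => hint k s

/-- If few words have a stacked prefix, then the energy is small: the recursive inequality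
`energy_le_add` is then a contraction. -/
lemma energy_le [Nonempty α] (hD : 0 ≤ D) (hv : ∀ a, |v a| ≤ D * (Fintype.card α - 1))
    (hK : 1 ≤ K) {N : ℕ}
    (hq : Fintype.card α * K * markedMass (IsStacked v D K) N ≤ 1 / 2) {n : ℕ} (hn : n ≤ N) :
    energy v D n ≤ 4 * D * K := by
  have hc : (0 : ℝ) < Fintype.card α := by exact_mod_cast Fintype.card_pos
  induction n using Nat.strong_induction_on with
  | _ n ih =>
    have hnil : firstMarked (IsStacked v D K) 0 = ∅ := by
      ext w
      rw [mem_firstMarked, mem_words, List.length_eq_zero_iff]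
      simp only [Finset.notMem_empty, iff_false]
      rintro ⟨rfl, h, -⟩
      exact not_isStacked_nil hK h
    have h1 : ∑ k ∈ Finset.range (n + 1), ((firstMarked (IsStacked v D K) k).card : ℝ) *
        (((Fintype.card α : ℝ) ^ k)⁻¹ * energy v D (n - k)) ≤
        markedMass (IsStacked v D K) n * (4 * D * K) := by
      rw [markedMass, Finset.sum_mul]
      refine Finset.sum_le_sum fun k hk => ?_
      rw [Finset.mem_range] at hk
      rcases Nat.eq_zero_or_pos k with rfl | hk0
      · simp [hnil]
      · rw [← mul_assoc]
        exact mul_le_mul_of_nonneg_left (ih (n - k) (by omega) (by omega)) (by positivity)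
    have h2 : Fintype.card α * K * markedMass (IsStacked v D K) n ≤ 1 / 2 :=
      (mul_le_mul_of_nonneg_left (markedMass_mono _ hn) (by positivity)).trans hq
    have h3 := energy_le_add hD hv hK n
    have h4 : Fintype.card α * K * ∑ k ∈ Finset.range (n + 1),
        ((firstMarked (IsStacked v D K) k).card : ℝ) *
        (((Fintype.card α : ℝ) ^ k)⁻¹ * energy v D (n - k)) ≤
        Fintype.card α * K * (markedMass (IsStacked v D K) n * (4 * D * K)) :=
      mul_le_mul_of_nonneg_left h1 (by positivity)
    have h5 : 0 ≤ 4 * D * K := by positivity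
    nlinarith [mul_le_mul_of_nonneg_right h2 h5]

end Stacking

/-! ### Short covers in directions with stacked words -/

section Covering

variable {α : Type*} [Fintype α] [DecidableEq α] {v : α → ℝ} {D K : ℝ}

/-- The union of the intervals of generation `n`, taken with twice the radius used in `stack`: this
leaves room for the thickening of the Cantor set. -/
def coverSet (v : α → ℝ) (D : ℝ) (n : ℕ) : Set ℝ :=
  ⋃ w ∈ words α n, Metric.closedBall (pos v w) (2 * D * ((Fintype.card α : ℝ) ^ n)⁻¹)

lemma mem_coverSet {n : ℕ} {x : ℝ} : x ∈ coverSet v D n ↔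
    ∃ w ∈ words α n, |x - pos v w| ≤ 2 * D * ((Fintype.card α : ℝ) ^ n)⁻¹ := by
  simp [coverSet, Real.dist_eq]

lemma volume_coverSet_ne_top (n : ℕ) : volume (coverSet v D n) ≠ ⊤ := by
  refine ne_of_lt ((measure_biUnion_finset_le _ _).trans_lt ?_)
  exact ENNReal.sum_lt_top.2 fun _ _ => measure_closedBall_lt_top

lemma volume_coverSet_zero_le (hD : 0 ≤ D) : volume.real (coverSet v D 0) ≤ 4 * D := by
  have : coverSet v D 0 = Metric.closedBall 0 (2 * D) := by
    ext x; simp [mem_coverSet, words, pos]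
  rw [this, Measure.real, Real.volume_closedBall, ENNReal.toReal_ofReal (by positivity)]
  linarith

lemma abs_sub_pos_prefix_le [Nonempty α] (hv : ∀ a, |v a| ≤ D * (Fintype.card α - 1))
    {k n : ℕ} (hkn : k ≤ n) {w : List α} (hw : w ∈ words α n) {x c : ℝ} (hcD : D ≤ c)
    (hx : |x - pos v w| ≤ c * ((Fintype.card α : ℝ) ^ n)⁻¹) :
    |x - pos v (w.take k)| ≤ c * ((Fintype.card α : ℝ) ^ k)⁻¹ := by
  have hc : (0 : ℝ) < Fintype.card α := by exact_mod_cast Fintype.card_pos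
  have hl : (w.take k).length = k := by rw [List.length_take, mem_words.1 hw]; omega
  have hl' : (w.drop k).length = n - k := by rw [List.length_drop, mem_words.1 hw]
  have h1 : pos v w = pos v (w.take k) + ((Fintype.card α : ℝ) ^ k)⁻¹ * pos v (w.drop k) := by
    conv_lhs => rw [← List.take_append_drop k w, pos_append, hl]
  have h2 := abs_pos_le hv (w.drop k)
  rw [hl'] at h2
  have hn : ((Fintype.card α : ℝ) ^ n)⁻¹ =
      ((Fintype.card α : ℝ) ^ k)⁻¹ * ((Fintype.card α : ℝ) ^ (n - k))⁻¹ := by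
    rw [← mul_inv, ← pow_add]; congr 2; omega
  have hone : ((Fintype.card α : ℝ) ^ (n - k))⁻¹ ≤ 1 :=
    inv_le_one_of_one_le₀ (one_le_pow₀ (by exact_mod_cast Fintype.card_pos))
  set a := ((Fintype.card α : ℝ) ^ k)⁻¹
  set b := ((Fintype.card α : ℝ) ^ (n - k))⁻¹
  have ha : 0 ≤ a := by positivity
  have h3 : |a * pos v (w.drop k)| = a * |pos v (w.drop k)| := by
    rw [abs_mul, abs_of_nonneg ha]
  have h4 : |x - pos v (w.take k)| ≤ |x - pos v w| + |a * pos v (w.drop k)| := by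
    rw [h1]
    calc |x - pos v (w.take k)| = |(x - (pos v (w.take k) + a * pos v (w.drop k))) +
          a * pos v (w.drop k)| := by congr 1; ring
      _ ≤ _ := abs_add_le _ _
  rw [h3] at h4
  rw [hn] at hx
  have h5 := mul_le_mul_of_nonneg_left h2 ha
  nlinarith [mul_le_mul_of_nonneg_left (mul_le_mul_of_nonneg_right hcD (sub_nonneg.2 hone)) ha]

lemma coverSet_subset_of_le [Nonempty α] (hD : 0 ≤ D)
    (hv : ∀ a, |v a| ≤ D * (Fintype.card α - 1)) {m n : ℕ} (hmn : m ≤ n) :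
    coverSet v D n ⊆ coverSet v D m := by
  intro x hx
  rw [mem_coverSet] at hx ⊢
  obtain ⟨w, hw, hx⟩ := hx
  refine ⟨w.take m, ?_, abs_sub_pos_prefix_le hv hmn hw (by linarith) hx⟩
  rw [mem_words, List.length_take, mem_words.1 hw]; omega

/-- A disjoint family of heavily stacked balls carries little total length, because each word has
a prefix over at most one of the balls and that prefix is stacked. -/
lemma sum_stack_le_markedMass [Nonempty α] (hD : 0 ≤ D)
    (hv : ∀ a, |v a| ≤ D * (Fintype.card α - 1)) {N : ℕ} (u : Finset (List α)) (z : List α → ℝ)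
    (hlen : ∀ c ∈ u, c.length ≤ N) (hK : ∀ c ∈ u, K < stack v D c.length (z c))
    (hdisj : (u : Set (List α)).PairwiseDisjoint fun c =>
      Metric.closedBall (z c) (3 * D * ((Fintype.card α : ℝ) ^ c.length)⁻¹)) :
    ∑ c ∈ u, K * ((Fintype.card α : ℝ) ^ c.length)⁻¹ ≤ markedMass (IsStacked v D K) N := by
  classical
  have hc : (0 : ℝ) < Fintype.card α := by exact_mod_cast Fintype.card_pos
  set P := IsStacked v D K
  set B : List α → List α → Prop := fun c w =>
    |z c - pos v (w.take c.length)| ≤ D * ((Fintype.card α : ℝ) ^ c.length)⁻¹ with hB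
  -- counting words of length `N` through their prefixes
  have h1 : ∀ c ∈ u, K * ((Fintype.card α : ℝ) ^ c.length)⁻¹ ≤
      ((Fintype.card α : ℝ) ^ N)⁻¹ * ∑ w ∈ words α N, if B c w then (1 : ℝ) else 0 := by
    intro c hcu
    have hN : N = c.length + (N - c.length) := by have := hlen c hcu; omega
    have h2 : ∑ w ∈ words α N, (if B c w then (1 : ℝ) else 0) =
        (Fintype.card α : ℝ) ^ (N - c.length) * stack v D c.length (z c) := by
      conv_lhs => rw [hN, sum_words_add]
      rw [stack, Finset.mul_sum]
      refine Finset.sum_congr rfl fun w hw => ?_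
      have : ∀ w', B c (w ++ w') ↔
          z c ∈ Metric.closedBall (pos v w) (D * ((Fintype.card α : ℝ) ^ c.length)⁻¹) := by
        intro w'
        rw [hB, Metric.mem_closedBall, Real.dist_eq]
        simp only
        rw [take_append_of_mem_words hw le_rfl, List.take_of_length_le (mem_words.1 hw).le]
      simp only [this, Finset.sum_const, card_words, Set.indicator_apply, nsmul_eq_mul,
        Nat.cast_pow]
    rw [h2, ← mul_assoc]
    have h3 : ((Fintype.card α : ℝ) ^ N)⁻¹ * (Fintype.card α : ℝ) ^ (N - c.length) =
        ((Fintype.card α : ℝ) ^ c.length)⁻¹ := by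
      conv_lhs => rw [hN, pow_add, Nat.add_sub_cancel_left]
      field_simp
    rw [h3, mul_comm]
    exact mul_le_mul_of_nonneg_left (hK c hcu).le (by positivity)
  refine (Finset.sum_le_sum h1).trans ?_
  rw [← Finset.mul_sum, Finset.sum_comm]
  have h4 : ∀ w ∈ words α N, ∑ c ∈ u, (if B c w then (1 : ℝ) else 0) ≤
      if w ∈ unmarked P N then 0 else 1 := by
    intro w hw
    split_ifs with hwu
    · refine (Finset.sum_eq_zero fun c hcu => if_neg fun hBc => ?_).le
      refine (mem_unmarked.1 hwu).2 c.length (hlen c hcu) ⟨z c, ?_, ?_⟩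
      · rw [List.length_take, mem_words.1 hw, min_eq_left (hlen c hcu), Metric.mem_closedBall,
          Real.dist_eq]
        exact hBc
      · rw [List.length_take, mem_words.1 hw, min_eq_left (hlen c hcu)]
        exact hK c hcu
    · rw [Finset.sum_boole, ← Nat.cast_one, Nat.cast_le, Finset.card_le_one]
      have key : ∀ c ∈ u, B c w → pos v w ∈
          Metric.closedBall (z c) (3 * D * ((Fintype.card α : ℝ) ^ c.length)⁻¹) := by
        intro c hcu hBc
        have h5 := abs_sub_pos_prefix_le hv (hlen c hcu) hw le_rfl
          (x := pos v w) (by simp; positivity)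
        rw [Metric.mem_closedBall, Real.dist_eq]
        have h6 : |pos v w - z c| ≤ |pos v w - pos v (w.take c.length)| +
            |z c - pos v (w.take c.length)| := by
          rw [abs_sub_comm (z c)]; exact abs_sub_le _ _ _
        have h7 : 0 ≤ D * ((Fintype.card α : ℝ) ^ c.length)⁻¹ := by positivity
        have h8 : |z c - pos v (w.take c.length)| ≤ D * ((Fintype.card α : ℝ) ^ c.length)⁻¹ := hBc
        linarith
      intro c hcu c' hcu'
      rw [Finset.mem_filter] at hcu hcu'
      by_contra hne
      exact Set.disjoint_left.1 (hdisj hcu.1 hcu'.1 hne) (key c hcu.1 hcu.2) (key c' hcu'.1 hcu'.2)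
  have h9 := Finset.sum_le_sum h4
  have h10 : ∑ w ∈ words α N, (if w ∈ unmarked P N then (0 : ℝ) else 1) =
      (Fintype.card α : ℝ) ^ N - (unmarked P N).card := by
    have : ∀ w : List α, (if w ∈ unmarked P N then (0 : ℝ) else 1) =
        1 - if w ∈ unmarked P N then 1 else 0 := by
      intro w; split_ifs <;> simp
    simp only [this, Finset.sum_sub_distrib, Finset.sum_const, card_words, Finset.sum_boole]
    rw [Finset.filter_mem_eq_inter, Finset.inter_eq_right.2 fun w hw => (mem_unmarked.1 hw).1]
    simp
  have h11 := card_unmarked_mul_inv P N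
  rw [h10] at h9
  refine (mul_le_mul_of_nonneg_left h9 (by positivity)).trans (le_of_eq ?_)
  have : ((Fintype.card α : ℝ) ^ N)⁻¹ * (Fintype.card α : ℝ) ^ N = 1 :=
    inv_mul_cancel₀ (by positivity)
  linarith

/-- The intervals of all first stacked prefixes have a union of length at most `30 D q / K`, where
`q` is the mass of the stacked words. -/
lemma volume_stacked_le [Nonempty α] (hD : 0 ≤ D)
    (hv : ∀ a, |v a| ≤ D * (Fintype.card α - 1)) (hK : 1 ≤ K) (N : ℕ) :
    volume.real (⋃ k ∈ Finset.range (N + 1), ⋃ s ∈ firstMarked (IsStacked v D K) k,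
      Metric.closedBall (pos v s) (2 * D * ((Fintype.card α : ℝ) ^ k)⁻¹)) ≤
      30 * D * markedMass (IsStacked v D K) N / K := by
  classical
  have hc : (0 : ℝ) < Fintype.card α := by exact_mod_cast Fintype.card_pos
  have hone : (1 : ℝ) ≤ Fintype.card α := by exact_mod_cast Fintype.card_pos
  set P := IsStacked v D K
  set t : Finset (List α) := (Finset.range (N + 1)).biUnion fun k => firstMarked P k
  have ht : ∀ s ∈ t, s.length ≤ N ∧ P s := by
    intro s hs
    obtain ⟨k, hk, hs⟩ := Finset.mem_biUnion.1 hs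
    rw [Finset.mem_range] at hk
    rw [mem_firstMarked, mem_words] at hs
    exact ⟨by omega, hs.2.1⟩
  have hz : ∀ s : List α, ∃ z : ℝ, P s →
      z ∈ Metric.closedBall (pos v s) (D * ((Fintype.card α : ℝ) ^ s.length)⁻¹) ∧
      K < stack v D s.length z := by
    intro s
    by_cases h : P s
    · obtain ⟨z, h1, h2⟩ := h
      exact ⟨z, fun _ => ⟨h1, h2⟩⟩
    · exact ⟨0, fun h' => absurd h' h⟩
  choose z hz using hz
  obtain ⟨u, hut, hdisj, hcov⟩ := Vitali.exists_disjoint_subfamily_covering_enlargement_closedBall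
    (t : Set (List α)) z (fun s => 3 * D * ((Fintype.card α : ℝ) ^ s.length)⁻¹) (3 * D)
    (fun s _ => mul_le_of_le_one_right (by positivity)
      (inv_le_one_of_one_le₀ (one_le_pow₀ hone))) 5 (by norm_num)
  obtain ⟨u, rfl⟩ := (t.finite_toSet.subset hut).exists_finset_coe
  have hut' : u ⊆ t := by exact_mod_cast hut
  have hsum := sum_stack_le_markedMass (K := K) (N := N) hD hv u z
    (fun c hcu => (ht c (hut' hcu)).1) (fun c hcu => (hz c (ht c (hut' hcu)).2).2) hdisj
  have hsub : (⋃ k ∈ Finset.range (N + 1), ⋃ s ∈ firstMarked P k,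
      Metric.closedBall (pos v s) (2 * D * ((Fintype.card α : ℝ) ^ k)⁻¹)) ⊆
      ⋃ c ∈ u, Metric.closedBall (z c) (5 * (3 * D * ((Fintype.card α : ℝ) ^ c.length)⁻¹)) := by
    intro x hx
    simp only [Set.mem_iUnion, exists_prop] at hx ⊢
    obtain ⟨k, hk, s, hs, hx⟩ := hx
    have hst : s ∈ t := Finset.mem_biUnion.2 ⟨k, hk, hs⟩
    have hl := mem_words.1 (mem_firstMarked.1 hs).1
    obtain ⟨b, hb, hsb⟩ := hcov s hst
    refine ⟨b, hb, hsb ?_⟩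
    have h1 := (hz s (ht s hst).2).1
    rw [Metric.mem_closedBall] at h1 hx ⊢
    rw [← hl] at hx
    rw [dist_comm] at h1
    have := dist_triangle x (pos v s) (z s)
    linarith
  calc _ ≤ volume.real (⋃ c ∈ u, Metric.closedBall (z c)
        (5 * (3 * D * ((Fintype.card α : ℝ) ^ c.length)⁻¹))) :=
        measureReal_mono hsub (ne_of_lt ((measure_biUnion_finset_le _ _).trans_lt
          (ENNReal.sum_lt_top.2 fun _ _ => measure_closedBall_lt_top)))
    _ ≤ ∑ c ∈ u, volume.real (Metric.closedBall (z c)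
        (5 * (3 * D * ((Fintype.card α : ℝ) ^ c.length)⁻¹))) :=
        measureReal_biUnion_finset_le _ _
    _ = 30 * D / K * ∑ c ∈ u, K * ((Fintype.card α : ℝ) ^ c.length)⁻¹ := by
        rw [Finset.mul_sum]
        refine Finset.sum_congr rfl fun c _ => ?_
        rw [Measure.real, Real.volume_closedBall, ENNReal.toReal_ofReal (by positivity)]
        field_simp
        ring
    _ ≤ 30 * D / K * markedMass P N := mul_le_mul_of_nonneg_left hsum (by positivity)
    _ = _ := by ring

/-- The words without stacked prefix of length at most `N` carry a rescaled copy of the cover of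
generation `n`; all the others lie over the intervals of the first stacked prefixes. -/
lemma volume_coverSet_add_le [Nonempty α] (hD : 0 ≤ D)
    (hv : ∀ a, |v a| ≤ D * (Fintype.card α - 1)) (hK : 1 ≤ K) (N n : ℕ) :
    volume.real (coverSet v D (n + N)) ≤
      (1 - markedMass (IsStacked v D K) N) * volume.real (coverSet v D n) +
        30 * D * markedMass (IsStacked v D K) N / K := by
  classical
  have hc : (0 : ℝ) < Fintype.card α := by exact_mod_cast Fintype.card_pos
  set P := IsStacked v D K
  have hpre : ∀ r : List α, volume ((fun x => (Fintype.card α : ℝ) ^ N * (x - pos v r)) ⁻¹'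
      coverSet v D n) = ENNReal.ofReal (((Fintype.card α : ℝ) ^ N)⁻¹) *
        volume (coverSet v D n) := by
    intro r
    have := measure_preimage_add_right volume (-pos v r)
      ((fun x => (Fintype.card α : ℝ) ^ N * x) ⁻¹' coverSet v D n)
    rw [Real.volume_preimage_mul_left (by positivity), abs_of_pos (by positivity)] at this
    simp only [← sub_eq_add_neg] at this
    exact this
  have hsub : coverSet v D (n + N) ⊆
      (⋃ r ∈ unmarked P N, (fun x => (Fintype.card α : ℝ) ^ N * (x - pos v r)) ⁻¹'
        coverSet v D n) ∪
      ⋃ k ∈ Finset.range (N + 1), ⋃ s ∈ firstMarked P k,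
        Metric.closedBall (pos v s) (2 * D * ((Fintype.card α : ℝ) ^ k)⁻¹) := by
    intro x hx
    obtain ⟨w, hw, hx⟩ := mem_coverSet.1 hx
    have hlw := mem_words.1 hw
    have hlN : (w.take N).length = N := by rw [List.length_take]; omega
    by_cases hu : w.take N ∈ unmarked P N
    · left
      simp only [Set.mem_iUnion, exists_prop]
      refine ⟨_, hu, ?_⟩
      rw [Set.mem_preimage, mem_coverSet]
      refine ⟨w.drop N, ?_, ?_⟩
      · rw [mem_words, List.length_drop]; omega
      · have h1 : pos v w = pos v (w.take N) +
            ((Fintype.card α : ℝ) ^ N)⁻¹ * pos v (w.drop N) := by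
          conv_lhs => rw [← List.take_append_drop N w, pos_append, hlN]
        have h2 : (Fintype.card α : ℝ) ^ N * (x - pos v (w.take N)) - pos v (w.drop N) =
            (Fintype.card α : ℝ) ^ N * (x - pos v w) := by
          rw [h1]; field_simp; ring
        rw [h2, abs_mul, abs_of_pos (by positivity)]
        calc _ ≤ _ := mul_le_mul_of_nonneg_left hx (by positivity)
          _ = _ := by rw [pow_add]; field_simp
    · right
      have hex : ∃ i, i ≤ N ∧ P (w.take i) := by
        by_contra! h
        refine hu (mem_unmarked.2 ⟨mem_words.2 hlN, fun i hi => ?_⟩)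
        rw [List.take_take, min_eq_left hi]
        exact h i hi
      have hspec := Nat.find_spec hex
      simp only [Set.mem_iUnion, exists_prop]
      refine ⟨Nat.find hex, Finset.mem_range.2 (by omega), w.take (Nat.find hex), ?_, ?_⟩
      · rw [mem_firstMarked]
        refine ⟨mem_words.2 (by rw [List.length_take]; omega), hspec.2, fun i hi => ?_⟩
        rw [List.take_take, min_eq_left hi.le]
        exact fun h => Nat.find_min hex hi ⟨by omega, h⟩
      · rw [Metric.mem_closedBall, Real.dist_eq]
        exact abs_sub_pos_prefix_le hv (by omega) hw (by linarith) hx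
  have hfin1 : volume (⋃ r ∈ unmarked P N, (fun x => (Fintype.card α : ℝ) ^ N * (x - pos v r)) ⁻¹'
        coverSet v D n) ≠ ⊤ := by
    refine ne_of_lt ((measure_biUnion_finset_le _ _).trans_lt (ENNReal.sum_lt_top.2 fun r _ => ?_))
    rw [hpre]
    exact ENNReal.mul_lt_top ENNReal.ofReal_lt_top (volume_coverSet_ne_top n).lt_top
  have hfin2 : volume (⋃ k ∈ Finset.range (N + 1), ⋃ s ∈ firstMarked P k,
        Metric.closedBall (pos v s) (2 * D * ((Fintype.card α : ℝ) ^ k)⁻¹)) ≠ ⊤ := by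
    refine ne_of_lt ((measure_biUnion_finset_le _ _).trans_lt (ENNReal.sum_lt_top.2 fun k _ => ?_))
    refine (measure_biUnion_finset_le _ _).trans_lt (ENNReal.sum_lt_top.2 fun r _ => ?_)
    exact measure_closedBall_lt_top
  calc _ ≤ _ := measureReal_mono hsub (measure_union_ne_top hfin1 hfin2)
    _ ≤ _ := measureReal_union_le _ _
    _ ≤ _ := add_le_add ?_ (volume_stacked_le hD hv hK N)
  calc _ ≤ _ := measureReal_biUnion_finset_le _ _
    _ = ((unmarked P N).card : ℝ) * ((Fintype.card α : ℝ) ^ N)⁻¹ *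
        volume.real (coverSet v D n) := by
      simp only [Measure.real, hpre, ENNReal.toReal_mul]
      rw [ENNReal.toReal_ofReal (by positivity)]
      simp [mul_assoc]
    _ = _ := by rw [card_unmarked_mul_inv]

/-- If a definite proportion of the words is stacked, then after sufficiently many independent
blocks nearly all words contain a stacked block and the cover is short. -/
lemma volume_coverSet_le [Nonempty α] (hD : 0 ≤ D)
    (hv : ∀ a, |v a| ≤ D * (Fintype.card α - 1)) (hK : 1 ≤ K) {N J : ℕ}
    (hq : 1 / 2 < Fintype.card α * K * markedMass (IsStacked v D K) N)
    (hJ : 2 * Fintype.card α * K ^ 2 ≤ J) :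
    volume.real (coverSet v D (J * N)) ≤ 34 * D / K := by
  have hc : (0 : ℝ) < Fintype.card α := by exact_mod_cast Fintype.card_pos
  set q := markedMass (IsStacked v D K) N
  have hq0 : 0 ≤ q := markedMass_nonneg _ _
  have hq1 : q ≤ 1 := markedMass_le_one _ _
  have hrec : ∀ j : ℕ, volume.real (coverSet v D (j * N)) ≤ (1 - q) ^ j * (4 * D) + 30 * D / K := by
    intro j
    induction j with
    | zero =>
      have := volume_coverSet_zero_le (v := v) hD
      have h2 : 0 ≤ 30 * D / K := by positivity
      simpa using by linarith
    | succ j ih =>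
      have h := volume_coverSet_add_le hD hv hK N (j * N)
      rw [← Nat.succ_mul] at h
      have h2 := mul_le_mul_of_nonneg_left ih (sub_nonneg.2 hq1)
      have h3 : 30 * D * q / K = q * (30 * D / K) := by ring
      rw [h3] at h
      calc _ ≤ _ := h
        _ ≤ (1 - q) * ((1 - q) ^ j * (4 * D) + 30 * D / K) + q * (30 * D / K) := by gcongr
        _ = _ := by ring
  have hb : (1 - q) ^ J ≤ 1 / K := by
    have h1 : (1 - q) ^ J * (1 + q) ^ J ≤ 1 := by
      rw [← mul_pow]
      exact pow_le_one₀ (mul_nonneg (by linarith) (by linarith)) (by nlinarith)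
    have h2 : 1 + (J : ℝ) * q ≤ (1 + q) ^ J := one_add_mul_le_pow (by linarith) J
    have h3 : K ≤ J * q := by
      have := mul_le_mul_of_nonneg_right hJ hq0
      nlinarith
    rw [le_div_iff₀ (by linarith)]
    have h4 : 0 ≤ (1 - q) ^ J := pow_nonneg (by linarith) J
    nlinarith
  have h := hrec J
  have h5 := mul_le_mul_of_nonneg_right hb (show 0 ≤ 4 * D by positivity)
  have h6 : 34 * D / K = 1 / K * (4 * D) + 30 * D / K := by ring
  linarith

end Covering

/-! ### A smoothed Plancherel inequality -/

section Bessel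

open Complex in
lemma integral_gaussian_mul_exp {b : ℝ} (hb : 0 < b) (t : ℝ) :
    ∫ ξ : ℝ, cexp (-b * ξ ^ 2) * cexp (I * ξ * t) =
      ((√(Real.pi / b) * Real.exp (-(4 * b)⁻¹ * t ^ 2) : ℝ) : ℂ) := by
  have h := fourierIntegral_gaussian (b := (b : ℂ)) (by simpa using hb) (t : ℂ)
  have h1 : ((Real.pi : ℂ) / b) ^ (1 / 2 : ℂ) = ((√(Real.pi / b) : ℝ) : ℂ) := by
    rw [Real.sqrt_eq_rpow, Complex.ofReal_cpow (by positivity)]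
    push_cast
    rfl
  rw [h1] at h
  rw [Complex.ofReal_mul, Complex.ofReal_exp]
  convert h using 2
  · ext ξ
    rw [mul_comm]
    congr 2
    ring
  · congr 1
    push_cast
    field_simp

open Complex in
/-- A smoothed form of Plancherel's theorem: the Gaussian weight only decreases the integral. -/
lemma integral_gaussian_mul_norm_fourier_sq_le {f : ℝ → ℝ} (hf : Integrable f)
    (hf2 : Integrable fun x => f x ^ 2) {b : ℝ} (hb : 0 < b) :
    Integrable (fun ξ : ℝ => Real.exp (-b * ξ ^ 2) * ‖∫ x : ℝ, (f x : ℂ) * cexp (I * ξ * x)‖ ^ 2) ∧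
    ∫ ξ : ℝ, Real.exp (-b * ξ ^ 2) * ‖∫ x : ℝ, (f x : ℂ) * cexp (I * ξ * x)‖ ^ 2 ≤
      2 * Real.pi * ∫ x, f x ^ 2 := by
  set g : ℝ → ℝ := fun t => √(Real.pi / b) * Real.exp (-(4 * b)⁻¹ * t ^ 2) with hg
  have hgint : Integrable g := (integrable_exp_neg_mul_sq (by positivity)).const_mul _
  have hgtot : ∫ t, g t = 2 * Real.pi := by
    rw [hg, integral_const_mul, integral_gaussian, ← Real.sqrt_mul (by positivity)]
    rw [show Real.pi / b * (Real.pi / (4 * b)⁻¹) = (2 * Real.pi) ^ 2 by field_simp; norm_num]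
    exact Real.sqrt_sq (by positivity)
  have hgnn : ∀ t, 0 ≤ g t := fun t => by positivity
  have hfc : Integrable fun x => (f x : ℂ) := hf.ofReal
  have hff : Integrable (fun p : ℝ × ℝ => (f p.1 : ℂ) * (f p.2 : ℂ)) (volume.prod volume) :=
    hfc.mul_prod hfc
  have hgc : Integrable fun ξ : ℝ => cexp (-b * ξ ^ 2) :=
    integrable_cexp_neg_mul_sq (b := (b : ℂ)) (by simpa using hb)
  have hA : ∀ ξ : ℝ, ((‖∫ x : ℝ, (f x : ℂ) * cexp (I * ξ * x)‖ ^ 2 : ℝ) : ℂ) =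
      ∫ p : ℝ × ℝ, (f p.1 : ℂ) * f p.2 * cexp (I * ξ * ((p.1 - p.2 : ℝ) : ℂ))
        ∂(volume.prod volume) := by
    intro ξ
    rw [← Complex.normSq_eq_norm_sq, ← Complex.mul_conj, ← integral_conj, ← integral_prod_mul]
    refine integral_congr_ae (Filter.Eventually.of_forall fun p => ?_)
    simp only [map_mul, Complex.conj_ofReal, ← Complex.exp_conj, Complex.conj_I]
    rw [mul_mul_mul_comm, ← Complex.exp_add]
    congr 2
    push_cast
    ring
  have hG : Integrable (fun q : ℝ × (ℝ × ℝ) => cexp (I * q.1 * ((q.2.1 - q.2.2 : ℝ) : ℂ)) *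
      (cexp (-b * q.1 ^ 2) * ((f q.2.1 : ℂ) * f q.2.2)))
      (volume.prod (volume.prod volume)) := by
    refine (hgc.mul_prod hff).bdd_mul (c := 1) ?_ (Filter.Eventually.of_forall fun q => ?_)
    · refine Continuous.aestronglyMeasurable ?_
      fun_prop
    · rw [show I * (q.1 : ℂ) * ((q.2.1 - q.2.2 : ℝ) : ℂ) =
        ((q.1 * (q.2.1 - q.2.2) : ℝ) : ℂ) * I by push_cast; ring, Complex.norm_exp_ofReal_mul_I]
  have hpt : ∀ ξ : ℝ,
      ((Real.exp (-b * ξ ^ 2) * ‖∫ x : ℝ, (f x : ℂ) * cexp (I * ξ * x)‖ ^ 2 : ℝ) : ℂ)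
      = ∫ p : ℝ × ℝ, cexp (I * ξ * ((p.1 - p.2 : ℝ) : ℂ)) *
      (cexp (-b * ξ ^ 2) * ((f p.1 : ℂ) * f p.2)) ∂(volume.prod volume) := by
    intro ξ
    rw [Complex.ofReal_mul, hA, ← integral_const_mul]
    refine integral_congr_ae (Filter.Eventually.of_forall fun p => ?_)
    simp only
    push_cast
    ring
  have hint : Integrable (fun ξ : ℝ => Real.exp (-b * ξ ^ 2) *
      ‖∫ x : ℝ, (f x : ℂ) * cexp (I * ξ * x)‖ ^ 2) := by
    have h1 := hG.integral_prod_left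
    have h2 := h1.re
    refine h2.congr (Filter.Eventually.of_forall fun ξ => ?_)
    simp only
    rw [← hpt ξ]
    exact Complex.ofReal_re _
  refine ⟨hint, ?_⟩
  have hB : ∫ ξ : ℝ, Real.exp (-b * ξ ^ 2) * ‖∫ x : ℝ, (f x : ℂ) * cexp (I * ξ * x)‖ ^ 2 =
      ∫ p : ℝ × ℝ, f p.1 * f p.2 * g (p.1 - p.2) ∂(volume.prod volume) := by
    have : ((∫ ξ : ℝ, Real.exp (-b * ξ ^ 2) *
          ‖∫ x : ℝ, (f x : ℂ) * cexp (I * ξ * x)‖ ^ 2 : ℝ) : ℂ) =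
        ((∫ p : ℝ × ℝ, f p.1 * f p.2 * g (p.1 - p.2) ∂(volume.prod volume) : ℝ) : ℂ) := by
      rw [← integral_complex_ofReal, ← integral_complex_ofReal]
      simp only [hpt]
      rw [integral_integral_swap hG]
      refine integral_congr_ae (Filter.Eventually.of_forall fun p => ?_)
      simp only
      rw [Complex.ofReal_mul, hg, ← integral_gaussian_mul_exp hb, ← integral_const_mul]
      refine integral_congr_ae (Filter.Eventually.of_forall fun ξ => ?_)
      simp only
      push_cast
      ring
    exact_mod_cast this
  rw [hB]
  -- Schur test
  have h1 : Integrable (fun p : ℝ × ℝ => f p.1 ^ 2 * g (p.1 - p.2)) (volume.prod volume) := by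
    have h := hf2.mul_prod hgint
    have := (measurePreserving_prod_neg_add
      (volume : Measure ℝ) (volume : Measure ℝ)).integrable_comp
      h.aestronglyMeasurable |>.2 h
    refine this.congr (Filter.Eventually.of_forall fun p => ?_)
    simp only [Function.comp, hg]
    congr 4
    ring
  have h1' : ∫ p : ℝ × ℝ, f p.1 ^ 2 * g (p.1 - p.2) ∂(volume.prod volume) =
      2 * Real.pi * ∫ x, f x ^ 2 := by
    rw [integral_prod _ h1]
    simp only [integral_const_mul]
    have : ∀ x : ℝ, ∫ y, g (x - y) = 2 * Real.pi := fun x => by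
      rw [integral_sub_left_eq_self g volume x, hgtot]
    simp only [this]
    rw [integral_mul_const, mul_comm]
  have h2 : Integrable (fun p : ℝ × ℝ => f p.2 ^ 2 * g (p.1 - p.2)) (volume.prod volume) := by
    have := h1.swap
    refine this.congr (Filter.Eventually.of_forall fun p => ?_)
    simp only [Function.comp, hg, Prod.fst_swap, Prod.snd_swap]
    congr 4
    ring
  have h2' : ∫ p : ℝ × ℝ, f p.2 ^ 2 * g (p.1 - p.2) ∂(volume.prod volume) =
      2 * Real.pi * ∫ x, f x ^ 2 := by
    rw [← h1', ← integral_prod_swap]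
    refine integral_congr_ae (Filter.Eventually.of_forall fun p => ?_)
    simp only [hg, Prod.fst_swap, Prod.snd_swap]
    congr 4
    ring
  calc _ ≤ ∫ p : ℝ × ℝ, (1 / 2 * (f p.1 ^ 2 * g (p.1 - p.2)) +
        1 / 2 * (f p.2 ^ 2 * g (p.1 - p.2))) ∂(volume.prod volume) := by
        refine integral_mono ?_ ((h1.const_mul _).add (h2.const_mul _)) fun p => ?_
        · refine (hf.mul_prod hf).mul_bdd (c := √(Real.pi / b)) ?_
            (Filter.Eventually.of_forall fun p => ?_)
          · refine Continuous.aestronglyMeasurable ?_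
            fun_prop
          · rw [Real.norm_of_nonneg (hgnn _)]
            refine mul_le_of_le_one_right (by positivity) (Real.exp_le_one_iff.2 ?_)
            have : 0 ≤ (4 * b)⁻¹ * (p.1 - p.2) ^ 2 := by positivity
            linarith
        · simp only
          nlinarith [mul_nonneg (hgnn (p.1 - p.2)) (sq_nonneg (f p.1 - f p.2))]
    _ = _ := by
      rw [integral_add (h1.const_mul _) (h2.const_mul _), integral_const_mul, integral_const_mul,
        h1', h2']
      ring

end Bessel

/-! ### The Fourier transform of the counting function -/

section FourierSide

open Complex in
lemma sum_words_exp {α : Type*} [Fintype α] [DecidableEq α] (v : α → ℝ) (n : ℕ) (ξ : ℝ) :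
    ∑ w ∈ words α n, cexp (I * ξ * pos v w) =
      ∏ k ∈ Finset.range n, ∑ a, cexp (I * (ξ / (Fintype.card α : ℝ) ^ (k + 1) * v a : ℝ)) := by
  induction n generalizing ξ with
  | zero => simp [sum_words_zero, pos]
  | succ n ih =>
    rw [sum_words_succ, Finset.prod_range_succ']
    have h := ih (ξ / Fintype.card α)
    have e : ∀ k : ℕ, ξ / (Fintype.card α : ℝ) ^ (k + 1 + 1) =
        ξ / Fintype.card α / (Fintype.card α : ℝ) ^ (k + 1) := fun k => by
      rw [div_div, pow_succ' _ (k + 1)]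
    simp only [e]
    rw [← h, Finset.sum_mul_sum, Finset.sum_comm]
    refine Finset.sum_congr rfl fun a _ => Finset.sum_congr rfl fun w _ => ?_
    rw [← Complex.exp_add]
    congr 1
    simp only [pos]
    push_cast
    ring

open Complex in
lemma integral_closedBall_exp {c r ξ : ℝ} (hr : 0 ≤ r) (hξ : ξ ≠ 0) :
    ∫ x : ℝ, (((Metric.closedBall c r).indicator (fun _ => (1 : ℝ)) x : ℝ) : ℂ) *
      cexp (I * ξ * x) = cexp (I * ξ * c) * ((2 * Real.sin (r * ξ) / ξ : ℝ) : ℂ) := by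
  have h1 : ∀ x : ℝ, (((Metric.closedBall c r).indicator (fun _ => (1 : ℝ)) x : ℝ) : ℂ) *
      cexp (I * ξ * x) = (Metric.closedBall c r).indicator (fun x : ℝ => cexp (I * ξ * x)) x := by
    intro x
    by_cases hx : x ∈ Metric.closedBall c r <;> simp [hx]
  simp only [h1]
  rw [integral_indicator Metric.isClosed_closedBall.measurableSet, Real.closedBall_eq_Icc,
    integral_Icc_eq_integral_Ioc, ← intervalIntegral.integral_of_le (by linarith)]
  have hne : I * (ξ : ℂ) ≠ 0 := mul_ne_zero I_ne_zero (by exact_mod_cast hξ)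
  rw [integral_exp_mul_complex hne]
  have hξ' : (ξ : ℂ) ≠ 0 := by exact_mod_cast hξ
  push_cast
  rw [Complex.sin, show I * (ξ : ℂ) * (c + r) = I * ξ * c + r * ξ * I by ring,
    show I * (ξ : ℂ) * (c - r) = I * ξ * c + -(r * ξ) * I by ring, Complex.exp_add,
    Complex.exp_add]
  field_simp
  rw [Complex.I_sq]
  ring

open Complex in
lemma fourier_stack {α : Type*} [Fintype α] [DecidableEq α] [Nonempty α] (v : α → ℝ) {D : ℝ}
    (hD : 0 ≤ D) (n : ℕ) {ξ : ℝ} (hξ : ξ ≠ 0) :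
    ∫ x : ℝ, (stack v D n x : ℂ) * cexp (I * ξ * x) =
      (∑ w ∈ words α n, cexp (I * ξ * pos v w)) *
        ((2 * Real.sin (D * ((Fintype.card α : ℝ) ^ n)⁻¹ * ξ) / ξ : ℝ) : ℂ) := by
  have hc : (0 : ℝ) < Fintype.card α := by exact_mod_cast Fintype.card_pos
  simp only [stack, Complex.ofReal_sum, Finset.sum_mul]
  rw [integral_finsetSum]
  · exact Finset.sum_congr rfl fun w _ => integral_closedBall_exp (by positivity) hξ
  · intro w _
    have h : Integrable fun x : ℝ => (((Metric.closedBall (pos v w)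
        (D * ((Fintype.card α : ℝ) ^ n)⁻¹)).indicator (fun _ => (1 : ℝ)) x : ℝ) : ℂ) :=
      ((integrable_indicator_iff Metric.isClosed_closedBall.measurableSet).2
        (integrableOn_const measure_closedBall_lt_top.ne)).ofReal
    refine h.mul_bdd (c := 1) (Continuous.aestronglyMeasurable (by fun_prop))
      (Filter.Eventually.of_forall fun x => ?_)
    rw [show I * (ξ : ℂ) * x = ((ξ * x : ℝ) : ℂ) * I by push_cast; ring,
      Complex.norm_exp_ofReal_mul_I]

/-- The digit values of the projection in direction `θ` of the `2^d` corners: the corner with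
coordinates `(2^d - 1) aⱼ`, `aⱼ ∈ {0, 1}`, is sent to its inner product with `θ`. -/
def cornerValue {d : ℕ} (θ : Fin d → ℝ) (a : Fin d → Bool) : ℝ :=
  (2 ^ d - 1) * ∑ j, θ j * (if a j then 1 else 0)

lemma card_corner (d : ℕ) : (Fintype.card (Fin d → Bool) : ℝ) = 2 ^ d := by
  simp

open Complex in
lemma norm_one_add_exp_sq (s : ℝ) : ‖1 + cexp (I * s)‖ ^ 2 = 4 * Real.cos (s / 2) ^ 2 := by
  rw [mul_comm, Complex.exp_mul_I, ← Complex.ofReal_cos, ← Complex.ofReal_sin,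
    ← Complex.normSq_eq_norm_sq, Complex.normSq_apply]
  simp only [add_re, add_im, one_re, one_im, mul_re, mul_im, ofReal_re, ofReal_im, I_re, I_im]
  have h1 : Real.cos s = 2 * Real.cos (s / 2) ^ 2 - 1 := by
    rw [← Real.cos_two_mul]; congr 1; ring
  have h2 := Real.sin_sq_add_cos_sq s
  nlinarith

open Complex in
lemma norm_sum_corner_exp_sq {d : ℕ} (θ : Fin d → ℝ) (t : ℝ) :
    ‖∑ a : Fin d → Bool, cexp (I * (t * cornerValue θ a : ℝ))‖ ^ 2 =
      (2 ^ d) ^ 2 * ∏ j, Real.cos (t * (2 ^ d - 1) / 2 * θ j) ^ 2 := by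
  have h1 : ∑ a : Fin d → Bool, cexp (I * (t * cornerValue θ a : ℝ)) =
      ∏ j, (1 + cexp (I * (t * (2 ^ d - 1) * θ j : ℝ))) := by
    have h2 : ∀ j, 1 + cexp (I * (t * (2 ^ d - 1) * θ j : ℝ)) =
        ∑ b : Bool, cexp (I * (t * (2 ^ d - 1) * θ j * (if b then 1 else 0) : ℝ)) := by
      intro j; simp [add_comm]
    simp only [h2]
    rw [Finset.prod_univ_sum, Fintype.piFinset_univ]
    refine Finset.sum_congr rfl fun a _ => ?_
    rw [← Complex.exp_sum, ← Finset.mul_sum, ← Complex.ofReal_sum]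
    congr 3
    rw [cornerValue, Finset.mul_sum, Finset.mul_sum]
    exact Finset.sum_congr rfl fun j _ => by ring
  rw [h1, norm_prod, ← Finset.prod_pow]
  simp only [norm_one_add_exp_sq, Finset.prod_mul_distrib, Finset.prod_const, Finset.card_univ,
    Fintype.card_fin]
  congr 1
  · rw [← pow_mul, mul_comm, pow_mul]; norm_num
  · refine Finset.prod_congr rfl fun j _ => ?_
    congr 2
    ring

/-- The Riesz product `∏_{m ≤ k < n} ∏ⱼ cos²(2^{dk} θⱼ y)`. For `m = 0` it is the squared modulus of
the Fourier transform of the projected natural measure of generation `n`, suitably rescaled. -/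
noncomputable def rieszProd {d : ℕ} (θ : Fin d → ℝ) (m n : ℕ) (y : ℝ) : ℝ :=
  ∏ k ∈ Finset.Ico m n, ∏ j, Real.cos ((2 ^ d) ^ k * θ j * y) ^ 2

lemma rieszProd_nonneg {d : ℕ} (θ : Fin d → ℝ) (m n : ℕ) (y : ℝ) : 0 ≤ rieszProd θ m n y :=
  Finset.prod_nonneg fun _ _ => Finset.prod_nonneg fun _ _ => sq_nonneg _

lemma rieszProd_le_one {d : ℕ} (θ : Fin d → ℝ) (m n : ℕ) (y : ℝ) : rieszProd θ m n y ≤ 1 :=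
  Finset.prod_le_one (fun _ _ => Finset.prod_nonneg fun _ _ => sq_nonneg _) fun _ _ =>
    Finset.prod_le_one (fun _ _ => sq_nonneg _) fun _ _ => Real.cos_sq_le_one _

@[fun_prop]
lemma continuous_rieszProd {d : ℕ} (θ : Fin d → ℝ) (m n : ℕ) : Continuous (rieszProd θ m n) := by
  unfold rieszProd
  fun_prop

open Complex in
lemma norm_sum_words_exp_sq {d : ℕ} (hd : 2 ≤ d) (θ : Fin d → ℝ) (n : ℕ) (y : ℝ) :
    ‖∑ w ∈ words (Fin d → Bool) n, cexp (I * (2 * (2 ^ d) ^ n / (2 ^ d - 1) * y : ℝ) *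
      pos (cornerValue θ) w)‖ ^ 2 = ((2 ^ d) ^ n) ^ 2 * rieszProd θ 0 n y := by
  have hL : (0 : ℝ) < 2 ^ d - 1 := by
    have : (2 : ℝ) ^ 2 ≤ 2 ^ d := pow_le_pow_right₀ (by norm_num) hd
    linarith
  rw [sum_words_exp, norm_prod, ← Finset.prod_pow]
  simp only [norm_sum_corner_exp_sq, Finset.prod_mul_distrib, Finset.prod_const,
    Finset.card_range, card_corner]
  rw [← pow_mul, ← pow_mul, mul_comm 2 n, pow_mul, pow_mul]
  congr 1
  rw [rieszProd, ← Finset.range_eq_Ico, ← Finset.prod_range_reflect]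
  refine Finset.prod_congr rfl fun k hk => Finset.prod_congr rfl fun j _ => ?_
  rw [Finset.mem_range] at hk
  congr 2
  have : ((2 : ℝ) ^ d) ^ n = (2 ^ d) ^ (k + 1) * (2 ^ d) ^ (n - 1 - k) := by
    rw [← pow_add]; congr 1; omega
  rw [this]
  have hne : (2 : ℝ) ^ d - 1 ≠ 0 := hL.ne'
  field_simp
  ring

/-- Small energy forces the Riesz product to be small on average. -/
lemma integral_rieszProd_le {d : ℕ} (hd : 2 ≤ d) (θ : Fin d → ℝ) (n : ℕ) :
    (2 ^ d) ^ n * ∫ y in (0 : ℝ)..1, rieszProd θ 0 n y ≤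
      2 ^ d * Real.exp 1 * Real.pi ^ 3 * energy (cornerValue θ) d n := by
  set L : ℝ := 2 ^ d with hLdef
  have hL4 : (4 : ℝ) ≤ L := by
    have : (2 : ℝ) ^ 2 ≤ 2 ^ d := pow_le_pow_right₀ (by norm_num) hd
    linarith
  have hd2 : (2 : ℝ) ≤ d := by exact_mod_cast hd
  set R : ℝ := 2 * L ^ n / (L - 1) with hR
  have hL1 : 0 < L - 1 := by linarith
  have hR0 : 0 < R := by positivity
  set f : ℝ → ℝ := stack (cornerValue θ) d n
  set F : ℝ → ℝ := fun ξ => ‖∫ x : ℝ, (f x : ℂ) * Complex.exp (Complex.I * ξ * x)‖ ^ 2 with hF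
  obtain ⟨hint, hle⟩ := integral_gaussian_mul_norm_fourier_sq_le
    (integrable_stack (v := cornerValue θ) (D := d) n)
    (integrable_stack_sq (v := cornerValue θ) (D := d) n) (b := (R ^ 2)⁻¹) (by positivity)
  -- the transform of a single interval does not vanish at the frequencies in question
  have hangle : 2 * (d : ℝ) / (L - 1) ≤ Real.pi / 2 := by
    have h3 : (3 : ℝ) < Real.pi := Real.pi_gt_three
    have h1 : 3 * (d : ℝ) ≤ 2 * L - 2 := by
      have : ∀ e : ℕ, 2 ≤ e → 3 * (e : ℝ) ≤ 2 * 2 ^ e - 2 := by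
        intro e he
        induction e, he using Nat.le_induction with
        | base => norm_num
        | succ e he ih =>
          have : (2 : ℝ) ^ 2 ≤ 2 ^ e := pow_le_pow_right₀ (by norm_num) he
          rw [pow_succ]; push_cast; linarith
      exact this d hd
    rw [div_le_iff₀ hL1]
    nlinarith
  have hpt : ∀ y ∈ Set.Ioc (0 : ℝ) 1, (Real.exp 1)⁻¹ * (16 / Real.pi ^ 2) * rieszProd θ 0 n y ≤
      Real.exp (-(R ^ 2)⁻¹ * (R * y) ^ 2) * F (R * y) := by
    intro y hy
    have hRy : R * y ≠ 0 := (mul_pos hR0 hy.1).ne'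
    have h1 : F (R * y) = L ^ n * L ^ n * rieszProd θ 0 n y *
        (2 * Real.sin (d * (L ^ n)⁻¹ * (R * y)) / (R * y)) ^ 2 := by
      simp only [hF]
      have h2 := norm_sum_words_exp_sq hd θ n y
      rw [fourier_stack _ (by positivity) n hRy, norm_mul, mul_pow, h2, Complex.norm_real,
        Real.norm_eq_abs, sq_abs, card_corner]
      ring
    have hu : (d : ℝ) * (L ^ n)⁻¹ * (R * y) = 2 * d / (L - 1) * y := by
      rw [hR]; field_simp
    have hu0 : 0 ≤ 2 * (d : ℝ) / (L - 1) * y := mul_nonneg (by positivity) hy.1.le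
    have hu1 : 2 * (d : ℝ) / (L - 1) * y ≤ Real.pi / 2 :=
      (mul_le_of_le_one_right (by positivity) hy.2).trans hangle
    have hsin := Real.mul_le_sin hu0 hu1
    have h3 : 4 / Real.pi * (L ^ n)⁻¹ ≤ 2 * Real.sin (d * (L ^ n)⁻¹ * (R * y)) / (R * y) := by
      rw [le_div_iff₀ (mul_pos hR0 hy.1), hu]
      have : 4 / Real.pi * (L ^ n)⁻¹ * (R * y) = 2 * (2 / Real.pi * (2 * 1 / (L - 1) * y)) := by
        rw [hR]; field_simp; norm_num
      rw [this]
      have h4 : 2 / Real.pi * (2 * 1 / (L - 1) * y) ≤ 2 / Real.pi * (2 * d / (L - 1) * y) := by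
        have := hy.1.le
        gcongr
        linarith
      linarith
    have h5 : (16 / Real.pi ^ 2) * (L ^ n * L ^ n)⁻¹ ≤
        (2 * Real.sin (d * (L ^ n)⁻¹ * (R * y)) / (R * y)) ^ 2 := by
      have := pow_le_pow_left₀ (by positivity) h3 2
      refine le_trans (le_of_eq ?_) this
      field_simp
      norm_num
    have h6 : 16 / Real.pi ^ 2 * rieszProd θ 0 n y ≤ F (R * y) := by
      rw [h1]
      have h7 : 0 ≤ L ^ n * L ^ n * rieszProd θ 0 n y :=
        mul_nonneg (by positivity) (rieszProd_nonneg _ _ _ _)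
      calc _ = L ^ n * L ^ n * rieszProd θ 0 n y *
            ((16 / Real.pi ^ 2) * (L ^ n * L ^ n)⁻¹) := by field_simp
        _ ≤ _ := mul_le_mul_of_nonneg_left h5 h7
    have h8 : (Real.exp 1)⁻¹ ≤ Real.exp (-(R ^ 2)⁻¹ * (R * y) ^ 2) := by
      rw [← Real.exp_neg, Real.exp_le_exp]
      have : -(R ^ 2)⁻¹ * (R * y) ^ 2 = -(y ^ 2) := by field_simp
      rw [this]
      have := hy.1
      nlinarith [hy.2]
    rw [mul_assoc]
    exact mul_le_mul h8 h6 (mul_nonneg (by positivity) (rieszProd_nonneg _ _ _ _))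
      (Real.exp_pos _).le
  have h1 : R * ∫ y in (0 : ℝ)..1, (Real.exp (-(R ^ 2)⁻¹ * (R * y) ^ 2) * F (R * y)) ≤
      2 * Real.pi * energy (cornerValue θ) d n := by
    rw [← smul_eq_mul, intervalIntegral.smul_integral_comp_mul_left
      (fun ξ => Real.exp (-(R ^ 2)⁻¹ * ξ ^ 2) * F ξ), mul_zero, mul_one,
      intervalIntegral.integral_of_le hR0.le]
    refine le_trans (setIntegral_le_integral hint (Filter.Eventually.of_forall fun ξ => ?_)) hle
    positivity
  have h2 : (Real.exp 1)⁻¹ * (16 / Real.pi ^ 2) * ∫ y in (0 : ℝ)..1, rieszProd θ 0 n y ≤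
      ∫ y in (0 : ℝ)..1, (Real.exp (-(R ^ 2)⁻¹ * (R * y) ^ 2) * F (R * y)) := by
    rw [← intervalIntegral.integral_const_mul, intervalIntegral.integral_of_le zero_le_one,
      intervalIntegral.integral_of_le zero_le_one]
    refine setIntegral_mono_on ?_ ?_ measurableSet_Ioc hpt
    · exact (((continuous_rieszProd θ 0 n).const_mul _).integrableOn_Icc).mono_set
        Set.Ioc_subset_Icc_self
    · exact (hint.comp_mul_left' hR0.ne').integrableOn
  have h3 : L ^ n = R * (L - 1) / 2 := by rw [hR]; field_simp
  set A := ∫ y in (0 : ℝ)..1, rieszProd θ 0 n y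
  have hE := energy_nonneg (v := cornerValue θ) (D := d) n
  set En := energy (cornerValue θ) d n
  have h4 : R * ((Real.exp 1)⁻¹ * (16 / Real.pi ^ 2) * A) ≤ 2 * Real.pi * En :=
    (mul_le_mul_of_nonneg_left h2 hR0.le).trans h1
  have h5 : R * A ≤ Real.exp 1 * Real.pi ^ 3 / 8 * En := by
    have h6 := mul_le_mul_of_nonneg_left h4 (show 0 ≤ Real.exp 1 * (Real.pi ^ 2 / 16) by positivity)
    calc R * A = Real.exp 1 * (Real.pi ^ 2 / 16) *
          (R * ((Real.exp 1)⁻¹ * (16 / Real.pi ^ 2) * A)) := by field_simp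
      _ ≤ _ := h6
      _ = _ := by ring
  calc L ^ n * A = (L - 1) / 2 * (R * A) := by rw [h3]; ring
    _ ≤ (L - 1) / 2 * (Real.exp 1 * Real.pi ^ 3 / 8 * En) :=
        mul_le_mul_of_nonneg_left h5 (by linarith)
    _ ≤ L * (Real.exp 1 * Real.pi ^ 3 * En) := by
        have : 0 ≤ Real.exp 1 * Real.pi ^ 3 * En := by positivity
        nlinarith
    _ = _ := by ring

end FourierSide

/-! ### Lower bounds for the integral of a Riesz product -/

section RieszLower

/-- Products of squared cosines correlate nonnegatively with every cosine against the triangle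
weight `1 - y`, because the expansion of such a product into cosines has nonnegative coefficients
and the triangle function is positive definite. -/
lemma integral_triangle_cos_mul_prod_nonneg {ι : Type*} (s : Finset ι) (μ : ι → ℝ) (l : ℝ) :
    0 ≤ ∫ y in (0 : ℝ)..1, (1 - y) * Real.cos (l * y) * ∏ i ∈ s, Real.cos (μ i * y) ^ 2 := by
  classical
  induction s using Finset.induction_on generalizing l with
  | empty =>
    simp only [Finset.prod_empty, mul_one]
    by_cases hl : l = 0
    · subst hl
      simp only [zero_mul, Real.cos_zero, mul_one]
      refine intervalIntegral.integral_nonneg zero_le_one fun y hy => ?_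
      linarith [hy.2]
    · have hderiv : ∀ y : ℝ, HasDerivAt
          (fun y => (1 - y) * (Real.sin (l * y) / l) - Real.cos (l * y) / l ^ 2)
          ((1 - y) * Real.cos (l * y)) y := by
        intro y
        have hs : HasDerivAt (fun y => Real.sin (l * y)) (Real.cos (l * y) * l) y := by
          simpa using ((hasDerivAt_id y).const_mul l).sin
        have hc : HasDerivAt (fun y => Real.cos (l * y)) (-Real.sin (l * y) * l) y := by
          simpa using ((hasDerivAt_id y).const_mul l).cos
        have h1 : HasDerivAt (fun y : ℝ => 1 - y) (-1) y := by
          simpa using (hasDerivAt_id y).const_sub 1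
        refine ((h1.mul (hs.div_const l)).sub (hc.div_const (l ^ 2))).congr_deriv ?_
        field_simp
        ring
      rw [intervalIntegral.integral_eq_sub_of_hasDerivAt (fun y _ => hderiv y)
        (Continuous.intervalIntegrable (by fun_prop) _ _)]
      have : (1 - (1 : ℝ)) * (Real.sin (l * 1) / l) - Real.cos (l * 1) / l ^ 2 -
          ((1 - 0) * (Real.sin (l * 0) / l) - Real.cos (l * 0) / l ^ 2) =
          (1 - Real.cos l) / l ^ 2 := by
        simp; ring
      rw [this]
      exact div_nonneg (by linarith [Real.cos_le_one l]) (sq_nonneg _)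
  | insert a s ha ih =>
    have h : ∀ y : ℝ, (1 - y) * Real.cos (l * y) * ∏ i ∈ insert a s, Real.cos (μ i * y) ^ 2 =
        1 / 2 * ((1 - y) * Real.cos (l * y) * ∏ i ∈ s, Real.cos (μ i * y) ^ 2) +
        (1 / 4 * ((1 - y) * Real.cos ((l + 2 * μ a) * y) * ∏ i ∈ s, Real.cos (μ i * y) ^ 2) +
        1 / 4 * ((1 - y) * Real.cos ((l - 2 * μ a) * y) * ∏ i ∈ s, Real.cos (μ i * y) ^ 2)) := by
      intro y
      rw [Finset.prod_insert ha]
      have h1 : Real.cos ((l + 2 * μ a) * y) + Real.cos ((l - 2 * μ a) * y) =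
          2 * Real.cos (l * y) * (2 * Real.cos (μ a * y) ^ 2 - 1) := by
        rw [show (l + 2 * μ a) * y = l * y + 2 * (μ a * y) by ring,
          show (l - 2 * μ a) * y = l * y - 2 * (μ a * y) by ring, Real.cos_add, Real.cos_sub,
          Real.cos_two_mul]
        ring
      linear_combination (-(1 / 4) * (1 - y) * ∏ i ∈ s, Real.cos (μ i * y) ^ 2) * h1
    simp only [h]
    rw [intervalIntegral.integral_add (Continuous.intervalIntegrable (by fun_prop) _ _)
      (Continuous.intervalIntegrable (by fun_prop) _ _),
      intervalIntegral.integral_add (Continuous.intervalIntegrable (by fun_prop) _ _)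
      (Continuous.intervalIntegrable (by fun_prop) _ _), intervalIntegral.integral_const_mul,
      intervalIntegral.integral_const_mul, intervalIntegral.integral_const_mul]
    linarith [ih l, ih (l + 2 * μ a), ih (l - 2 * μ a)]

lemma le_integral_triangle_mul_prod {ι : Type*} (s : Finset ι) (μ : ι → ℝ) :
    1 / 2 * ((2 : ℝ) ^ s.card)⁻¹ ≤
      ∫ y in (0 : ℝ)..1, (1 - y) * ∏ i ∈ s, Real.cos (μ i * y) ^ 2 := by
  classical
  induction s using Finset.induction_on with
  | empty =>
    simp only [Finset.prod_empty, mul_one]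
    rw [intervalIntegral.integral_sub (by simp) (by simp)]
    simp
    norm_num
  | insert a s ha ih =>
    have h : ∀ y : ℝ, (1 - y) * ∏ i ∈ insert a s, Real.cos (μ i * y) ^ 2 =
        1 / 2 * ((1 - y) * ∏ i ∈ s, Real.cos (μ i * y) ^ 2) +
        1 / 2 * ((1 - y) * Real.cos ((2 * μ a) * y) * ∏ i ∈ s, Real.cos (μ i * y) ^ 2) := by
      intro y
      rw [Finset.prod_insert ha, mul_assoc 2, Real.cos_two_mul]
      ring
    simp only [h]
    rw [intervalIntegral.integral_add (Continuous.intervalIntegrable (by fun_prop) _ _)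
      (Continuous.intervalIntegrable (by fun_prop) _ _), intervalIntegral.integral_const_mul,
      intervalIntegral.integral_const_mul, Finset.card_insert_of_notMem ha, pow_succ, mul_inv]
    linarith [integral_triangle_cos_mul_prod_nonneg s μ (2 * μ a)]

lemma le_integral_rieszProd {d : ℕ} (θ : Fin d → ℝ) (m n : ℕ) :
    1 / 2 * (((2 : ℝ) ^ d) ^ (n - m))⁻¹ ≤ ∫ y in (0 : ℝ)..1, rieszProd θ m n y := by
  have h := le_integral_triangle_mul_prod (Finset.Ico m n ×ˢ (Finset.univ : Finset (Fin d)))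
    (fun p => (2 ^ d) ^ p.1 * θ p.2)
  rw [Finset.card_product, Nat.card_Ico, Finset.card_univ, Fintype.card_fin, mul_comm (n - m),
    pow_mul] at h
  refine h.trans (intervalIntegral.integral_mono_on zero_le_one
    (Continuous.intervalIntegrable (by fun_prop) _ _)
    ((continuous_rieszProd θ m n).intervalIntegrable _ _) fun y hy => ?_)
  rw [Finset.prod_product]
  exact mul_le_of_le_one_left (rieszProd_nonneg θ m n y) (by linarith [hy.1])

end RieszLower

/-! ### One-dimensional Riesz products near the zeros of a sine -/

section CosProd

/-- The Riesz product `∏_{m ≤ k < n} cos²(2^{dk} x)` in one variable. -/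
noncomputable def cosProd (d m n : ℕ) (x : ℝ) : ℝ :=
  ∏ k ∈ Finset.Ico m n, Real.cos ((2 ^ d) ^ k * x) ^ 2

lemma cosProd_nonneg (d m n : ℕ) (x : ℝ) : 0 ≤ cosProd d m n x :=
  Finset.prod_nonneg fun _ _ => sq_nonneg _

lemma cosProd_le_one (d m n : ℕ) (x : ℝ) : cosProd d m n x ≤ 1 :=
  Finset.prod_le_one (fun _ _ => sq_nonneg _) fun _ _ => Real.cos_sq_le_one _

@[fun_prop]
lemma continuous_cosProd (d m n : ℕ) : Continuous (cosProd d m n) := by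
  unfold cosProd; fun_prop

lemma rieszProd_eq_prod {d : ℕ} (θ : Fin d → ℝ) (m n : ℕ) (y : ℝ) :
    rieszProd θ m n y = ∏ j, cosProd d m n (y * θ j) := by
  simp only [rieszProd, cosProd]
  rw [Finset.prod_comm]
  refine Finset.prod_congr rfl fun j _ => Finset.prod_congr rfl fun k _ => ?_
  congr 2
  ring

lemma abs_sin_two_pow_le {d : ℕ} (hd : 1 ≤ d) (y : ℝ) :
    |Real.sin (2 ^ d * y)| ≤ 2 ^ d * |Real.cos y| * |Real.sin y| := by
  induction d, hd using Nat.le_induction with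
  | base =>
    rw [pow_one, Real.sin_two_mul, abs_mul, abs_mul, abs_two]
    linarith
  | succ d hd ih =>
    rw [pow_succ', mul_assoc, Real.sin_two_mul, abs_mul, abs_mul, abs_two]
    have h1 := Real.abs_cos_le_one (2 ^ d * y)
    have h2 := abs_nonneg (Real.sin (2 ^ d * y))
    nlinarith

/-- The zeros of the low frequency factor are essentially those of `sin (2^{dm} x)`. -/
lemma sin_sq_le_cosProd {d : ℕ} (hd : 1 ≤ d) (m : ℕ) (x : ℝ) :
    Real.sin ((2 ^ d) ^ m * x) ^ 2 ≤ ((2 ^ d) ^ m) ^ 2 * cosProd d 0 m x := by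
  have key : ∀ m : ℕ, Real.sin ((2 ^ d) ^ m * x) ^ 2 ≤
      ((2 ^ d) ^ m) ^ 2 * cosProd d 0 m x * Real.sin x ^ 2 := by
    intro m
    induction m with
    | zero => simp [cosProd]
    | succ m ih =>
      rw [cosProd, Finset.prod_Ico_succ_top (Nat.zero_le m), ← cosProd]
      have h := abs_sin_two_pow_le hd ((2 ^ d) ^ m * x)
      rw [pow_succ' _ m, mul_assoc]
      have h2 := pow_le_pow_left₀ (abs_nonneg _) h 2
      rw [mul_pow, mul_pow, sq_abs, sq_abs, sq_abs] at h2
      refine h2.trans ?_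
      calc _ ≤ (2 ^ d) ^ 2 * Real.cos ((2 ^ d) ^ m * x) ^ 2 *
            (((2 ^ d) ^ m) ^ 2 * cosProd d 0 m x * Real.sin x ^ 2) :=
            mul_le_mul_of_nonneg_left ih (by positivity)
        _ = _ := by ring
  refine (key m).trans (mul_le_of_le_one_right ?_ (Real.sin_sq_le_one x))
  exact mul_nonneg (by positivity) (cosProd_nonneg _ _ _ _)

lemma cosProd_periodic {d : ℕ} (n : ℕ) : Function.Periodic (cosProd d 0 n) Real.pi := by
  intro x
  refine Finset.prod_congr rfl fun k _ => ?_
  rw [mul_add, show ((2 : ℝ) ^ d) ^ k * Real.pi = ((2 ^ d) ^ k : ℕ) * Real.pi by push_cast; ring,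
    Real.cos_add_nat_mul_pi, mul_pow, ← pow_mul, mul_comm _ 2, pow_mul]
  norm_num

lemma cosProd_succ (d n : ℕ) (x : ℝ) :
    cosProd d 0 (n + 1) x = Real.cos x ^ 2 * cosProd d 0 n (2 ^ d * x) := by
  simp only [cosProd, ← Finset.range_eq_Ico]
  rw [Finset.prod_range_succ', mul_comm]
  congr 1
  · simp
  · refine Finset.prod_congr rfl fun k _ => ?_
    congr 2
    rw [pow_succ]
    ring

/-- Each factor halves the integral, since the factors after the first are `π / 2`-periodic while
`cos² x + cos² (x + π / 2) = 1`. -/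
lemma integral_cosProd_zero_pi {d : ℕ} (hd : 1 ≤ d) (n : ℕ) :
    ∫ x in (0 : ℝ)..Real.pi, cosProd d 0 n x = Real.pi * ((2 : ℝ) ^ n)⁻¹ := by
  induction n with
  | zero => simp [cosProd]
  | succ n ih =>
    set g : ℝ → ℝ := fun x => cosProd d 0 n (2 ^ d * x) with hg
    have hgc : Continuous g := (continuous_cosProd d 0 n).comp (by fun_prop)
    have h2d : (2 : ℝ) ^ d = 2 * (2 ^ (d - 1) : ℕ) := by
      push_cast
      rw [← pow_succ']; congr 1; omega
    have hgp : ∀ x, g (x + Real.pi / 2) = g x := by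
      intro x
      have := (cosProd_periodic (d := d) n).nat_mul (2 ^ (d - 1)) (2 ^ d * x)
      simp only [hg]
      rw [← this, mul_add]
      congr 2
      rw [h2d]; ring
    have hsucc : ∀ x, cosProd d 0 (n + 1) x = Real.cos x ^ 2 * g x := cosProd_succ d n
    simp only [hsucc]
    rw [← intervalIntegral.integral_add_adjacent_intervals (b := Real.pi / 2)
      (Continuous.intervalIntegrable (by fun_prop) _ _)
      (Continuous.intervalIntegrable (by fun_prop) _ _)]
    have h1 : ∫ x in (Real.pi / 2)..Real.pi, Real.cos x ^ 2 * g x =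
        ∫ x in (0 : ℝ)..(Real.pi / 2), Real.sin x ^ 2 * g x := by
      have := intervalIntegral.integral_comp_add_right (a := 0) (b := Real.pi / 2)
        (fun x => Real.cos x ^ 2 * g x) (Real.pi / 2)
      rw [zero_add, add_halves] at this
      rw [← this]
      refine intervalIntegral.integral_congr fun x _ => ?_
      simp only [hgp, Real.cos_add_pi_div_two, neg_sq]
    rw [h1, ← intervalIntegral.integral_add (Continuous.intervalIntegrable (by fun_prop) _ _)
      (Continuous.intervalIntegrable (by fun_prop) _ _)]
    have h2 : ∀ x, Real.cos x ^ 2 * g x + Real.sin x ^ 2 * g x = g x := by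
      intro x
      rw [← add_mul, Real.cos_sq_add_sin_sq, one_mul]
    simp only [h2]
    rw [hg, intervalIntegral.integral_comp_mul_left _ (by positivity), mul_zero]
    have h3 := (cosProd_periodic (d := d) n).intervalIntegral_add_zsmul_eq
      (2 ^ (d - 1) : ℕ) 0 (fun a b => (continuous_cosProd d 0 n).intervalIntegrable a b)
    rw [zero_add] at h3
    have h4 : (2 : ℝ) ^ d * (Real.pi / 2) = ((2 ^ (d - 1) : ℕ) : ℤ) • Real.pi := by
      rw [h2d]; simp; ring
    rw [h4, h3, zero_add, ih, h2d, smul_eq_mul]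
    simp only [zsmul_eq_mul]
    push_cast
    rw [pow_succ]
    field_simp

lemma cosProd_le_comp (d l n : ℕ) (x : ℝ) :
    cosProd d 0 n x ≤ cosProd d 0 (n - l) ((2 ^ d) ^ l * x) := by
  rcases le_total n l with h | h
  · rw [Nat.sub_eq_zero_of_le h]
    exact (cosProd_le_one _ _ _ _).trans (by simp [cosProd])
  · have h1 : cosProd d 0 (n - l) ((2 ^ d) ^ l * x) = cosProd d l n x := by
      simp only [cosProd]
      rw [Finset.prod_Ico_eq_prod_range _ l n, ← Finset.range_eq_Ico]
      refine Finset.prod_congr rfl fun k _ => ?_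
      rw [pow_add]
      congr 2
      ring
    rw [h1, cosProd, ← Finset.prod_Ico_consecutive _ (Nat.zero_le l) h]
    exact mul_le_of_le_one_left (cosProd_nonneg _ _ _ _) (cosProd_le_one _ _ _ _)

/-- Within `π 2^{-dl}` of the origin the factors of frequency below `2^{dl}` are bounded by `1`,
which loses `2^l` in the mean value, while the length of the interval gains `2^{-dl}`. -/
lemma integral_cosProd_le {d : ℕ} (hd : 1 ≤ d) (l n : ℕ) :
    ∫ x in -(Real.pi * (((2 : ℝ) ^ d) ^ l)⁻¹)..(Real.pi * (((2 : ℝ) ^ d) ^ l)⁻¹), cosProd d 0 n x ≤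
      2 * Real.pi * (2 / 2 ^ d) ^ l * ((2 : ℝ) ^ n)⁻¹ := by
  set A : ℝ := ((2 : ℝ) ^ d) ^ l with hA
  have hA0 : 0 < A := by positivity
  have hcomp : Continuous fun x => cosProd d 0 (n - l) (A * x) :=
    (continuous_cosProd d 0 (n - l)).comp (by fun_prop)
  calc _ ≤ ∫ x in -(Real.pi * A⁻¹)..(Real.pi * A⁻¹), cosProd d 0 (n - l) (A * x) := by
        refine intervalIntegral.integral_mono_on ?_
          ((continuous_cosProd d 0 n).intervalIntegrable _ _)
          (hcomp.intervalIntegrable _ _) fun x _ => cosProd_le_comp d l n x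
        have : 0 ≤ Real.pi * A⁻¹ := by positivity
        linarith
    _ = A⁻¹ * (2 * (Real.pi * ((2 : ℝ) ^ (n - l))⁻¹)) := by
        rw [intervalIntegral.integral_comp_mul_left _ hA0.ne', smul_eq_mul]
        have e1 : A * -(Real.pi * A⁻¹) = -Real.pi := by field_simp
        have e2 : A * (Real.pi * A⁻¹) = -Real.pi + (2 : ℤ) • Real.pi := by
          rw [zsmul_eq_mul]; field_simp; norm_num
        rw [e1, e2, (cosProd_periodic (d := d) (n - l)).intervalIntegral_add_zsmul_eq 2 (-Real.pi)
          (fun a b => (continuous_cosProd d 0 (n - l)).intervalIntegrable a b),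
          (cosProd_periodic (d := d) (n - l)).intervalIntegral_add_eq (-Real.pi) 0, zero_add,
          integral_cosProd_zero_pi hd]
        simp
    _ ≤ A⁻¹ * (2 * (Real.pi * (2 ^ l * ((2 : ℝ) ^ n)⁻¹))) := by
        have : ((2 : ℝ) ^ (n - l))⁻¹ ≤ 2 ^ l * ((2 : ℝ) ^ n)⁻¹ := by
          rw [inv_le_iff_one_le_mul₀ (by positivity)]
          have h1 : (2 : ℝ) ^ n ≤ 2 ^ l * 2 ^ (n - l) := by
            rw [← pow_add]; exact pow_le_pow_right₀ (by norm_num) (by omega)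
          have h2 : 2 ^ l * ((2 : ℝ) ^ n)⁻¹ * 2 ^ (n - l) = 2 ^ l * 2 ^ (n - l) / 2 ^ n := by
            field_simp
          rw [h2, le_div_iff₀ (by positivity)]
          linarith
        gcongr
    _ = _ := by
        rw [div_pow, ← hA]
        field_simp

/-- The set of points where `|sin (2^{dm} x)| ≤ 2^{-dl}`, that is the neighbourhood of the zeros of
the low frequency factor. -/
def nearZeros (d m l : ℕ) : Set ℝ := {x | |Real.sin ((2 ^ d) ^ m * x)| ≤ (((2 : ℝ) ^ d) ^ l)⁻¹}

lemma isClosed_nearZeros (d m l : ℕ) : IsClosed (nearZeros d m l) :=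
  isClosed_le (by fun_prop) continuous_const

lemma nearZeros_zero (d m : ℕ) : nearZeros d m 0 = Set.univ := by
  ext x; simp [nearZeros, Real.abs_sin_le_one]

/-- All frequencies of `cosProd d m n` are multiples of `2^{dm}`, so that its behaviour near every
zero of `sin (2^{dm} x)` is that near the origin. -/
lemma integral_nearZeros_le {d : ℕ} (hd : 1 ≤ d) (m n l : ℕ) :
    ∫ x in Set.Icc (-1 : ℝ) 1, (nearZeros d m l).indicator (cosProd d m n) x ≤
      4 * Real.pi * (2 / 2 ^ d) ^ l * ((2 : ℝ) ^ (n - m))⁻¹ := by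
  set A : ℝ := ((2 : ℝ) ^ d) ^ m with hA
  set e : ℝ := (((2 : ℝ) ^ d) ^ l)⁻¹ with he
  have hA0 : 0 < A := by positivity
  set Φ : ℝ → ℝ := {u : ℝ | |Real.sin u| ≤ e}.indicator (cosProd d 0 (n - m)) with hΦ
  have hmeas : MeasurableSet {u : ℝ | |Real.sin u| ≤ e} :=
    (isClosed_le (by fun_prop) continuous_const).measurableSet
  have hΦint : ∀ a b : ℝ, IntervalIntegrable Φ volume a b := fun a b =>
    (intervalIntegrable_iff.2 ((intervalIntegrable_iff.1
      ((continuous_cosProd d 0 (n - m)).intervalIntegrable a b)).indicator hmeas))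
  have hΦ0 : ∀ u, 0 ≤ Φ u := fun u => Set.indicator_nonneg (fun _ _ => cosProd_nonneg _ _ _ _) u
  have hΦp : Function.Periodic Φ Real.pi := by
    intro u
    classical
    simp only [hΦ, Set.indicator_apply, Set.mem_ofPred_eq, Real.sin_add_pi, abs_neg]
    rw [cosProd_periodic]
  have h1 : ∀ x, (nearZeros d m l).indicator (cosProd d m n) x = Φ (A * x) := by
    intro x
    classical
    simp only [hΦ, Set.indicator_apply, nearZeros, Set.mem_ofPred_eq, ← hA, ← he]
    congr 1
    simp only [cosProd]
    rw [Finset.prod_Ico_eq_prod_range _ m n, ← Finset.range_eq_Ico]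
    refine Finset.prod_congr rfl fun k _ => ?_
    rw [pow_add, hA]
    congr 2
    ring
  simp only [h1]
  have hpi := Real.pi_gt_three
  have hN : A = ((2 ^ d) ^ m : ℕ) := by push_cast; rw [hA]
  rw [integral_Icc_eq_integral_Ioc, ← intervalIntegral.integral_of_le (by norm_num),
    intervalIntegral.integral_comp_mul_left _ hA0.ne', smul_eq_mul]
  have h2 : ∫ x in (A * -1)..(A * 1), Φ x ≤ ∫ x in (-(A * Real.pi))..(A * Real.pi), Φ x := by
    refine intervalIntegral.integral_mono_interval ?_ (by nlinarith) ?_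
      (Filter.Eventually.of_forall hΦ0) (hΦint _ _)
    · nlinarith
    · nlinarith
  have h3 : ∫ x in (-(A * Real.pi))..(A * Real.pi), Φ x =
      2 * A * ∫ x in (-(Real.pi / 2))..(Real.pi / 2), Φ x := by
    have e2 : A * Real.pi = -(A * Real.pi) + ((2 * (2 ^ d) ^ m : ℕ) : ℤ) • Real.pi := by
      rw [zsmul_eq_mul, hN]; push_cast; ring
    have h := hΦp.intervalIntegral_add_zsmul_eq (2 * (2 ^ d) ^ m : ℕ) (-(A * Real.pi)) hΦint
    rw [← e2] at h
    rw [h, hΦp.intervalIntegral_add_eq _ (-(Real.pi / 2)),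
      show -(Real.pi / 2) + Real.pi = Real.pi / 2 by ring, zsmul_eq_mul, hN]
    push_cast
    ring
  have h4 : ∫ x in (-(Real.pi / 2))..(Real.pi / 2), Φ x ≤
      ∫ x in -(Real.pi * e)..(Real.pi * e), cosProd d 0 (n - m) x := by
    have hpe : 0 ≤ Real.pi * e := by positivity
    rw [intervalIntegral.integral_of_le (by linarith),
      intervalIntegral.integral_of_le (by linarith),
      ← integral_indicator measurableSet_Ioc, ← integral_Icc_eq_integral_Ioc,
      ← integral_indicator measurableSet_Icc]
    refine integral_mono ?_ ?_ fun x => ?_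
    · exact (integrable_indicator_iff measurableSet_Ioc).2
        ((intervalIntegrable_iff_integrableOn_Ioc_of_le (by linarith)).1 (hΦint _ _))
    · exact (integrable_indicator_iff measurableSet_Icc).2
        (continuous_cosProd _ _ _).continuousOn.integrableOn_Icc
    · have hnn : 0 ≤ (Set.Icc (-(Real.pi * e)) (Real.pi * e)).indicator (cosProd d 0 (n - m)) x :=
        Set.indicator_nonneg (fun _ _ => cosProd_nonneg _ _ _ _) x
      by_cases hx : x ∈ Set.Ioc (-(Real.pi / 2)) (Real.pi / 2)
      · rw [Set.indicator_of_mem hx]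
        by_cases hx2 : |Real.sin x| ≤ e
        · have hxa : |x| ≤ Real.pi / 2 := abs_le.2 ⟨hx.1.le, hx.2⟩
          have h5 := Real.mul_abs_le_abs_sin hxa
          have h6 : |x| ≤ Real.pi * e := by
            have h7 : 2 / Real.pi * |x| ≤ e := h5.trans hx2
            rw [div_mul_eq_mul_div, div_le_iff₀ (by linarith)] at h7
            nlinarith [abs_nonneg x]
          rw [Set.indicator_of_mem (Set.mem_Icc.2 (abs_le.1 h6))]
          exact Set.indicator_le_self' (fun _ _ => cosProd_nonneg _ _ _ _) x
        · have : Φ x = 0 := Set.indicator_of_notMem (show x ∉ {u : ℝ | |Real.sin u| ≤ e} from hx2) _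
          rw [this]; exact hnn
      · rw [Set.indicator_of_notMem hx]; exact hnn
  have h5 := integral_cosProd_le hd l (n - m)
  calc _ ≤ A⁻¹ * (2 * A * (2 * Real.pi * (2 / 2 ^ d) ^ l * ((2 : ℝ) ^ (n - m))⁻¹)) := by
        refine mul_le_mul_of_nonneg_left ?_ (by positivity)
        rw [h3] at h2
        exact h2.trans (mul_le_mul_of_nonneg_left (h4.trans h5) (by positivity))
    _ = _ := by field_simp; norm_num

end CosProd

/-! ### Polar coordinates -/

section Polar

/-- Polar coordinates, in the form of an inequality: outside the ball of radius `ρ` the Jacobian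
`r^(d-1)` is at least `ρ^(d-1)`. -/
lemma lintegral_sphere_le {E : Type*} [NormedAddCommGroup E] [NormedSpace ℝ E]
    [FiniteDimensional ℝ E] [Nontrivial E] [MeasurableSpace E] [BorelSpace E] (μ : Measure E)
    [μ.IsAddHaarMeasure] {Φ : E → ℝ≥0∞} (hΦ : Measurable Φ) {ρ : ℝ} (hρ : 0 < ρ) :
    ∫⁻ θ : Metric.sphere (0 : E) 1, (∫⁻ y in Set.Ioc ρ 1, Φ (y • (θ : E))) ∂μ.toSphere ≤
    ENNReal.ofReal ((ρ ^ (Module.finrank ℝ E - 1))⁻¹) * ∫⁻ x in Metric.closedBall 0 1, Φ x ∂μ := by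
  have : ProperSpace E := FiniteDimensional.proper_real E
  have hmp := μ.measurePreserving_homeomorphUnitSphereProd
  set d := Module.finrank ℝ E
  set G : Metric.sphere (0 : E) 1 × Set.Ioi (0 : ℝ) → ℝ≥0∞ := fun p =>
    (Set.Ioc ρ 1).indicator (fun r => Φ (r • (p.1 : E))) (p.2 : ℝ) with hG
  have hGm : Measurable G := by
    have h1 : Measurable fun p : Metric.sphere (0 : E) 1 × Set.Ioi (0 : ℝ) =>
        Φ ((p.2 : ℝ) • (p.1 : E)) := by
      have h0 : Measurable fun p : Metric.sphere (0 : E) 1 × Set.Ioi (0 : ℝ) =>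
        (p.2 : ℝ) • (p.1 : E) := by fun_prop
      exact hΦ.comp h0
    have h2 : MeasurableSet {p : Metric.sphere (0 : E) 1 × Set.Ioi (0 : ℝ) |
        (p.2 : ℝ) ∈ Set.Ioc ρ 1} := by
      have : Measurable fun p : Metric.sphere (0 : E) 1 × Set.Ioi (0 : ℝ) => (p.2 : ℝ) := by
        fun_prop
      exact this measurableSet_Ioc
    exact h1.indicator h2
  have h1 : ∫⁻ p, G p ∂(μ.toSphere.prod (Measure.volumeIoiPow (d - 1))) ≤
      ∫⁻ x in Metric.closedBall 0 1, Φ x ∂μ := by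
    rw [← hmp.lintegral_comp hGm]
    have h2 : ∀ x : ({0}ᶜ : Set E), G (homeomorphUnitSphereProd E x) ≤
        (Metric.closedBall (0 : E) 1).indicator Φ x := by
      intro x
      have hx : (x : E) ≠ 0 := x.2
      have hx' : ‖(x : E)‖ ≠ 0 := norm_ne_zero_iff.2 hx
      simp only [hG, homeomorphUnitSphereProd_apply_snd_coe, homeomorphUnitSphereProd_apply_fst_coe]
      by_cases h : ‖(x : E)‖ ∈ Set.Ioc ρ 1
      · rw [Set.indicator_of_mem h, Set.indicator_of_mem (by simpa using h.2), smul_smul,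
          mul_inv_cancel₀ hx', one_smul]
      · rw [Set.indicator_of_notMem h]; exact zero_le
    calc _ ≤ ∫⁻ x : ({0}ᶜ : Set E), (Metric.closedBall (0 : E) 1).indicator Φ x
          ∂(μ.comap Subtype.val) := lintegral_mono h2
      _ = ∫⁻ x in ({0}ᶜ : Set E), (Metric.closedBall (0 : E) 1).indicator Φ x ∂μ := by
          rw [lintegral_subtype_comap (measurableSet_singleton _).compl]
      _ ≤ ∫⁻ x, (Metric.closedBall (0 : E) 1).indicator Φ x ∂μ := setLIntegral_le_lintegral _ _
      _ = _ := lintegral_indicator Metric.isClosed_closedBall.measurableSet _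
  rw [lintegral_prod _ hGm.aemeasurable] at h1
  have h3 : ∀ θ : Metric.sphere (0 : E) 1, ENNReal.ofReal (ρ ^ (d - 1)) *
      ∫⁻ y in Set.Ioc ρ 1, Φ (y • (θ : E)) ≤
      ∫⁻ r, G (θ, r) ∂(Measure.volumeIoiPow (d - 1)) := by
    intro θ
    have hΦθ : Measurable fun r : ℝ => Φ (r • (θ : E)) := by
      have h0 : Measurable fun r : ℝ => r • (θ : E) := by fun_prop
      exact hΦ.comp h0
    have hw : Measurable fun r : Set.Ioi (0 : ℝ) => ENNReal.ofReal ((r : ℝ) ^ (d - 1)) := by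
      fun_prop
    have hGθ : Measurable fun r : Set.Ioi (0 : ℝ) => G (θ, r) := hGm.comp measurable_prodMk_left
    rw [Measure.volumeIoiPow, lintegral_withDensity_eq_lintegral_mul _ hw hGθ]
    have h4 := lintegral_subtype_comap (μ := (volume : Measure ℝ))
      (measurableSet_Ioi (a := (0 : ℝ))) (fun r : ℝ => ENNReal.ofReal (r ^ (d - 1)) *
        (Set.Ioc ρ 1).indicator (fun r => Φ (r • (θ : E))) r)
    simp only [Pi.mul_apply, hG]
    rw [h4, ← lintegral_const_mul _ hΦθ]
    have h5 : Set.Ioc ρ 1 ⊆ Set.Ioi 0 := fun r hr => hρ.trans hr.1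
    calc _ ≤ ∫⁻ r in Set.Ioc ρ 1, ENNReal.ofReal (r ^ (d - 1)) *
          (Set.Ioc ρ 1).indicator (fun r => Φ (r • (θ : E))) r := by
          refine setLIntegral_mono' measurableSet_Ioc fun r hr => ?_
          rw [Set.indicator_of_mem hr]
          gcongr
          exact hr.1.le
      _ ≤ _ := lintegral_mono_set h5
  have h6 : ENNReal.ofReal (ρ ^ (d - 1)) * ∫⁻ θ : Metric.sphere (0 : E) 1,
      (∫⁻ y in Set.Ioc ρ 1, Φ (y • (θ : E))) ∂μ.toSphere ≤
      ∫⁻ x in Metric.closedBall 0 1, Φ x ∂μ := by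
    rw [← lintegral_const_mul]
    · exact (lintegral_mono h3).trans h1
    · have : Measurable fun p : Metric.sphere (0 : E) 1 × ℝ => Φ (p.2 • (p.1 : E)) := by
        have h0 : Measurable fun p : Metric.sphere (0 : E) 1 × ℝ => p.2 • (p.1 : E) := by fun_prop
        exact hΦ.comp h0
      exact this.lintegral_prod_right'
  have hρ' : ENNReal.ofReal (ρ ^ (d - 1)) ≠ 0 := by
    rw [Ne, ENNReal.ofReal_eq_zero, not_le]; positivity
  rw [ENNReal.ofReal_inv_of_pos (by positivity), mul_comm, ← div_eq_mul_inv]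
  rw [ENNReal.le_div_iff_mul_le (Or.inl hρ') (Or.inl ENNReal.ofReal_ne_top), mul_comm]
  exact h6

end Polar

/-! ### Averaging over directions -/

section SmallValues

/-- The Riesz product at `x ∈ ℝ^d`, weighted by the number of coordinates of `x` close to a zero of
the low frequency factor. -/
noncomputable def badProd (d m n l : ℕ) (x : Fin d → ℝ) : ℝ :=
  ∑ j, ∏ i, (if i = j then (nearZeros d m l).indicator (cosProd d m n) else cosProd d m n) (x i)

lemma badProd_eq (d m n l : ℕ) (x : Fin d → ℝ) : badProd d m n l x =
    ∑ j, (nearZeros d m l).indicator (fun _ => ∏ i, cosProd d m n (x i)) (x j) := by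
  classical
  refine Finset.sum_congr rfl fun j _ => ?_
  by_cases h : x j ∈ nearZeros d m l
  · rw [Set.indicator_of_mem h]
    refine Finset.prod_congr rfl fun i _ => ?_
    split_ifs with hij
    · subst hij; rw [Set.indicator_of_mem h]
    · rfl
  · rw [Set.indicator_of_notMem h]
    refine Finset.prod_eq_zero (Finset.mem_univ j) ?_
    rw [if_pos rfl, Set.indicator_of_notMem h]

lemma badProd_nonneg (d m n l : ℕ) (x : Fin d → ℝ) : 0 ≤ badProd d m n l x := by
  rw [badProd_eq]
  exact Finset.sum_nonneg fun j _ => Set.indicator_nonneg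
    (fun _ _ => Finset.prod_nonneg fun _ _ => cosProd_nonneg _ _ _ _) _

lemma measurable_badProd (d m n l : ℕ) : Measurable (badProd d m n l) := by
  unfold badProd
  refine Finset.measurable_sum _ fun j _ => Finset.measurable_prod _ fun i _ => ?_
  have h := (continuous_cosProd d m n).measurable
  split_ifs
  · exact (h.indicator (isClosed_nearZeros d m l).measurableSet).comp (measurable_pi_apply i)
  · exact h.comp (measurable_pi_apply i)

lemma lintegral_badProd_le {d : ℕ} (hd : 1 ≤ d) (m n l : ℕ) :
    ∫⁻ x : EuclideanSpace ℝ (Fin d) in Metric.closedBall 0 1,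
      ENNReal.ofReal (badProd d m n l x) ≤
    ENNReal.ofReal (d * (4 * Real.pi) ^ d * (2 / 2 ^ d) ^ l * (((2 : ℝ) ^ d) ^ (n - m))⁻¹) := by
  classical
  set f : Fin d → Fin d → ℝ → ℝ := fun j i => (Set.Icc (-1 : ℝ) 1).indicator
    (if i = j then (nearZeros d m l).indicator (cosProd d m n) else cosProd d m n) with hf
  have hfint : ∀ j i, Integrable (f j i) := by
    intro j i
    rw [hf, integrable_indicator_iff measurableSet_Icc]
    split_ifs
    · exact ((continuous_cosProd d m n).continuousOn.integrableOn_Icc).indicator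
        (isClosed_nearZeros d m l).measurableSet
    · exact (continuous_cosProd d m n).continuousOn.integrableOn_Icc
  have hf0 : ∀ j i x, 0 ≤ f j i x := by
    intro j i x
    refine Set.indicator_nonneg (fun x _ => ?_) x
    split_ifs
    · exact Set.indicator_nonneg (fun _ _ => cosProd_nonneg _ _ _ _) x
    · exact cosProd_nonneg _ _ _ _
  set g : (Fin d → ℝ) → ℝ := fun x => ∑ j, ∏ i, f j i (x i) with hg
  have hgint : Integrable g := integrable_finsetSum _ fun j _ => Integrable.fintype_prod (hfint j)
  have hg0 : ∀ x, 0 ≤ g x := fun x => Finset.sum_nonneg fun j _ =>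
    Finset.prod_nonneg fun i _ => hf0 j i _
  have h1 : ∀ x : EuclideanSpace ℝ (Fin d), x ∈ Metric.closedBall 0 1 →
      badProd d m n l x = g x := by
    intro x hx
    refine Finset.sum_congr rfl fun j _ => Finset.prod_congr rfl fun i _ => ?_
    have : x i ∈ Set.Icc (-1 : ℝ) 1 := by
      rw [mem_closedBall_zero_iff] at hx
      have := (PiLp.norm_apply_le x i).trans hx
      exact Set.mem_Icc.2 (abs_le.1 (by simpa using this))
    simp only [hf]
    rw [Set.indicator_of_mem this]
  have hbound : ∫ x, g x ≤
      d * (4 * Real.pi) ^ d * (2 / 2 ^ d) ^ l * (((2 : ℝ) ^ d) ^ (n - m))⁻¹ := by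
    have hsum : ∫ x, g x = ∑ j, ∫ x : Fin d → ℝ, ∏ i, f j i (x i) :=
      integral_finsetSum _ fun j _ => Integrable.fintype_prod (hfint j)
    rw [hsum]
    have h2 : ∀ j, ∫ x : Fin d → ℝ, ∏ i, f j i (x i) ≤
        (4 * Real.pi) ^ d * (2 / 2 ^ d) ^ l * (((2 : ℝ) ^ d) ^ (n - m))⁻¹ := by
      intro j
      rw [integral_fintype_prod_volume_eq_prod]
      have h3 : ∀ i, ∫ x, f j i x ≤ 4 * Real.pi * ((2 : ℝ) ^ (n - m))⁻¹ *
          (if i = j then (2 / 2 ^ d) ^ l else 1) := by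
        intro i
        simp only [hf]
        rw [integral_indicator measurableSet_Icc]
        split_ifs
        · refine (integral_nearZeros_le hd m n l).trans (le_of_eq (by ring))
        · have := integral_nearZeros_le hd m n 0
          rw [nearZeros_zero, Set.indicator_univ, pow_zero] at this
          refine this.trans (le_of_eq (by ring))
      calc _ ≤ ∏ i, (4 * Real.pi * ((2 : ℝ) ^ (n - m))⁻¹ *
            (if i = j then (2 / 2 ^ d) ^ l else 1)) :=
            Finset.prod_le_prod (fun i _ => integral_nonneg (hf0 j i)) fun i _ => h3 i
        _ = _ := by
            rw [Finset.prod_mul_distrib, Finset.prod_ite_eq']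
            simp only [Finset.prod_const, Finset.card_univ, Fintype.card_fin, Finset.mem_univ,
              if_true]
            rw [mul_pow, inv_pow, ← pow_mul, ← pow_mul, mul_comm (n - m) d]
            ring
    calc _ ≤ ∑ j : Fin d, _ := Finset.sum_le_sum fun j _ => h2 j
      _ = _ := by
        rw [Finset.sum_const, Finset.card_univ, Fintype.card_fin, nsmul_eq_mul]
        ring
  calc _ = ∫⁻ x : EuclideanSpace ℝ (Fin d) in Metric.closedBall 0 1, ENNReal.ofReal (g x) :=
        setLIntegral_congr_fun Metric.isClosed_closedBall.measurableSet fun x hx => by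
          simp only [h1 x hx]
    _ ≤ ∫⁻ x : EuclideanSpace ℝ (Fin d), ENNReal.ofReal (g x) := setLIntegral_le_lintegral _ _
    _ = ∫⁻ x : Fin d → ℝ, ENNReal.ofReal (g x) := by
        rw [← (PiLp.volume_preserving_toLp (Fin d)).lintegral_comp_emb
          (MeasurableEquiv.toLp 2 _).measurableEmbedding]
    _ = ENNReal.ofReal (∫ x, g x) :=
        (ofReal_integral_eq_lintegral_ofReal hgint (Filter.Eventually.of_forall hg0)).symm
    _ ≤ _ := ENNReal.ofReal_le_ofReal hbound

/-- Averaged over all directions, the high frequency factor gives little mass to the small values of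
the low frequency factor: near a zero of one coordinate factor, the other coordinates remain
independent. -/
lemma lintegral_sphere_badProd_le {d : ℕ} (hd : 2 ≤ d) (m n l : ℕ) :
    ∫⁻ θ : Metric.sphere (0 : EuclideanSpace ℝ (Fin d)) 1,
      (∫⁻ y in Set.Ioc ((((2 : ℝ) ^ d) ^ m)⁻¹) 1,
        ENNReal.ofReal (badProd d m n l fun i => y * (θ : EuclideanSpace ℝ (Fin d)) i))
      ∂((volume : Measure (EuclideanSpace ℝ (Fin d))).toSphere) ≤
    ENNReal.ofReal ((((2 : ℝ) ^ d) ^ m) ^ (d - 1) *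
      (d * (4 * Real.pi) ^ d * (2 / 2 ^ d) ^ l * (((2 : ℝ) ^ d) ^ (n - m))⁻¹)) := by
  have hm : Measurable fun x : EuclideanSpace ℝ (Fin d) =>
      ENNReal.ofReal (badProd d m n l x) :=
    ((measurable_badProd d m n l).comp (by fun_prop)).ennreal_ofReal
  have hne : Nonempty (Fin d) := ⟨⟨0, by omega⟩⟩
  have h := lintegral_sphere_le volume hm (ρ := (((2 : ℝ) ^ d) ^ m)⁻¹) (by positivity)
  rw [inv_pow, inv_inv, finrank_euclideanSpace_fin] at h
  rw [ENNReal.ofReal_mul (by positivity)]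
  exact h.trans (mul_le_mul_right (lintegral_badProd_le (by omega) m n l) _)

end SmallValues

/-! ### Riesz products in a fixed direction -/

section Directions

lemma one_sub_le_mul {x z a b : ℝ} (hx : x ≤ 1) (hz : z ≤ 1) (hxa : 1 - a ≤ x)
    (hzb : 1 - b ≤ z) : 1 - (a + b) ≤ x * z := by
  nlinarith [mul_nonneg (sub_nonneg.2 hx) (sub_nonneg.2 hz)]

lemma one_sub_sum_le_prod_cos_sq {ι : Type*} (s : Finset ι) (φ : ι → ℝ) :
    1 - ∑ j ∈ s, φ j ^ 2 ≤ ∏ j ∈ s, Real.cos (φ j) ^ 2 := by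
  classical
  induction s using Finset.induction_on with
  | empty => simp
  | insert a s ha ih =>
    rw [Finset.sum_insert ha, Finset.prod_insert ha]
    refine one_sub_le_mul (Real.cos_sq_le_one _)
      (Finset.prod_le_one (fun _ _ => sq_nonneg _) fun _ _ => Real.cos_sq_le_one _) ?_ ih
    rw [Real.cos_sq']
    have := Real.abs_sin_le_abs (x := φ a)
    have := sq_le_sq' (by linarith [abs_nonneg (φ a), neg_abs_le (Real.sin (φ a)), this])
      ((le_abs_self _).trans this)
    rw [sq_abs] at this
    linarith

/-- The Riesz product of length `p` is close to `1` at scales up to `2^{-dp}`. -/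
lemma half_le_rieszProd {d : ℕ} (hd : 2 ≤ d) {θ : Fin d → ℝ} (hθ : ∑ j, θ j ^ 2 = 1) (p : ℕ)
    {y : ℝ} (hy0 : 0 ≤ y) (hy : y ≤ (((2 : ℝ) ^ d) ^ p)⁻¹) : 1 / 2 ≤ rieszProd θ 0 p y := by
  have hL4 : (4 : ℝ) ≤ 2 ^ d := by
    have : (2 : ℝ) ^ 2 ≤ 2 ^ d := pow_le_pow_right₀ (by norm_num) hd
    linarith
  have h : ∀ p : ℕ, 1 - (((2 : ℝ) ^ d) ^ p * y) ^ 2 / 2 ≤ rieszProd θ 0 p y := by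
    intro p
    induction p with
    | zero => simp [rieszProd]; positivity
    | succ p ih =>
      rw [rieszProd, Finset.prod_Ico_succ_top (Nat.zero_le p), ← rieszProd]
      have h1 := one_sub_sum_le_prod_cos_sq Finset.univ fun j => (2 ^ d) ^ p * θ j * y
      have h2 : ∑ j, ((2 ^ d) ^ p * θ j * y) ^ 2 = (((2 : ℝ) ^ d) ^ p * y) ^ 2 := by
        have : ∀ j, ((2 ^ d) ^ p * θ j * y) ^ 2 = (((2 : ℝ) ^ d) ^ p * y) ^ 2 * θ j ^ 2 :=
          fun j => by ring
        simp only [this, ← Finset.mul_sum, hθ, mul_one]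
      rw [h2] at h1
      have h3 := one_sub_le_mul (rieszProd_le_one θ 0 p y)
        (Finset.prod_le_one (fun _ _ => sq_nonneg _) fun _ _ => Real.cos_sq_le_one _) ih h1
      refine le_trans ?_ h3
      have e : ((2 : ℝ) ^ d) ^ (p + 1) * y = 2 ^ d * (((2 : ℝ) ^ d) ^ p * y) := by
        rw [pow_succ]; ring
      rw [e, mul_pow ((2 : ℝ) ^ d) _ 2]
      have h16 : (16 : ℝ) ≤ (2 ^ d) ^ 2 := by nlinarith
      nlinarith [mul_le_mul_of_nonneg_right h16 (sq_nonneg (((2 : ℝ) ^ d) ^ p * y))]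
  have h1 := h p
  have h2 : ((2 : ℝ) ^ d) ^ p * y ≤ 1 := by
    have := mul_le_mul_of_nonneg_left hy (show 0 ≤ ((2 : ℝ) ^ d) ^ p by positivity)
    rwa [mul_inv_cancel₀ (by positivity)] at this
  have h3 : 0 ≤ ((2 : ℝ) ^ d) ^ p * y := by positivity
  nlinarith

lemma rieszProd_comp {d : ℕ} (θ : Fin d → ℝ) (m n : ℕ) (y : ℝ) :
    rieszProd θ 0 n ((2 ^ d) ^ m * y) = rieszProd θ m (m + n) y := by
  simp only [rieszProd]
  rw [Finset.prod_Ico_eq_prod_range _ m, ← Finset.range_eq_Ico, Nat.add_sub_cancel_left]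
  refine Finset.prod_congr rfl fun k _ => Finset.prod_congr rfl fun j _ => ?_
  rw [pow_add]
  congr 2
  ring

lemma rieszProd_mul {d : ℕ} (θ : Fin d → ℝ) {m n : ℕ} (h : m ≤ n) (y : ℝ) :
    rieszProd θ 0 m y * rieszProd θ m n y = rieszProd θ 0 n y :=
  Finset.prod_Ico_consecutive _ (Nat.zero_le m) h

/-- Rescaling by `2^{dp}` moves the scale `[2^{-dm}, 1]` to `[2^{-d(p+m)}, 2^{-dp}]`, on which the
additional `p` factors are harmless. -/
lemma integral_rieszProd_shift_le {d : ℕ} (hd : 2 ≤ d) {θ : Fin d → ℝ} (hθ : ∑ j, θ j ^ 2 = 1)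
    (m n p : ℕ) :
    (2 ^ d) ^ n * ∫ y in ((((2 : ℝ) ^ d) ^ m)⁻¹)..1, rieszProd θ 0 n y ≤
      2 * ((2 ^ d) ^ (p + n) *
        ∫ y in ((((2 : ℝ) ^ d) ^ (p + m))⁻¹)..((((2 : ℝ) ^ d) ^ p)⁻¹),
          rieszProd θ 0 (p + n) y) := by
  set A : ℝ := ((2 : ℝ) ^ d) ^ p with hA
  have hA0 : 0 < A := by positivity
  have hone : (1 : ℝ) ≤ ((2 : ℝ) ^ d) ^ m := one_le_pow₀ (one_le_pow₀ (by norm_num))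
  have h1 : ∫ y in ((((2 : ℝ) ^ d) ^ m)⁻¹)..1, rieszProd θ 0 n y =
      A * ∫ y in ((((2 : ℝ) ^ d) ^ (p + m))⁻¹)..(A⁻¹), rieszProd θ 0 n (A * y) := by
    rw [intervalIntegral.integral_comp_mul_left _ hA0.ne', smul_eq_mul, ← mul_assoc,
      mul_inv_cancel₀ hA0.ne', one_mul, pow_add, ← hA, mul_inv,
      ← mul_assoc, mul_inv_cancel₀ hA0.ne', one_mul]
  have hle : (((2 : ℝ) ^ d) ^ (p + m))⁻¹ ≤ A⁻¹ := by
    rw [pow_add, ← hA]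
    exact inv_anti₀ hA0 (le_mul_of_one_le_right hA0.le hone)
  have h2 : ∫ y in ((((2 : ℝ) ^ d) ^ (p + m))⁻¹)..(A⁻¹), rieszProd θ 0 n (A * y) ≤
      ∫ y in ((((2 : ℝ) ^ d) ^ (p + m))⁻¹)..(A⁻¹), 2 * rieszProd θ 0 (p + n) y := by
    refine intervalIntegral.integral_mono_on hle
      (Continuous.intervalIntegrable (by fun_prop) _ _)
      (Continuous.intervalIntegrable (by fun_prop) _ _) fun y hy => ?_
    rw [hA, rieszProd_comp, ← rieszProd_mul θ (Nat.le_add_right p n)]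
    have h3 := half_le_rieszProd hd hθ p (le_trans (by positivity) hy.1) hy.2
    nlinarith [rieszProd_nonneg θ p (p + n) y]
  rw [intervalIntegral.integral_const_mul] at h2
  rw [h1, pow_add _ p n, ← hA]
  calc _ ≤ ((2 : ℝ) ^ d) ^ n * (A * (2 *
        ∫ y in ((((2 : ℝ) ^ d) ^ (p + m))⁻¹)..(A⁻¹), rieszProd θ 0 (p + n) y)) := by gcongr
    _ = _ := by ring

/-- The scales split `[0, 1]` into disjoint annuli, so that the Riesz products of all the lengths
`m, 2m, …, Im` together are controlled by the longest one. -/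
lemma sum_integral_rieszProd_le {d : ℕ} (hd : 2 ≤ d) {θ : Fin d → ℝ} (hθ : ∑ j, θ j ^ 2 = 1)
    (m I : ℕ) :
    ∑ q ∈ Finset.range I, (2 ^ d) ^ ((I - q) * m) *
      ∫ y in ((((2 : ℝ) ^ d) ^ m)⁻¹)..1, rieszProd θ 0 ((I - q) * m) y ≤
    2 * ((2 ^ d) ^ (I * m) * ∫ y in (0 : ℝ)..1, rieszProd θ 0 (I * m) y) := by
  have hcont := continuous_rieszProd θ 0 (I * m)
  calc _ ≤ ∑ q ∈ Finset.range I, 2 * ((2 ^ d) ^ (I * m) *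
        ∫ y in ((((2 : ℝ) ^ d) ^ ((q + 1) * m))⁻¹)..((((2 : ℝ) ^ d) ^ (q * m))⁻¹),
          rieszProd θ 0 (I * m) y) := by
        refine Finset.sum_le_sum fun q hq => ?_
        rw [Finset.mem_range] at hq
        have h := integral_rieszProd_shift_le hd hθ m ((I - q) * m) (q * m)
        rwa [← Nat.add_mul, Nat.add_sub_cancel' hq.le, ← Nat.succ_mul] at h
    _ = 2 * ((2 ^ d) ^ (I * m) * ∫ y in ((((2 : ℝ) ^ d) ^ (I * m))⁻¹)..1,
          rieszProd θ 0 (I * m) y) := by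
        rw [← Finset.mul_sum, ← Finset.mul_sum]
        congr 2
        have h := intervalIntegral.sum_integral_adjacent_intervals (μ := volume)
          (f := rieszProd θ 0 (I * m)) (a := fun q => (((2 : ℝ) ^ d) ^ (q * m))⁻¹) (n := I)
          (fun k _ => hcont.intervalIntegrable _ _)
        simp only [zero_mul, pow_zero, inv_one] at h
        rw [intervalIntegral.integral_symm, ← h, ← Finset.sum_neg_distrib]
        exact Finset.sum_congr rfl fun q _ => intervalIntegral.integral_symm _ _
    _ ≤ _ := by
        refine mul_le_mul_of_nonneg_left (mul_le_mul_of_nonneg_left ?_ (by positivity))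
          (by norm_num)
        refine intervalIntegral.integral_mono_interval (by positivity) ?_ le_rfl
          (Filter.Eventually.of_forall fun y => rieszProd_nonneg _ _ _ _)
          (hcont.intervalIntegrable _ _)
        exact inv_le_one_of_one_le₀ (one_le_pow₀ (one_le_pow₀ (by norm_num)))

/-- Away from the zeros of the low frequency factor, the full Riesz product is not much smaller than
its high frequency factor. -/
lemma mul_rieszProd_le {d : ℕ} (hd : 2 ≤ d) (θ : Fin d → ℝ) {m n : ℕ} (hmn : m ≤ n) (l : ℕ)
    (y : ℝ) :
    (((2 : ℝ) ^ d) ^ (2 * d * (m + l)))⁻¹ * rieszProd θ m n y ≤ rieszProd θ 0 n y +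
      (((2 : ℝ) ^ d) ^ (2 * d * (m + l)))⁻¹ * badProd d m n l (fun i => y * θ i) := by
  set η : ℝ := (((2 : ℝ) ^ d) ^ (2 * d * (m + l)))⁻¹ with hη
  have hη0 : 0 < η := by positivity
  by_cases h : ∃ j, y * θ j ∈ nearZeros d m l
  · obtain ⟨j, hj⟩ := h
    have h1 : rieszProd θ m n y ≤ badProd d m n l (fun i => y * θ i) := by
      rw [badProd_eq, rieszProd_eq_prod]
      have h2 := Finset.single_le_sum (s := Finset.univ)
        (f := fun j =>
          (nearZeros d m l).indicator (fun _ => ∏ i, cosProd d m n (y * θ i)) (y * θ j))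
        (fun j _ => Set.indicator_nonneg (fun _ _ => Finset.prod_nonneg fun _ _ =>
          cosProd_nonneg _ _ _ _) _) (Finset.mem_univ j)
      rwa [Set.indicator_of_mem hj] at h2
    have := rieszProd_nonneg θ 0 n y
    have := mul_le_mul_of_nonneg_left h1 hη0.le
    linarith
  · push Not at h
    have h1 : η ≤ rieszProd θ 0 m y := by
      rw [rieszProd_eq_prod]
      have h2 : η = ∏ _j : Fin d, ((((2 : ℝ) ^ d) ^ (m + l))⁻¹) ^ 2 := by
        rw [Finset.prod_const, Finset.card_univ, Fintype.card_fin, hη]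
        simp only [inv_pow, ← pow_mul]
        congr 2
        ring
      rw [h2]
      refine Finset.prod_le_prod (fun _ _ => by positivity) fun j _ => ?_
      have h3 : (((2 : ℝ) ^ d) ^ l)⁻¹ < |Real.sin ((2 ^ d) ^ m * (y * θ j))| := by
        have := h j
        simpa [nearZeros] using this
      have h4 := sin_sq_le_cosProd (d := d) (by omega) m (y * θ j)
      have h5 := pow_le_pow_left₀ (by positivity) h3.le 2
      rw [sq_abs] at h5
      have h6 := h5.trans h4
      rw [pow_add, mul_inv, mul_pow, inv_pow, inv_mul_le_iff₀ (by positivity)]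
      exact h6
    rw [← rieszProd_mul θ hmn]
    have h2 := mul_le_mul_of_nonneg_right h1 (rieszProd_nonneg θ m n y)
    have h3 := mul_nonneg hη0.le (badProd_nonneg d m n l fun i => y * θ i)
    linarith

lemma badProd_le (d m n l : ℕ) (x : Fin d → ℝ) : badProd d m n l x ≤ d := by
  rw [badProd_eq]
  calc _ ≤ ∑ _j : Fin d, (1 : ℝ) := by
        refine Finset.sum_le_sum fun j _ => ?_
        refine Set.indicator_le' (f := fun _ => ∏ i, cosProd d m n (x i)) (g := fun _ => (1 : ℝ))
          (fun _ _ => Finset.prod_le_one (fun _ _ => cosProd_nonneg _ _ _ _)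
            fun _ _ => cosProd_le_one _ _ _ _) (fun _ _ => zero_le_one) _
    _ = d := by simp

lemma intervalIntegrable_badProd (d m n l : ℕ) (θ : Fin d → ℝ) (a b : ℝ) :
    IntervalIntegrable (fun y => badProd d m n l fun i => y * θ i) volume a b := by
  have hm : Measurable fun y : ℝ => badProd d m n l fun i => y * θ i :=
    (measurable_badProd d m n l).comp (by fun_prop)
  refine (intervalIntegrable_const (c := (d : ℝ))).mono_fun hm.aestronglyMeasurable
    (Filter.Eventually.of_forall fun y => ?_)
  simp only
  rw [Real.norm_of_nonneg (badProd_nonneg _ _ _ _ _), Real.norm_of_nonneg (by positivity)]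
  exact badProd_le _ _ _ _ _

/-- Lower bound at a single scale: the positive definiteness of the Riesz product provides mass, and
the mass near the origin is small because the energy is. -/
lemma le_integral_add_integral_badProd {d : ℕ} (hd : 2 ≤ d) (θ : Fin d → ℝ) {m n : ℕ}
    (hmn : m ≤ n) (l : ℕ) {B : ℝ} (hB : 4 * B ≤ (2 ^ d) ^ m)
    (hE : (2 ^ d) ^ (n - m) * ∫ y in (0 : ℝ)..1, rieszProd θ 0 (n - m) y ≤ B) :
    (((2 : ℝ) ^ d) ^ (2 * d * (m + l)))⁻¹ * ((2 ^ d) ^ m / 4) ≤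
      (2 ^ d) ^ n * (∫ y in ((((2 : ℝ) ^ d) ^ m)⁻¹)..1, rieszProd θ 0 n y) +
      (((2 : ℝ) ^ d) ^ (2 * d * (m + l)))⁻¹ * ((2 ^ d) ^ n *
        ∫ y in ((((2 : ℝ) ^ d) ^ m)⁻¹)..1, badProd d m n l fun i => y * θ i) := by
  set η : ℝ := (((2 : ℝ) ^ d) ^ (2 * d * (m + l)))⁻¹ with hη
  have hη0 : 0 < η := by positivity
  set A : ℝ := ((2 : ℝ) ^ d) ^ m with hA
  have hA0 : 0 < A := by positivity
  have hA1 : 1 ≤ A := one_le_pow₀ (one_le_pow₀ (by norm_num))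
  set R : ℝ := ((2 : ℝ) ^ d) ^ (n - m) with hR
  have hR0 : 0 < R := by positivity
  have hn : ((2 : ℝ) ^ d) ^ n = A * R := by rw [hA, hR, ← pow_add, Nat.add_sub_cancel' hmn]
  have hle : A⁻¹ ≤ 1 := inv_le_one_of_one_le₀ hA1
  have h1 := le_integral_rieszProd θ m n
  rw [← hR, ← intervalIntegral.integral_add_adjacent_intervals (b := A⁻¹)
    ((continuous_rieszProd θ m n).intervalIntegrable _ _)
    ((continuous_rieszProd θ m n).intervalIntegrable _ _)] at h1
  have h2 : ∫ y in (0 : ℝ)..(A⁻¹), rieszProd θ m n y =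
      A⁻¹ * ∫ y in (0 : ℝ)..1, rieszProd θ 0 (n - m) y := by
    have h3 : ∀ y, rieszProd θ m n y = rieszProd θ 0 (n - m) (A * y) := by
      intro y
      rw [hA, rieszProd_comp, Nat.add_sub_cancel' hmn]
    simp only [h3]
    rw [intervalIntegral.integral_comp_mul_left _ hA0.ne', smul_eq_mul, mul_zero,
      mul_inv_cancel₀ hA0.ne']
  have h3 : ∫ y in (0 : ℝ)..(A⁻¹), rieszProd θ m n y ≤ 1 / 4 * R⁻¹ := by
    rw [h2]
    set T := ∫ y in (0 : ℝ)..1, rieszProd θ 0 (n - m) y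
    have h4 : 4 * (R * T) ≤ A := by linarith
    rw [inv_mul_le_iff₀ hA0]
    calc T = 4 * (R * T) * (1 / 4 * R⁻¹) := by field_simp
      _ ≤ A * (1 / 4 * R⁻¹) := mul_le_mul_of_nonneg_right h4 (by positivity)
  have h4 : 1 / 4 * R⁻¹ ≤ ∫ y in (A⁻¹)..1, rieszProd θ m n y := by linarith
  have h5 : η * ∫ y in (A⁻¹)..1, rieszProd θ m n y ≤
      (∫ y in (A⁻¹)..1, rieszProd θ 0 n y) +
      η * ∫ y in (A⁻¹)..1, badProd d m n l fun i => y * θ i := by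
    rw [← intervalIntegral.integral_const_mul, ← intervalIntegral.integral_const_mul,
      ← intervalIntegral.integral_add ((continuous_rieszProd θ 0 n).intervalIntegrable _ _)
      ((intervalIntegrable_badProd d m n l θ _ _).const_mul _)]
    exact intervalIntegral.integral_mono_on hle
      (Continuous.intervalIntegrable (by fun_prop) _ _)
      (((continuous_rieszProd θ 0 n).intervalIntegrable _ _).add
        ((intervalIntegrable_badProd d m n l θ _ _).const_mul _))
      fun y _ => mul_rieszProd_le hd θ hmn l y
  rw [hn]
  set X := ∫ y in (A⁻¹)..1, rieszProd θ 0 n y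
  set Y := ∫ y in (A⁻¹)..1, badProd d m n l fun i => y * θ i
  calc η * (A / 4) = A * R * (η * (1 / 4 * R⁻¹)) := by field_simp
    _ ≤ A * R * (X + η * Y) := by
        refine mul_le_mul_of_nonneg_left ?_ (by positivity)
        exact (mul_le_mul_of_nonneg_left h4 hη0.le).trans h5
    _ = _ := by ring

end Directions

/-! ### The directions of low energy -/

section ExceptionalSet

/-- The directions in which the Riesz products of all lengths up to `N` have integrals over `[0, 1]`
that are small relative to their length. By `integral_rieszProd_le` these include all directions in
which the energy of all generations up to `N` is small. -/
def lowEnergyDirections (d N : ℕ) (B : ℝ) : Set (Metric.sphere (0 : EuclideanSpace ℝ (Fin d)) 1) :=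
  {θ | ∀ n ≤ N, (2 ^ d) ^ n * ∫ y in (0 : ℝ)..1,
    rieszProd (fun i => (θ : EuclideanSpace ℝ (Fin d)) i) 0 n y ≤ B}

lemma sum_sq_sphere {d : ℕ} (θ : Metric.sphere (0 : EuclideanSpace ℝ (Fin d)) 1) :
    ∑ j, (θ : EuclideanSpace ℝ (Fin d)) j ^ 2 = 1 := by
  have h := θ.2
  rw [mem_sphere_zero_iff_norm] at h
  rw [← EuclideanSpace.real_norm_sq_eq, h, one_pow]

/-- Summing the lower bounds at the scales `m, 2m, …, Im`: as the full Riesz products contribute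
only `2 B` altogether, most of the mass lies near the zeros of the low frequency factor. -/
lemma le_sum_integral_badProd {d : ℕ} (hd : 2 ≤ d) {m I l : ℕ} {B : ℝ}
    (hB : 4 * B ≤ (2 ^ d) ^ m)
    (hI : 16 * B * (2 ^ d) ^ (2 * d * (m + l)) ≤ I * (2 ^ d) ^ m)
    {θ : Metric.sphere (0 : EuclideanSpace ℝ (Fin d)) 1}
    (hθ : θ ∈ lowEnergyDirections d (I * m) B) :
    I * (2 ^ d) ^ m / 8 ≤ ∑ q ∈ Finset.range I, (2 ^ d) ^ ((I - q) * m) *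
      ∫ y in ((((2 : ℝ) ^ d) ^ m)⁻¹)..1, badProd d m ((I - q) * m) l
        fun i => y * (θ : EuclideanSpace ℝ (Fin d)) i := by
  set t : Fin d → ℝ := fun i => (θ : EuclideanSpace ℝ (Fin d)) i
  set η : ℝ := (((2 : ℝ) ^ d) ^ (2 * d * (m + l)))⁻¹ with hη
  have hη0 : 0 < η := by positivity
  have h1 := Finset.sum_le_sum fun q (hq : q ∈ Finset.range I) => by
    rw [Finset.mem_range] at hq
    have hq1 : 1 ≤ I - q := by omega
    exact le_integral_add_integral_badProd hd t (m := m) (n := (I - q) * m)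
      (Nat.le_mul_of_pos_left m hq1) l hB (hθ _ ((Nat.sub_le _ _).trans
        (Nat.mul_le_mul_right m (Nat.sub_le I q))))
  rw [Finset.sum_const, Finset.card_range, nsmul_eq_mul, Finset.sum_add_distrib,
    ← Finset.mul_sum] at h1
  have h2 := sum_integral_rieszProd_le hd (sum_sq_sphere θ) m I
  have h3 := hθ (I * m) le_rfl
  set S := ∑ q ∈ Finset.range I, (2 ^ d) ^ ((I - q) * m) *
      ∫ y in ((((2 : ℝ) ^ d) ^ m)⁻¹)..1, badProd d m ((I - q) * m) l fun i => y * t i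
  have h4 : 2 * B ≤ η * (I * (2 ^ d) ^ m / 8) := by
    have h5 := mul_le_mul_of_nonneg_left hI hη0.le
    have h6 : η * (16 * B * (2 ^ d) ^ (2 * d * (m + l))) = 16 * B := by
      rw [hη]; field_simp
    linarith
  have h5 : (I : ℝ) * (η * ((2 ^ d) ^ m / 4)) ≤ 2 * B + η * S := by
    refine h1.trans (add_le_add ?_ le_rfl)
    refine h2.trans ?_
    linarith
  have h6 : η * (I * (2 ^ d) ^ m / 8) ≤ η * S := by
    have : (I : ℝ) * (η * ((2 ^ d) ^ m / 4)) = 2 * (η * (I * (2 ^ d) ^ m / 8)) := by ring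
    linarith
  exact le_of_mul_le_mul_left h6 hη0

/-- There are few directions of low energy: in each of them the Riesz products have a lot of mass
near the zeros of their low frequency factors, which on average they do not. -/
lemma measure_lowEnergyDirections_le {d : ℕ} (hd : 2 ≤ d) {m I : ℕ} {B : ℝ} (hI0 : 0 < I)
    (hB : 4 * B ≤ (2 ^ d) ^ m)
    (hI : 16 * B * (2 ^ d) ^ (2 * d * (m + 2 * d * m)) ≤ I * (2 ^ d) ^ m) :
    (volume : Measure (EuclideanSpace ℝ (Fin d))).toSphere (lowEnergyDirections d (I * m) B) ≤
      ENNReal.ofReal (8 * (d * (4 * Real.pi) ^ d) * (((2 : ℝ) ^ d) ^ m)⁻¹) := by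
  set l := 2 * d * m with hl
  set σ := (volume : Measure (EuclideanSpace ℝ (Fin d))).toSphere
  set A : ℝ := ((2 : ℝ) ^ d) ^ m with hA
  have hA0 : 0 < A := by positivity
  have hA1 : 1 ≤ A := one_le_pow₀ (one_le_pow₀ (by norm_num))
  set Cd : ℝ := d * (4 * Real.pi) ^ d with hCd
  set β : ℕ → Metric.sphere (0 : EuclideanSpace ℝ (Fin d)) 1 → ℝ≥0∞ := fun n θ =>
    ∫⁻ y in Set.Ioc (A⁻¹) 1, ENNReal.ofReal
      (badProd d m n l fun i => y * (θ : EuclideanSpace ℝ (Fin d)) i) with hβ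
  have hβm : ∀ n, Measurable (β n) := by
    intro n
    have : Measurable fun p : Metric.sphere (0 : EuclideanSpace ℝ (Fin d)) 1 × ℝ =>
        ENNReal.ofReal (badProd d m n l fun i => p.2 * (p.1 : EuclideanSpace ℝ (Fin d)) i) := by
      have h0 : Measurable fun p : Metric.sphere (0 : EuclideanSpace ℝ (Fin d)) 1 × ℝ =>
          fun i : Fin d => p.2 * (p.1 : EuclideanSpace ℝ (Fin d)) i := by fun_prop
      exact ((measurable_badProd d m n l).comp h0).ennreal_ofReal
    exact this.lintegral_prod_right'
  set c : ℝ≥0∞ := ENNReal.ofReal (I * A / 8) with hc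
  have hsub : lowEnergyDirections d (I * m) B ⊆
      {θ | c ≤ ∑ q ∈ Finset.range I, ENNReal.ofReal ((2 ^ d) ^ ((I - q) * m)) *
        β ((I - q) * m) θ} := by
    intro θ hθ
    have h1 := ENNReal.ofReal_le_ofReal (le_sum_integral_badProd hd hB hI hθ)
    refine h1.trans (le_of_eq ?_)
    have hle : A⁻¹ ≤ 1 := inv_le_one_of_one_le₀ hA1
    rw [ENNReal.ofReal_sum_of_nonneg]
    · refine Finset.sum_congr rfl fun q _ => ?_
      rw [ENNReal.ofReal_mul (by positivity), intervalIntegral.integral_of_le hle,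
        ofReal_integral_eq_lintegral_ofReal]
      · exact (intervalIntegrable_iff_integrableOn_Ioc_of_le hle).1
          (intervalIntegrable_badProd d m _ l _ _ _)
      · exact Filter.Eventually.of_forall fun y => badProd_nonneg _ _ _ _ _
    · exact fun q _ => mul_nonneg (by positivity) (intervalIntegral.integral_nonneg hle
        fun y _ => badProd_nonneg _ _ _ _ _)
  have hmarkov := mul_meas_ge_le_lintegral (μ := σ) (f := fun θ =>
    ∑ q ∈ Finset.range I, ENNReal.ofReal ((2 ^ d) ^ ((I - q) * m)) * β ((I - q) * m) θ)
    (Finset.measurable_sum _ fun q _ => (hβm _).const_mul _) c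
  have hint : ∫⁻ θ, ∑ q ∈ Finset.range I,
      ENNReal.ofReal ((2 ^ d) ^ ((I - q) * m)) * β ((I - q) * m) θ ∂σ ≤
      ENNReal.ofReal (I * (A * (Cd * A⁻¹))) := by
    rw [lintegral_finsetSum _ fun q _ => (hβm _).const_mul _]
    have h1 : ∀ q ∈ Finset.range I, ∫⁻ θ, ENNReal.ofReal ((2 ^ d) ^ ((I - q) * m)) *
        β ((I - q) * m) θ ∂σ ≤ ENNReal.ofReal (A * (Cd * A⁻¹)) := by
      intro q hq
      rw [Finset.mem_range] at hq
      have hq1 : 1 ≤ I - q := by omega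
      rw [lintegral_const_mul _ (hβm _)]
      have h2 := lintegral_sphere_badProd_le hd m ((I - q) * m) l
      refine (mul_le_mul_right h2 _).trans ?_
      rw [← ENNReal.ofReal_mul (by positivity)]
      refine ENNReal.ofReal_le_ofReal ?_
      have h3 : ((2 : ℝ) ^ d) ^ ((I - q) * m) = A * (2 ^ d) ^ ((I - q) * m - m) := by
        rw [hA, ← pow_add, Nat.add_sub_cancel' (Nat.le_mul_of_pos_left m hq1)]
      -- the gain `(2 / 2^d)^l` beats the loss `2^{dm(d-1)}` of the polar coordinates
      have h4 : A ^ (d - 1) * (2 / 2 ^ d) ^ l ≤ A⁻¹ := by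
        obtain ⟨e, rfl⟩ : ∃ e, d = e + 2 := ⟨d - 2, by omega⟩
        have h5 : (2 : ℝ) / 2 ^ (e + 2) = (2 ^ (e + 1))⁻¹ := by
          rw [pow_succ _ (e + 1), inv_eq_one_div, div_eq_div_iff (by positivity) (by positivity)]
          ring
        rw [h5, inv_pow, mul_inv_le_iff₀ (by positivity), inv_mul_eq_div,
          le_div_iff₀ hA0, hA, ← pow_mul, ← pow_mul, ← pow_mul, ← pow_add, hl, ← pow_mul]
        refine pow_le_pow_right₀ (by norm_num : (1 : ℝ) ≤ 2) ?_
        have : e + 2 - 1 = e + 1 := rfl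
        rw [this]
        nlinarith [Nat.zero_le (e * m), Nat.zero_le (e * e * m)]
      rw [h3, ← hA, ← hCd]
      have hR0 : (0 : ℝ) < (2 ^ d) ^ ((I - q) * m - m) := by positivity
      calc _ = A * (Cd * (A ^ (d - 1) * (2 / 2 ^ d) ^ l)) := by
            field_simp
        _ ≤ _ := by gcongr
    refine (Finset.sum_le_sum h1).trans (le_of_eq ?_)
    rw [Finset.sum_const, Finset.card_range, nsmul_eq_mul,
      ENNReal.ofReal_mul (by positivity) (p := (I : ℝ)), ENNReal.ofReal_natCast]
  have hI0' : (0 : ℝ) < I := by exact_mod_cast hI0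
  have hc0 : 0 < I * A / 8 := by positivity
  have h6 : c * σ (lowEnergyDirections d (I * m) B) ≤ ENNReal.ofReal (I * (A * (Cd * A⁻¹))) :=
    ((mul_le_mul_right (measure_mono hsub) c).trans hmarkov).trans hint
  have h7 : σ (lowEnergyDirections d (I * m) B) ≤ ENNReal.ofReal (I * (A * (Cd * A⁻¹))) / c := by
    rw [ENNReal.le_div_iff_mul_le (Or.inl (by rw [Ne, ENNReal.ofReal_eq_zero, not_le]; exact hc0))
      (Or.inl ENNReal.ofReal_ne_top), mul_comm]
    exact h6
  refine h7.trans (le_of_eq ?_)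
  rw [hc, ← ENNReal.ofReal_div_of_pos hc0]
  congr 1
  field_simp

end ExceptionalSet

/-! ### The cubes of the Cantor set and their projections -/

section Geometry

lemma pos_eq_sum {α : Type*} [Fintype α] [Nonempty α] {v : α → ℝ} {z : α} (hz : v z = 0)
    {u : List α} {M : ℕ} (hM : u.length ≤ M) :
    pos v u = ∑ n ∈ Finset.range M, v (u.getD n z) * ((Fintype.card α : ℝ) ^ (n + 1))⁻¹ := by
  induction u generalizing M with
  | nil => simp [pos, hz]
  | cons a u ih =>
    obtain ⟨M, rfl⟩ : ∃ k, M = k + 1 := ⟨M - 1, by simp at hM; omega⟩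
    rw [Finset.sum_range_succ', pos, ih (M := M) (by simpa using hM), add_div, Finset.sum_div,
      add_comm]
    congr 1
    · refine Finset.sum_congr rfl fun n _ => ?_
      rw [List.getD_cons_succ, pow_succ _ (n + 1), mul_inv, div_eq_mul_inv, mul_assoc]
    · simp [div_eq_mul_inv]

/-- The vertex with the smallest coordinates of the cube addressed by the word `w`. -/
noncomputable def cornerPoint {d : ℕ} (w : List (Fin d → Bool)) : EuclideanSpace ℝ (Fin d) :=
  WithLp.toLp 2 fun i => pos (fun a : Fin d → Bool => (2 ^ d - 1) * (if a i then 1 else 0)) w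

lemma cornerPoint_apply {d : ℕ} (w : List (Fin d → Bool)) (i : Fin d) :
    cornerPoint w i =
      pos (fun a : Fin d → Bool => (2 ^ d - 1) * (if a i then 1 else 0)) w := rfl

lemma inner_cornerPoint {d : ℕ} (w : List (Fin d → Bool)) (θ : EuclideanSpace ℝ (Fin d)) :
    inner ℝ (cornerPoint w) θ = pos (cornerValue fun i => θ i) w := by
  have h : inner ℝ (cornerPoint w) θ = ∑ i, θ i * cornerPoint w i := by
    simp [PiLp.inner_apply]
  rw [h]
  induction w with
  | nil => simp [cornerPoint_apply, pos]
  | cons a w ih =>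
    simp only [cornerPoint_apply, pos] at ih ⊢
    rw [← ih (by simp [PiLp.inner_apply, cornerPoint_apply]), cornerValue, Finset.mul_sum,
      ← Finset.sum_add_distrib, Finset.sum_div]
    exact Finset.sum_congr rfl fun i _ => by ring

lemma cornerPoint_mem_multiscaleDigits {d : ℕ} {u : List (Fin d → Bool)} {M : ℕ}
    (hu : u.length ≤ M) (i : Fin d) : cornerPoint u i ∈ multiscaleDigits d M := by
  refine ⟨fun n => if u.getD (n - 1) (fun _ => false) i then 2 ^ d - 1 else 0, fun n => ?_, ?_⟩
  · dsimp only
    split_ifs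
    · exact Or.inr rfl
    · exact Or.inl rfl
  · have hI : Finset.Icc 1 M = Finset.Ico (0 + 1) (M + 1) := by ext; simp
    rw [cornerPoint_apply, pos_eq_sum (z := fun _ => false) (by simp) hu, hI,
      ← Finset.sum_Ico_add', Finset.range_eq_Ico]
    refine Finset.sum_congr rfl fun n _ => ?_
    rw [card_corner, pow_mul]
    dsimp only
    rw [Nat.add_sub_cancel]
    split_ifs <;> simp

lemma exists_cornerPoint_eq {d N : ℕ} {p : EuclideanSpace ℝ (Fin d)}
    (hp : ∀ i, p i ∈ multiscaleDigits d N) :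
    ∃ w ∈ words (Fin d → Bool) N, cornerPoint w = p := by
  choose a ha hpa using hp
  refine ⟨(List.range N).map fun n i => decide (a i (n + 1) ≠ 0), by simp [mem_words], ?_⟩
  ext i
  have hI : Finset.Icc 1 N = Finset.Ico (0 + 1) (N + 1) := by ext; simp
  rw [hpa, cornerPoint_apply, pos_eq_sum (M := N) (z := fun _ => false) (by simp) (by simp), hI,
    ← Finset.sum_Ico_add', Finset.range_eq_Ico]
  refine Finset.sum_congr rfl fun n hn => ?_
  rw [Finset.mem_Ico] at hn
  rw [card_corner, pow_mul, List.getD_eq_getElem _ _ (by simpa using hn.2)]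
  congr 1
  rcases ha i (n + 1) with h | h
  · simp [h]
  · have : (2 : ℤ) ^ d - 1 = 0 ∨ (2 : ℤ) ^ d - 1 ≠ 0 := em _
    rw [Set.mem_singleton_iff] at h
    rcases this with h0 | h0
    · have h0' : (2 : ℝ) ^ d - 1 = 0 := by exact_mod_cast h0
      simp [h, h0, h0']
    · simp [h, h0]

lemma cornerPoint_append {d : ℕ} (u w : List (Fin d → Bool)) (i : Fin d) :
    cornerPoint (u ++ w) i = cornerPoint u i + (((2 : ℝ) ^ d) ^ u.length)⁻¹ * cornerPoint w i := by
  rw [cornerPoint_apply, pos_append, card_corner]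
  rfl

lemma cornerPoint_mem_Icc {d : ℕ} (w : List (Fin d → Bool)) (i : Fin d) :
    cornerPoint w i ∈ Set.Icc (0 : ℝ) (1 - (((2 : ℝ) ^ d) ^ w.length)⁻¹) := by
  have hL : (1 : ℝ) ≤ 2 ^ d := one_le_pow₀ (by norm_num)
  refine Set.mem_Icc.2 ⟨?_, ?_⟩
  · rw [cornerPoint_apply, pos_eq_sum (z := fun _ => false) (by simp) le_rfl]
    refine Finset.sum_nonneg fun n _ => mul_nonneg (mul_nonneg (by linarith) ?_) (by positivity)
    split_ifs <;> norm_num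
  · have := (le_abs_self _).trans (abs_pos_le (D := 1)
      (v := fun a : Fin d → Bool => (2 ^ d - 1) * (if a i then 1 else 0)) (fun a => ?_) w)
    · rwa [one_mul, card_corner] at this
    · rw [card_corner, abs_of_nonneg] <;> split_ifs <;> linarith

lemma cornerPoint_mem_cornerCantorSet {d : ℕ} (w : List (Fin d → Bool)) :
    cornerPoint w ∈ cornerCantorSet d := by
  refine Set.mem_iInter₂.2 fun M _ => ?_
  refine Set.mem_add.2 ⟨cornerPoint (w.take M), fun i => cornerPoint_mem_multiscaleDigits
    (by simp) i, cornerPoint w - cornerPoint (w.take M), fun i => ?_, by simp⟩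
  have h := cornerPoint_append (w.take M) (w.drop M) i
  rw [List.take_append_drop] at h
  rw [PiLp.sub_apply, h, add_sub_cancel_left, pow_mul]
  rcases le_total M w.length with hM | hM
  · rw [List.length_take_of_le hM]
    have h1 := Set.mem_Icc.1 (cornerPoint_mem_Icc (w.drop M) i)
    have h2 : (0 : ℝ) < (((2 : ℝ) ^ d) ^ M)⁻¹ := by positivity
    have h3 : cornerPoint (w.drop M) i ≤ 1 := h1.2.trans (sub_le_self _ (by positivity))
    exact Set.mem_Icc.2 ⟨mul_nonneg h2.le h1.1, by nlinarith⟩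
  · rw [List.drop_of_length_le hM]
    have : cornerPoint ([] : List (Fin d → Bool)) i = 0 := rfl
    rw [this, mul_zero]
    exact Set.mem_Icc.2 ⟨le_rfl, by positivity⟩

lemma abs_coord_sphere_le {d : ℕ} (θ : Metric.sphere (0 : EuclideanSpace ℝ (Fin d)) 1)
    (i : Fin d) : |(θ : EuclideanSpace ℝ (Fin d)) i| ≤ 1 := by
  rw [← sq_le_one_iff_abs_le_one]
  refine le_trans ?_ (sum_sq_sphere θ).le
  exact Finset.single_le_sum (f := fun j => (θ : EuclideanSpace ℝ (Fin d)) j ^ 2)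
    (fun _ _ => sq_nonneg _) (Finset.mem_univ i)

lemma abs_cornerValue_le {d : ℕ} {θ : Fin d → ℝ} (hθ : ∀ i, |θ i| ≤ 1) (a : Fin d → Bool) :
    |cornerValue θ a| ≤ d * (Fintype.card (Fin d → Bool) - 1) := by
  have hL : (1 : ℝ) ≤ 2 ^ d := one_le_pow₀ (by norm_num)
  rw [card_corner, cornerValue, abs_mul, abs_of_nonneg (sub_nonneg.2 hL), mul_comm]
  refine mul_le_mul_of_nonneg_right ?_ (sub_nonneg.2 hL)
  refine (Finset.abs_sum_le_sum_abs _ _).trans ?_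
  calc _ ≤ ∑ _j : Fin d, (1 : ℝ) := Finset.sum_le_sum fun j _ => by
        rw [abs_mul]
        split_ifs
        · simpa using hθ j
        · simp
    _ = d := by simp

/-- A cube of side `2^{-dN}` projects to an interval of length at most `d 2^{-dN}`, and the
thickening adds another `2^{-dN}`; together this is at most the radius `2 d 2^{-dN}` used in
`coverSet`. -/
lemma inner_image_thickening_subset {d : ℕ} (hd : 2 ≤ d) {N : ℕ} (hN : 1 ≤ N)
    (θ : Metric.sphere (0 : EuclideanSpace ℝ (Fin d)) 1) :
    (fun x : EuclideanSpace ℝ (Fin d) => inner ℝ x (θ : EuclideanSpace ℝ (Fin d))) ''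
      Metric.thickening ((2 : ℝ) ^ (d * N))⁻¹ (cornerCantorSet d) ⊆
      coverSet (cornerValue fun i => (θ : EuclideanSpace ℝ (Fin d)) i) d N := by
  rintro _ ⟨x, hx, rfl⟩
  obtain ⟨y, hy, hxy⟩ := Metric.mem_thickening_iff.1 hx
  obtain ⟨p, hp, q, hq, rfl⟩ := Set.mem_add.1 (Set.mem_iInter₂.1 hy N hN)
  obtain ⟨w, hw, rfl⟩ := exists_cornerPoint_eq hp
  rw [mem_coverSet]
  refine ⟨w, hw, ?_⟩
  have hθ : ‖(θ : EuclideanSpace ℝ (Fin d))‖ = 1 := mem_sphere_zero_iff_norm.1 θ.2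
  dsimp only
  rw [← inner_cornerPoint, ← inner_sub_left, card_corner, ← pow_mul]
  set δ : ℝ := ((2 : ℝ) ^ (d * N))⁻¹ with hδ
  have hδ0 : 0 < δ := by positivity
  have h1 : |inner ℝ (x - (cornerPoint w + q)) (θ : EuclideanSpace ℝ (Fin d))| ≤ δ := by
    refine (abs_real_inner_le_norm _ _).trans ?_
    rw [hθ, mul_one, ← dist_eq_norm]
    exact hxy.le
  have h2 : |inner ℝ q (θ : EuclideanSpace ℝ (Fin d))| ≤ d * δ := by
    have : inner ℝ q (θ : EuclideanSpace ℝ (Fin d)) =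
        ∑ i, (θ : EuclideanSpace ℝ (Fin d)) i * q i := by
      simp [PiLp.inner_apply]
    rw [this]
    refine (Finset.abs_sum_le_sum_abs _ _).trans ?_
    calc _ ≤ ∑ _j : Fin d, δ := Finset.sum_le_sum fun j _ => by
          have hqj := Set.mem_Icc.1 (hq j)
          rw [abs_mul, abs_of_nonneg hqj.1]
          exact (mul_le_of_le_one_left hqj.1 (abs_coord_sphere_le θ j)).trans hqj.2
      _ = d * δ := by simp
  have h3 : inner ℝ (x - cornerPoint w) (θ : EuclideanSpace ℝ (Fin d)) =
      inner ℝ (x - (cornerPoint w + q)) (θ : EuclideanSpace ℝ (Fin d)) +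
        inner ℝ q (θ : EuclideanSpace ℝ (Fin d)) := by
    rw [← inner_add_left]; congr 1; abel
  rw [h3]
  refine (abs_add_le _ _).trans ?_
  have hd' : (2 : ℝ) ≤ d := by exact_mod_cast hd
  nlinarith

end Geometry

/-! ### The upper bound -/

section UpperBound

/-- A direction that is not exceptional has a generation at which the projected intervals are
stacked, which forces the cover of a much later generation to be short. -/
lemma volume_coverSet_le_of_notMem {d : ℕ} (hd : 2 ≤ d)
    {θ : Metric.sphere (0 : EuclideanSpace ℝ (Fin d)) 1} {K : ℝ} {N J : ℕ} (hK : 1 ≤ K)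
    (hJ : 2 * 2 ^ d * K ^ 2 ≤ J)
    (hθ : θ ∉ lowEnergyDirections d N (2 ^ d * Real.exp 1 * Real.pi ^ 3 * (4 * d * K))) :
    volume.real (coverSet (cornerValue fun i => (θ : EuclideanSpace ℝ (Fin d)) i) d (J * N)) ≤
      34 * d / K := by
  have hv := abs_cornerValue_le (abs_coord_sphere_le θ)
  refine volume_coverSet_le (Nat.cast_nonneg d) hv hK ?_ (by rwa [card_corner])
  by_contra hq
  refine hθ fun n hn => (integral_rieszProd_le hd _ n).trans ?_
  exact mul_le_mul_of_nonneg_left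
    (energy_le (Nat.cast_nonneg d) hv hK (not_lt.1 hq) hn) (by positivity)

/-- The low energy directions contribute at most their measure times the length `4 d` of the cover
of generation `0`. -/
lemma favardLength_thickening_le {d : ℕ} (hd : 2 ≤ d) {m I J N : ℕ} {K : ℝ} (hK : 1 ≤ K)
    (hI0 : 0 < I) (hB : 4 * (2 ^ d * Real.exp 1 * Real.pi ^ 3 * (4 * d * K)) ≤ (2 ^ d) ^ m)
    (hI : 16 * (2 ^ d * Real.exp 1 * Real.pi ^ 3 * (4 * d * K)) *
      (2 ^ d) ^ (2 * d * (m + 2 * d * m)) ≤ I * (2 ^ d) ^ m)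
    (hJ : 2 * 2 ^ d * K ^ 2 ≤ J) (hN : 1 ≤ N) (hJN : J * (I * m) ≤ N) :
    favardLength (Metric.thickening ((2 : ℝ) ^ (d * N))⁻¹ (cornerCantorSet d)) ≤
      ENNReal.ofReal (4 * d * (8 * (d * (4 * Real.pi) ^ d) * (((2 : ℝ) ^ d) ^ m)⁻¹) + 34 * d / K *
        (volume : Measure (EuclideanSpace ℝ (Fin d))).toSphere.real Set.univ) := by
  set σ := (volume : Measure (EuclideanSpace ℝ (Fin d))).toSphere
  set E := lowEnergyDirections d (I * m) (2 ^ d * Real.exp 1 * Real.pi ^ 3 * (4 * d * K)) with hE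
  have hpt : ∀ θ : Metric.sphere (0 : EuclideanSpace ℝ (Fin d)) 1,
      Measure.hausdorffMeasure (1 : ℝ)
        ((fun x : EuclideanSpace ℝ (Fin d) => inner ℝ x (θ : EuclideanSpace ℝ (Fin d))) ''
          Metric.thickening ((2 : ℝ) ^ (d * N))⁻¹ (cornerCantorSet d)) ≤
      (toMeasurable σ E).indicator (fun _ => ENNReal.ofReal (4 * d)) θ +
        ENNReal.ofReal (34 * d / K) := by
    intro θ
    have hv := abs_cornerValue_le (abs_coord_sphere_le θ)
    have hd0 : (0 : ℝ) ≤ d := Nat.cast_nonneg d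
    rw [hausdorffMeasure_real]
    refine (measure_mono (inner_image_thickening_subset hd hN θ)).trans ?_
    by_cases hθ : θ ∈ toMeasurable σ E
    · rw [Set.indicator_of_mem hθ]
      refine le_add_right ((measure_mono (coverSet_subset_of_le hd0 hv (Nat.zero_le N))).trans ?_)
      rw [← ENNReal.ofReal_toReal (volume_coverSet_ne_top 0)]
      exact ENNReal.ofReal_le_ofReal (volume_coverSet_zero_le hd0)
    · refine le_add_left ((measure_mono (coverSet_subset_of_le hd0 hv hJN)).trans ?_)
      rw [← ENNReal.ofReal_toReal (volume_coverSet_ne_top _)]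
      exact ENNReal.ofReal_le_ofReal (volume_coverSet_le_of_notMem hd hK hJ
        fun h => hθ (subset_toMeasurable σ E h))
  refine (lintegral_mono hpt).trans ?_
  rw [lintegral_add_left (measurable_const.indicator (measurableSet_toMeasurable σ E)),
    lintegral_indicator_const (measurableSet_toMeasurable σ E), measure_toMeasurable,
    lintegral_const, ENNReal.ofReal_add (by positivity) (by positivity),
    ENNReal.ofReal_mul (by positivity) (p := 4 * (d : ℝ)),
    ENNReal.ofReal_mul (by positivity) (p := 34 * (d : ℝ) / K), ofReal_measureReal]
  exact add_le_add (mul_le_mul_right (measure_lowEnergyDirections_le hd hI0 hB hI) _) le_rfl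

lemma exists_favardLength_thickening_le {d : ℕ} (hd : 2 ≤ d) :
    ∃ C : ℝ, 0 < C ∧ ∃ N₀ : ℕ, ∀ N : ℕ, N₀ ≤ N →
      favardLength (Metric.thickening ((2 : ℝ) ^ (d * N))⁻¹ (cornerCantorSet d)) ≤
        ENNReal.ofReal (C * (N : ℝ) ^ (-((2 * d * (2 * d + 1) + 5 : ℕ) : ℝ)⁻¹)) := by
  set s : ℕ := 2 * d * (2 * d + 1) + 5 with hs
  set c : ℝ := 2 ^ d * Real.exp 1 * Real.pi ^ 3 * (4 * d) with hc
  set σ := (volume : Measure (EuclideanSpace ℝ (Fin d))).toSphere with hσ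
  have hd' : (2 : ℝ) ≤ d := by exact_mod_cast hd
  have hL4 : (4 : ℝ) ≤ 2 ^ d := by
    have : (2 : ℝ) ^ 2 ≤ 2 ^ d := pow_le_pow_right₀ (by norm_num) hd
    linarith
  have hc1 : 1 ≤ c := by
    have h1 : 1 ≤ Real.exp 1 := Real.one_le_exp zero_le_one
    have h2 : 1 ≤ Real.pi ^ 3 := one_le_pow₀ (by linarith [Real.pi_gt_three])
    have h3 : (1 : ℝ) ≤ 2 ^ d := by linarith
    exact one_le_mul_of_one_le_of_one_le (one_le_mul_of_one_le_of_one_le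
      (one_le_mul_of_one_le_of_one_le h3 h1) h2) (by linarith)
  obtain ⟨m₀, hm₀⟩ := pow_unbounded_of_one_lt (4 * c) (by linarith : (1 : ℝ) < 2 ^ d)
  set C' : ℝ := 4 * d * (8 * (d * (4 * Real.pi) ^ d)) + 136 * d * c * σ.real Set.univ with hC'
  have hC'0 : 0 < C' := by positivity
  refine ⟨C' * 2 ^ d, by positivity, ((2 ^ d) ^ s) ^ (m₀ + 1), fun N hN => ?_⟩
  have hb : 1 < (2 ^ d) ^ s :=
    Nat.one_lt_pow (by omega) (Nat.one_lt_pow (by omega) (by norm_num))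
  have hN0 : N ≠ 0 := by
    have : 0 < ((2 ^ d) ^ s) ^ (m₀ + 1) := by positivity
    omega
  -- `m` is the largest integer with `(2^d)^(s m) ≤ N`
  set m := Nat.log ((2 ^ d) ^ s) N with hm
  have hmm₀ : m₀ + 1 ≤ m := Nat.le_log_of_pow_le hb hN
  have hmN : ((2 ^ d) ^ s) ^ m ≤ N := Nat.pow_log_le_self _ hN0
  have hNm : N < ((2 ^ d) ^ s) ^ (m + 1) := Nat.lt_pow_succ_log_self hb N
  set X : ℝ := ((2 : ℝ) ^ d) ^ m with hX
  have hX0 : 0 < X := by positivity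
  have hXc : 4 * c ≤ X := hm₀.le.trans (pow_le_pow_right₀ (by linarith) (by omega))
  have hK : 1 ≤ X / (4 * c) := (one_le_div (by positivity)).2 hXc
  have hcK : 2 ^ d * Real.exp 1 * Real.pi ^ 3 * (4 * d * (X / (4 * c))) = X / 4 := by
    rw [← mul_assoc (2 ^ d * Real.exp 1 * Real.pi ^ 3), ← hc]; field_simp
  -- `K` is chosen so that the energy threshold is `2^{dm} / 4`; then `I` and `J` are powers of
  -- `2^d` that are large enough, and the generation `J * (I * m)` is still at most `N`
  have hkey := favardLength_thickening_le hd (m := m) (I := (2 ^ d) ^ (2 * d * (2 * d + 1) * m + 1))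
    (J := (2 ^ d) ^ (2 * m + 1)) (N := N) hK (by positivity) (by rw [hcK]; linarith) (by
      rw [hcK, show 2 * d * (m + 2 * d * m) = 2 * d * (2 * d + 1) * m by ring]
      push_cast
      rw [pow_succ, ← hX]
      have : 0 < ((2 : ℝ) ^ d) ^ (2 * d * (2 * d + 1) * m) := by positivity
      nlinarith [mul_le_mul_of_nonneg_left hL4 (mul_pos this hX0).le]) (by
      push_cast
      rw [pow_succ _ (2 * m), mul_comm 2 m, pow_mul, ← hX]
      have h1 : X / (4 * c) ≤ X / 4 := div_le_div_of_nonneg_left hX0.le (by norm_num) (by linarith)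
      have h2 : (X / (4 * c)) ^ 2 ≤ (X / 4) ^ 2 := pow_le_pow_left₀ (by positivity) h1 2
      nlinarith [mul_le_mul_of_nonneg_left h2 (by positivity : (0 : ℝ) ≤ 2 * 2 ^ d),
        (by positivity : (0 : ℝ) ≤ 2 ^ d * X ^ 2)]) (Nat.one_le_iff_ne_zero.2 hN0) (by
      refine le_trans ?_ hmN
      have h1 : m ≤ (2 ^ d) ^ m := (Nat.lt_pow_self (Nat.one_lt_pow (by omega) (by norm_num))).le
      calc _ ≤ (2 ^ d) ^ (2 * m + 1) * ((2 ^ d) ^ (2 * d * (2 * d + 1) * m + 1) * (2 ^ d) ^ m) := by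
            gcongr
        _ = (2 ^ d) ^ (2 * m + 1 + (2 * d * (2 * d + 1) * m + 1 + m)) := by
            rw [← pow_add, ← pow_add]
        _ ≤ (2 ^ d) ^ (s * m) := by
            refine Nat.pow_le_pow_right (by positivity) ?_
            rw [hs, add_mul]
            omega
        _ = _ := pow_mul _ _ _)
  refine hkey.trans (ENNReal.ofReal_le_ofReal ?_)
  have hs0 : s ≠ 0 := by omega
  have hroot : (N : ℝ) ^ ((s : ℝ)⁻¹) ≤ X * 2 ^ d := by
    have h1 : (N : ℝ) ≤ (X * 2 ^ d) ^ s := by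
      have : (N : ℝ) ≤ (((2 : ℝ) ^ d) ^ s) ^ (m + 1) := by exact_mod_cast hNm.le
      rwa [pow_right_comm, pow_succ _ m, ← hX] at this
    have h2 := Real.rpow_le_rpow (Nat.cast_nonneg N) h1 (by positivity : (0 : ℝ) ≤ (s : ℝ)⁻¹)
    rwa [Real.pow_rpow_inv_natCast (by positivity) hs0] at h2
  have hNpos : (0 : ℝ) < (N : ℝ) ^ ((s : ℝ)⁻¹) :=
    Real.rpow_pos_of_pos (by exact_mod_cast Nat.pos_of_ne_zero hN0) _
  have hfin : X⁻¹ ≤ 2 ^ d * (N : ℝ) ^ (-(s : ℝ)⁻¹) := by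
    rw [Real.rpow_neg (Nat.cast_nonneg N), ← div_eq_mul_inv, le_div_iff₀ hNpos,
      inv_mul_le_iff₀ hX0]
    exact hroot
  calc _ = C' * X⁻¹ := by rw [hC', div_div_eq_mul_div]; field_simp; ring
    _ ≤ C' * (2 ^ d * (N : ℝ) ^ (-(s : ℝ)⁻¹)) := by gcongr
    _ = _ := by ring

end UpperBound

/-! ### Directions almost orthogonal to a vector -/

section Slabs

lemma volume_slab_inter_cube_le {d : ℕ} (z : Fin d → ℝ) (i : Fin d) (hz : z i ≠ 0) {r : ℝ}
    (hr : 0 ≤ r) :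
    volume {x : Fin d → ℝ | (∀ j, |x j| ≤ 1) ∧ |∑ j, z j * x j| ≤ r} ≤
      ENNReal.ofReal (2 ^ d * (r / |z i|)) := by
  -- the linear map replacing the `i`-th coordinate of `x` by `∑ j, z j * x j`
  set f := Matrix.toLin' ((1 : Matrix (Fin d) (Fin d) ℝ).updateRow i z) with hf
  have hdet : LinearMap.det f = z i := by
    rw [hf, LinearMap.det_toLin', ← Matrix.cramer_transpose_apply, Matrix.transpose_one,
      Matrix.cramer_one]
    rfl
  set b : Fin d → ℝ := Function.update 1 i r with hb
  have hsub : {x : Fin d → ℝ | (∀ j, |x j| ≤ 1) ∧ |∑ j, z j * x j| ≤ r} ⊆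
      f ⁻¹' Set.Icc (-b) b := by
    rintro x ⟨hx1, hx2⟩
    have hfx : ∀ j, |f x j| ≤ b j := by
      intro j
      rw [hf, Matrix.toLin'_apply, Matrix.mulVec, hb]
      rcases eq_or_ne j i with rfl | hj
      · simpa [Matrix.updateRow_self, dotProduct] using hx2
      · rw [Matrix.updateRow_ne hj, Function.update_of_ne hj]
        simpa [dotProduct, Matrix.one_apply] using hx1 j
    exact Set.mem_Icc.2 ⟨fun j => (abs_le.1 (hfx j)).1, fun j => (abs_le.1 (hfx j)).2⟩
  refine (measure_mono hsub).trans ?_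
  rw [Measure.addHaar_preimage_linearMap _ (by rwa [hdet]), hdet, Real.volume_Icc_pi,
    ← ENNReal.ofReal_prod_of_nonneg, ← ENNReal.ofReal_mul (abs_nonneg _)]
  · refine ENNReal.ofReal_le_ofReal (le_of_eq ?_)
    have h1 : ∀ j ∈ Finset.univ.erase i, b j - (-b) j = 2 := by
      intro j hj
      rw [hb, Pi.neg_apply, Function.update_of_ne (Finset.ne_of_mem_erase hj)]
      norm_num
    have h2 : b i - (-b) i = 2 * r := by
      rw [hb, Pi.neg_apply, Function.update_self]
      ring
    have hd : d = d - 1 + 1 := by have := i.pos; omega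
    rw [← Finset.mul_prod_erase _ _ (Finset.mem_univ i), Finset.prod_congr rfl h1,
      Finset.prod_const, Finset.card_erase_of_mem (Finset.mem_univ i), Finset.card_univ,
      Fintype.card_fin, h2, abs_inv]
    conv_rhs => rw [hd, pow_succ]
    ring
  · intro j _
    have : 0 ≤ b j := by
      rw [hb]
      rcases eq_or_ne j i with rfl | hj
      · rwa [Function.update_self]
      · rw [Function.update_of_ne hj]; exact zero_le_one
    rw [Pi.neg_apply]
    linarith

lemma toSphere_slab_le {d : ℕ} (z : EuclideanSpace ℝ (Fin d)) (i : Fin d) (hz : z i ≠ 0)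
    {r : ℝ} (hr : 0 ≤ r) :
    (volume : Measure (EuclideanSpace ℝ (Fin d))).toSphere
      {θ | |inner ℝ z (θ : EuclideanSpace ℝ (Fin d))| ≤ r} ≤
      ENNReal.ofReal (d * (2 ^ d * (r / |z i|))) := by
  have hm : MeasurableSet {θ : Metric.sphere (0 : EuclideanSpace ℝ (Fin d)) 1 |
      |inner ℝ z (θ : EuclideanSpace ℝ (Fin d))| ≤ r} :=
    (isClosed_le (by fun_prop) continuous_const).measurableSet
  rw [Measure.toSphere_apply' _ hm, finrank_euclideanSpace_fin, ENNReal.ofReal_mul (by positivity),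
    ENNReal.ofReal_natCast]
  refine mul_le_mul_right ?_ _
  refine (measure_mono ?_).trans
    (((PiLp.volume_preserving_ofLp (Fin d)).measure_preimage_le _).trans
      (volume_slab_inter_cube_le (fun j => z j) i hz hr))
  rintro _ ⟨t, ht, _, ⟨θ, hθ, rfl⟩, rfl⟩
  refine ⟨fun j => ?_, ?_⟩
  · have := abs_coord_sphere_le θ j
    change |t * (θ : EuclideanSpace ℝ (Fin d)) j| ≤ 1
    rw [abs_mul, abs_of_pos ht.1]
    nlinarith [ht.1, ht.2, abs_nonneg ((θ : EuclideanSpace ℝ (Fin d)) j)]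
  · have h1 : ∑ j, z j * (t • (θ : EuclideanSpace ℝ (Fin d))) j =
        t * inner ℝ z (θ : EuclideanSpace ℝ (Fin d)) := by
      simp only [PiLp.inner_apply, Finset.mul_sum, PiLp.smul_apply, smul_eq_mul]
      exact Finset.sum_congr rfl fun j _ => by simp; ring
    change |∑ j, z j * (t • (θ : EuclideanSpace ℝ (Fin d))) j| ≤ r
    rw [h1, abs_mul, abs_of_pos ht.1]
    refine le_trans ?_ (show |inner ℝ z (θ : EuclideanSpace ℝ (Fin d))| ≤ r from hθ)
    exact mul_le_of_le_one_left (abs_nonneg _) ht.2.le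

end Slabs

/-! ### Pairs of corners -/

section CommonPrefix

/-- The length of the longest common prefix of two words. -/
def commonPrefixLength {α : Type*} [DecidableEq α] : List α → List α → ℕ
  | a :: u, b :: w => if a = b then commonPrefixLength u w + 1 else 0
  | _, _ => 0

lemma commonPrefixLength_self {α : Type*} [DecidableEq α] (w : List α) :
    commonPrefixLength w w = w.length := by
  induction w with
  | nil => rfl
  | cons a w ih => simp [commonPrefixLength, ih]

lemma sum_pow_commonPrefixLength_le {α : Type*} [Fintype α] [DecidableEq α] (n : ℕ) :
    ∑ u ∈ words α n, ∑ w ∈ words α n, (Fintype.card α : ℝ) ^ commonPrefixLength u w ≤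
      (n + 1) * ((Fintype.card α : ℝ) ^ n) ^ 2 := by
  set L : ℝ := (Fintype.card α : ℝ)
  have hL : 0 ≤ L := Nat.cast_nonneg _
  induction n with
  | zero => simp [card_words, sum_words_zero, commonPrefixLength]
  | succ n ih =>
    have h1 : ∀ a b : α, ∑ u ∈ words α n, ∑ w ∈ words α n,
        L ^ commonPrefixLength (a :: u) (b :: w) ≤
        (if a = b then L * ((n + 1) * (L ^ n) ^ 2) else 0) + (L ^ n) ^ 2 := by
      intro a b
      by_cases hab : a = b
      · simp only [commonPrefixLength, hab, if_true, pow_succ _ (commonPrefixLength _ _),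
          ← Finset.sum_mul]
        nlinarith [mul_le_mul_of_nonneg_left ih hL, sq_nonneg (L ^ n)]
      · simp only [commonPrefixLength, hab, if_false, pow_zero, Finset.sum_const, card_words,
          nsmul_eq_mul, mul_one, zero_add]
        push_cast
        exact (sq _).ge
    calc _ = ∑ a : α, ∑ b : α, ∑ u ∈ words α n, ∑ w ∈ words α n,
          L ^ commonPrefixLength (a :: u) (b :: w) := by
          rw [sum_words_succ]
          refine Finset.sum_congr rfl fun a _ => ?_
          rw [Finset.sum_comm, sum_words_succ]
          exact Finset.sum_congr rfl fun b _ => Finset.sum_comm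
      _ ≤ ∑ a : α, ∑ b : α,
          ((if a = b then L * ((n + 1) * (L ^ n) ^ 2) else 0) + (L ^ n) ^ 2) :=
          Finset.sum_le_sum fun a _ => Finset.sum_le_sum fun b _ => h1 a b
      _ = _ := by
          simp only [Finset.sum_add_distrib, Finset.sum_ite_eq, Finset.mem_univ, if_true,
            Finset.sum_const, Finset.card_univ, nsmul_eq_mul]
          push_cast
          ring

/-- Distinct corners sharing the first `k` digits are `(2^d)^(-k) / 2` apart in some coordinate. -/
lemma exists_le_abs_cornerPoint_sub {d : ℕ} (hd : 2 ≤ d) {u w : List (Fin d → Bool)}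
    (huw : u.length = w.length) (hne : u ≠ w) :
    ∃ i, (((2 : ℝ) ^ d) ^ commonPrefixLength u w)⁻¹ / 2 ≤ |(cornerPoint u - cornerPoint w) i| := by
  have hL4 : (4 : ℝ) ≤ 2 ^ d := by
    have : (2 : ℝ) ^ 2 ≤ 2 ^ d := pow_le_pow_right₀ (by norm_num) hd
    linarith
  have hcons : ∀ (a : Fin d → Bool) u i, cornerPoint (a :: u) i =
      ((2 ^ d - 1) * (if a i then 1 else 0) + cornerPoint u i) / 2 ^ d := by
    intro a u i
    rw [cornerPoint_apply, pos, card_corner]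
    rfl
  induction u generalizing w with
  | nil => exact absurd (List.length_eq_zero_iff.1 huw.symm).symm hne
  | cons a u ih =>
    cases w with
    | nil => simp at huw
    | cons b w =>
      simp only [PiLp.sub_apply, hcons] at ih ⊢
      by_cases hab : a = b
      · subst hab
        obtain ⟨i, hi⟩ := ih (by simpa using huw) (by simpa using hne)
        refine ⟨i, ?_⟩
        rw [commonPrefixLength, if_pos rfl, pow_succ, ← sub_div, add_sub_add_left_eq_sub, abs_div,
          abs_of_pos (by positivity : (0 : ℝ) < 2 ^ d), mul_inv]
        rw [le_div_iff₀ (by positivity)]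
        refine le_trans (le_of_eq ?_) hi
        field_simp
      · obtain ⟨i, hi⟩ := Function.ne_iff.1 hab
        refine ⟨i, ?_⟩
        have hu := Set.mem_Icc.1 (cornerPoint_mem_Icc u i)
        have hw := Set.mem_Icc.1 (cornerPoint_mem_Icc w i)
        have hu1 : cornerPoint u i ≤ 1 := hu.2.trans (sub_le_self _ (by positivity))
        have hw1 : cornerPoint w i ≤ 1 := hw.2.trans (sub_le_self _ (by positivity))
        rw [commonPrefixLength, if_neg hab, pow_zero, inv_one, ← sub_div, abs_div,
          abs_of_pos (by positivity : (0 : ℝ) < 2 ^ d), le_div_iff₀ (by positivity), le_abs]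
        cases ha : a i <;> cases hb : b i <;> simp [ha, hb] at hi ⊢
        · right; linarith [hu.1, hw.1]
        · left; linarith [hu.1, hw.1]

end CommonPrefix

/-! ### The second moment method -/

section SecondMoment

variable {α : Type*} [Fintype α] [DecidableEq α] {v : α → ℝ} {D : ℝ}

/-- The second moment method: the union of the intervals is long if the energy is small. -/
lemma sub_energy_le_volume [Nonempty α] (hD : 0 ≤ D) (n : ℕ) (t : ℝ) :
    2 * t * (2 * D) - t ^ 2 * energy v D n ≤ volume.real {x | 1 ≤ stack v D n x} := by
  have hU : {x | 1 ≤ stack v D n x} =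
      ⋃ w ∈ words α n, Metric.closedBall (pos v w) (D * ((Fintype.card α : ℝ) ^ n)⁻¹) := by
    ext x
    rw [Set.mem_ofPred_eq, one_le_stack_iff]
    simp
  have hUm : MeasurableSet {x | 1 ≤ stack v D n x} :=
    measurableSet_le measurable_const (measurable_stack n)
  have hUfin : volume {x | 1 ≤ stack v D n x} ≠ ⊤ := by
    rw [hU]
    exact ((measure_biUnion_finset_le _ _).trans_lt
      (ENNReal.sum_lt_top.2 fun _ _ => measure_closedBall_lt_top)).ne
  have h1 : ∫ x, (2 * t * stack v D n x - t ^ 2 * stack v D n x ^ 2) =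
      2 * t * (2 * D) - t ^ 2 * energy v D n := by
    rw [integral_sub ((integrable_stack n).const_mul _) ((integrable_stack_sq n).const_mul _),
      integral_const_mul, integral_const_mul, integral_stack hD, energy]
  rw [← h1, ← mul_one (volume.real _), ← smul_eq_mul (volume.real _),
    ← integral_indicator_const _ hUm]
  refine integral_mono (((integrable_stack n).const_mul _).sub
    ((integrable_stack_sq n).const_mul _)) ((integrable_indicator_iff hUm).2
      (integrableOn_const hUfin)) fun x => ?_
  dsimp only
  rcases stack_eq_zero_or_one_le (v := v) (D := D) n x with h | h
  · rw [h, Set.indicator_of_notMem (by rw [Set.mem_ofPred_eq, h]; norm_num)]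
    simp
  · rw [Set.indicator_of_mem (by exact h)]
    nlinarith [sq_nonneg (t * stack v D n x - 1)]

/-- The energy counts the pairs of words with overlapping intervals. The radius `1 / 2` makes the
intervals lie inside the projection of the thickening of the corners. -/
lemma energy_half_le (n : ℕ) :
    energy v (1 / 2) n ≤ ∑ u ∈ words α n, ∑ w ∈ words α n,
      if |pos v u - pos v w| ≤ ((Fintype.card α : ℝ) ^ n)⁻¹ then
        ((Fintype.card α : ℝ) ^ n)⁻¹ else 0 := by
  set δ : ℝ := ((Fintype.card α : ℝ) ^ n)⁻¹ with hδ
  have hδ0 : 0 ≤ δ := by positivity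
  have hm : ∀ u w : List α, MeasurableSet (Metric.closedBall (pos v u) (1 / 2 * δ) ∩
      Metric.closedBall (pos v w) (1 / 2 * δ)) := fun u w =>
    Metric.isClosed_closedBall.measurableSet.inter Metric.isClosed_closedBall.measurableSet
  have h1 : ∀ x, stack v (1 / 2) n x ^ 2 = ∑ u ∈ words α n, ∑ w ∈ words α n,
      (Metric.closedBall (pos v u) (1 / 2 * δ) ∩
        Metric.closedBall (pos v w) (1 / 2 * δ)).indicator (fun _ => (1 : ℝ)) x := by
    intro x
    rw [sq, stack, Finset.sum_mul_sum]
    refine Finset.sum_congr rfl fun u _ => Finset.sum_congr rfl fun w _ => ?_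
    rw [← Set.inter_indicator_mul (fun _ => (1 : ℝ)) (fun _ => (1 : ℝ)) x, one_mul]
  have hfin : ∀ u w : List α, volume (Metric.closedBall (pos v u) (1 / 2 * δ) ∩
      Metric.closedBall (pos v w) (1 / 2 * δ)) ≠ ⊤ := fun u w =>
    ((measure_mono Set.inter_subset_left).trans_lt measure_closedBall_lt_top).ne
  have hint : ∀ u w : List α, Integrable ((Metric.closedBall (pos v u) (1 / 2 * δ) ∩
      Metric.closedBall (pos v w) (1 / 2 * δ)).indicator (fun _ => (1 : ℝ))) := fun u w =>
    (integrable_indicator_iff (hm u w)).2 (integrableOn_const (hfin u w))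
  rw [energy]
  simp only [h1]
  rw [integral_finsetSum _ fun u _ => integrable_finsetSum _ fun w _ => hint u w]
  refine Finset.sum_le_sum fun u _ => ?_
  rw [integral_finsetSum _ fun w _ => hint u w]
  refine Finset.sum_le_sum fun w _ => ?_
  rw [integral_indicator_const _ (hm u w), smul_eq_mul, mul_one]
  split_ifs with h
  · refine (measureReal_mono Set.inter_subset_left measure_closedBall_lt_top.ne).trans ?_
    rw [Measure.real, Real.volume_closedBall, ENNReal.toReal_ofReal (by positivity)]
    linarith
  · have : Metric.closedBall (pos v u) (1 / 2 * δ) ∩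
        Metric.closedBall (pos v w) (1 / 2 * δ) = ∅ := by
      refine Set.eq_empty_of_forall_notMem fun x hx => h ?_
      have hu := Metric.mem_closedBall.1 hx.1
      have hw := Metric.mem_closedBall.1 hx.2
      rw [← Real.dist_eq]
      linarith [dist_triangle_left (pos v u) (pos v w) x]
    rw [this]
    simp

end SecondMoment

/-! ### The lower bound -/

section LowerBound

lemma ofReal_integral_le_lintegral_ofReal {X : Type*} [MeasurableSpace X] {μ : Measure X}
    {f : X → ℝ} (hf : Integrable f μ) :
    ENNReal.ofReal (∫ x, f x ∂μ) ≤ ∫⁻ x, ENNReal.ofReal (f x) ∂μ := by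
  rw [integral_eq_lintegral_pos_part_sub_lintegral_neg_part hf]
  exact (ENNReal.ofReal_le_ofReal (sub_le_self _ ENNReal.toReal_nonneg)).trans
    ENNReal.ofReal_toReal_le

lemma one_le_stack_subset_inner_image {d N : ℕ}
    (θ : Metric.sphere (0 : EuclideanSpace ℝ (Fin d)) 1) :
    {x | 1 ≤ stack (cornerValue fun i => (θ : EuclideanSpace ℝ (Fin d)) i) (1 / 2) N x} ⊆
    (fun x : EuclideanSpace ℝ (Fin d) => inner ℝ x (θ : EuclideanSpace ℝ (Fin d))) ''
      Metric.thickening ((2 : ℝ) ^ (d * N))⁻¹ (cornerCantorSet d) := by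
  intro t ht
  obtain ⟨w, -, hw⟩ := one_le_stack_iff.1 ht
  rw [Metric.mem_closedBall, Real.dist_eq, card_corner, ← pow_mul, ← inner_cornerPoint] at hw
  have hθ : ‖(θ : EuclideanSpace ℝ (Fin d))‖ = 1 := mem_sphere_zero_iff_norm.1 θ.2
  set s := t - inner ℝ (cornerPoint w) (θ : EuclideanSpace ℝ (Fin d)) with hs
  refine ⟨cornerPoint w + s • (θ : EuclideanSpace ℝ (Fin d)), Metric.mem_thickening_iff.2
    ⟨cornerPoint w, cornerPoint_mem_cornerCantorSet w, ?_⟩, ?_⟩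
  · rw [dist_eq_norm, add_sub_cancel_left, norm_smul, hθ, mul_one, Real.norm_eq_abs]
    have : (0 : ℝ) < ((2 : ℝ) ^ (d * N))⁻¹ := by positivity
    linarith
  · dsimp only
    rw [inner_add_left, real_inner_smul_left, real_inner_self_eq_norm_sq, hθ, hs]
    ring

/-- Two corners whose addresses share `k` letters project to within `2^{-dN}` of each other only in
a set of directions of measure `O(2^{-dN} 2^{dk})`; this includes the trivial bound for `u = w`. -/
lemma toSphere_real_collision_le {d : ℕ} (hd : 2 ≤ d) {N : ℕ} {u w : List (Fin d → Bool)}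
    (hu : u.length = N) (hw : w.length = N) :
    (volume : Measure (EuclideanSpace ℝ (Fin d))).toSphere.real
      {θ | |inner ℝ (cornerPoint u - cornerPoint w) (θ : EuclideanSpace ℝ (Fin d))| ≤
        (((2 : ℝ) ^ d) ^ N)⁻¹} ≤
      (d * 2 ^ (d + 1) +
        (volume : Measure (EuclideanSpace ℝ (Fin d))).toSphere.real Set.univ) *
        ((((2 : ℝ) ^ d) ^ N)⁻¹ * (2 ^ d) ^ commonPrefixLength u w) := by
  set σ := (volume : Measure (EuclideanSpace ℝ (Fin d))).toSphere
  have hS : 0 ≤ σ.real Set.univ := measureReal_nonneg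
  by_cases huw : u = w
  · subst huw
    rw [commonPrefixLength_self, hu, inv_mul_cancel₀ (by positivity), mul_one]
    exact (measureReal_mono (Set.subset_univ _)).trans (le_add_of_nonneg_left (by positivity))
  · obtain ⟨i, hi⟩ := exists_le_abs_cornerPoint_sub hd (hu.trans hw.symm) huw
    set P : ℝ := (2 ^ d) ^ commonPrefixLength u w with hP
    set δ : ℝ := (((2 : ℝ) ^ d) ^ N)⁻¹ with hδ
    have hP0 : 0 < P := by positivity
    have hδ0 : 0 < δ := by positivity
    have hz : 0 < |(cornerPoint u - cornerPoint w) i| := lt_of_lt_of_le (by positivity) hi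
    have h := ENNReal.toReal_le_of_le_ofReal (by positivity)
      (toSphere_slab_le (cornerPoint u - cornerPoint w) i (abs_pos.1 hz) hδ0.le)
    refine h.trans ?_
    have h2 : δ / |(cornerPoint u - cornerPoint w) i| ≤ δ / (P⁻¹ / 2) :=
      div_le_div_of_nonneg_left hδ0.le (by positivity) hi
    calc _ ≤ d * (2 ^ d * (δ / (P⁻¹ / 2))) := by gcongr
      _ = d * 2 ^ (d + 1) * (δ * P) := by rw [pow_succ]; field_simp
      _ ≤ _ := mul_le_mul_of_nonneg_right (le_add_of_nonneg_right hS) (by positivity)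

/-- The second moment bound averaged over all directions, with a free parameter `t`. -/
lemma sub_le_favardLength_thickening {d : ℕ} (hd : 2 ≤ d) (N : ℕ) (t : ℝ) :
    ENNReal.ofReal (2 * t *
      (volume : Measure (EuclideanSpace ℝ (Fin d))).toSphere.real Set.univ -
      t ^ 2 * ((d * 2 ^ (d + 1) +
        (volume : Measure (EuclideanSpace ℝ (Fin d))).toSphere.real Set.univ) * (N + 1))) ≤
      favardLength (Metric.thickening ((2 : ℝ) ^ (d * N))⁻¹ (cornerCantorSet d)) := by
  set σ := (volume : Measure (EuclideanSpace ℝ (Fin d))).toSphere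
  set c : ℝ := d * 2 ^ (d + 1) + σ.real Set.univ with hc
  set δ : ℝ := (((2 : ℝ) ^ d) ^ N)⁻¹ with hδ
  have hδ0 : 0 < δ := by positivity
  set T : List (Fin d → Bool) → List (Fin d → Bool) →
      Set (Metric.sphere (0 : EuclideanSpace ℝ (Fin d)) 1) := fun u w =>
    {θ | |inner ℝ (cornerPoint u - cornerPoint w) (θ : EuclideanSpace ℝ (Fin d))| ≤ δ} with hT
  have hTm : ∀ u w, MeasurableSet (T u w) := fun u w =>
    (isClosed_le (by fun_prop) continuous_const).measurableSet
  have hTi : ∀ u w, Integrable ((T u w).indicator fun _ => δ) σ := fun u w =>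
    (integrable_const δ).indicator (hTm u w)
  set F : Metric.sphere (0 : EuclideanSpace ℝ (Fin d)) 1 → ℝ := fun θ =>
    ∑ u ∈ words (Fin d → Bool) N, ∑ w ∈ words (Fin d → Bool) N,
      (T u w).indicator (fun _ => δ) θ with hF
  have hFi : Integrable F σ :=
    integrable_finsetSum _ fun u _ => integrable_finsetSum _ fun w _ => hTi u w
  have hFint : ∫ θ, F θ ∂σ ≤ c * (N + 1) := by
    rw [hF, integral_finsetSum _ fun u _ => integrable_finsetSum _ fun w _ => hTi u w]
    calc _ ≤ ∑ u ∈ words (Fin d → Bool) N, ∑ w ∈ words (Fin d → Bool) N,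
          c * δ ^ 2 * (2 ^ d) ^ commonPrefixLength u w := by
          refine Finset.sum_le_sum fun u hu => ?_
          rw [integral_finsetSum _ fun w _ => hTi u w]
          refine Finset.sum_le_sum fun w hw => ?_
          rw [integral_indicator_const _ (hTm u w), smul_eq_mul]
          have := toSphere_real_collision_le hd (mem_words.1 hu) (mem_words.1 hw)
          nlinarith
      _ ≤ c * δ ^ 2 * ((N + 1) * ((2 ^ d) ^ N) ^ 2) := by
          simp only [← Finset.mul_sum]
          have := sum_pow_commonPrefixLength_le (α := Fin d → Bool) N
          rw [card_corner] at this
          exact mul_le_mul_of_nonneg_left this (by positivity)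
      _ = c * (N + 1) := by
          rw [hδ]; field_simp
  have hpt : ∀ θ : Metric.sphere (0 : EuclideanSpace ℝ (Fin d)) 1,
      ENNReal.ofReal (2 * t - t ^ 2 * F θ) ≤ Measure.hausdorffMeasure (1 : ℝ)
        ((fun x : EuclideanSpace ℝ (Fin d) => inner ℝ x (θ : EuclideanSpace ℝ (Fin d))) ''
          Metric.thickening ((2 : ℝ) ^ (d * N))⁻¹ (cornerCantorSet d)) := by
    intro θ
    rw [hausdorffMeasure_real]
    refine le_trans ?_ (measure_mono (one_le_stack_subset_inner_image θ))
    have h1 := sub_energy_le_volume (v := cornerValue fun i => (θ : EuclideanSpace ℝ (Fin d)) i)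
      (D := 1 / 2) (by norm_num) N t
    have h2 : energy (cornerValue fun i => (θ : EuclideanSpace ℝ (Fin d)) i) (1 / 2) N ≤ F θ := by
      refine (energy_half_le N).trans (le_of_eq ?_)
      refine Finset.sum_congr rfl fun u _ => Finset.sum_congr rfl fun w _ => ?_
      simp only [hT, Set.indicator_apply, Set.mem_ofPred_eq, inner_sub_left, inner_cornerPoint,
        card_corner, hδ]
    refine (ENNReal.ofReal_le_ofReal ?_).trans (ENNReal.ofReal_toReal_le (a := volume _))
    rw [← Measure.real]
    nlinarith [mul_le_mul_of_nonneg_left h2 (sq_nonneg t)]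
  refine le_trans ?_ (lintegral_mono hpt)
  refine le_trans (ENNReal.ofReal_le_ofReal ?_)
    (ofReal_integral_le_lintegral_ofReal (μ := σ) (f := fun θ => 2 * t - t ^ 2 * F θ)
      ((integrable_const _).sub (hFi.const_mul _)))
  rw [integral_sub (integrable_const _) (hFi.const_mul _), integral_const, integral_const_mul,
    smul_eq_mul]
  nlinarith [mul_le_mul_of_nonneg_left hFint (sq_nonneg t)]

lemma exists_le_favardLength_thickening {d : ℕ} (hd : 2 ≤ d) :
    ∃ c : ℝ, 0 < c ∧ ∀ N : ℕ, 1 ≤ N → ENNReal.ofReal (c * (N : ℝ)⁻¹) ≤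
      favardLength (Metric.thickening ((2 : ℝ) ^ (d * N))⁻¹ (cornerCantorSet d)) := by
  set S := (volume : Measure (EuclideanSpace ℝ (Fin d))).toSphere.real Set.univ with hS
  have hS0 : 0 < S := by
    have : Nontrivial (EuclideanSpace ℝ (Fin d)) := by
      have : Nonempty (Fin d) := ⟨⟨0, by omega⟩⟩
      infer_instance
    rw [hS, Measure.toSphere_real_apply_univ, finrank_euclideanSpace_fin]
    have h1 : 0 < volume.real (Metric.ball (0 : EuclideanSpace ℝ (Fin d)) 1) :=
      ENNReal.toReal_pos (Metric.measure_ball_pos _ _ one_pos).ne' measure_ball_lt_top.ne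
    have h2 : (0 : ℝ) < d := by exact_mod_cast (by omega : 0 < d)
    positivity
  set b : ℝ := d * 2 ^ (d + 1) + S with hb
  have hb0 : 0 < b := by positivity
  refine ⟨S ^ 2 / (2 * b), by positivity, fun N hN => ?_⟩
  -- the choice of `t` maximizing the quadratic lower bound
  refine le_trans (ENNReal.ofReal_le_ofReal ?_)
    (sub_le_favardLength_thickening hd N (S / (b * (N + 1))))
  rw [← hS, ← hb]
  have hN' : (1 : ℝ) ≤ N := by exact_mod_cast hN
  have h1 : 2 * (S / (b * (N + 1))) * S - (S / (b * (N + 1))) ^ 2 * (b * (N + 1)) =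
      S ^ 2 / (b * (N + 1)) := by field_simp; ring
  rw [h1, ← div_eq_mul_inv, div_div]
  exact div_le_div_of_nonneg_left (by positivity) (by positivity) (by nlinarith)

end LowerBound

theorem theorem1p1 (d : ℕ) (hd : 2 ≤ d) :
    ∃ ε : ℝ, 0 < ε ∧ ε < 1 ∧ ∃ C : ℝ, 0 < C ∧ ∃ N₀ : ℕ, ∀ N : ℕ, N₀ ≤ N →
      ENNReal.ofReal (C⁻¹ * (N : ℝ)⁻¹) ≤
        favardLength (Metric.thickening ((2 : ℝ) ^ (d * N))⁻¹ (cornerCantorSet d)) ∧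
      favardLength (Metric.thickening ((2 : ℝ) ^ (d * N))⁻¹ (cornerCantorSet d)) ≤
        ENNReal.ofReal (C * (N : ℝ) ^ (-ε)) := by
  obtain ⟨c, hc, hlow⟩ := exists_le_favardLength_thickening hd
  obtain ⟨C, hC, N₀, hup⟩ := exists_favardLength_thickening_le hd
  refine ⟨((2 * d * (2 * d + 1) + 5 : ℕ) : ℝ)⁻¹, by positivity, ?_, max C c⁻¹,
    lt_max_of_lt_left hC, max N₀ 1, fun N hN => ⟨?_, ?_⟩⟩
  · exact inv_lt_one_of_one_lt₀ (by exact_mod_cast (by omega))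
  · refine le_trans (ENNReal.ofReal_le_ofReal ?_) (hlow N (le_of_max_le_right hN))
    gcongr
    exact inv_le_of_inv_le₀ hc (le_max_right _ _)
  · refine (hup N (le_of_max_le_left hN)).trans (ENNReal.ofReal_le_ofReal ?_)
    gcongr
    exact le_max_left _ _
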